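/- **Theorem 1 (Schwartz's Poncelet grid theorem).** Regard $\mathbb R^2$ as an affine chart of $\mathbb{RP}^2$. Let $\gamma,\Gamma\subset\mathbb R^2$ be nested ellipses, $\gamma$ strictly inside $\Gamma$. If no projective transformation takes $\gamma,\Gamma$ to a pair of concentric circles, then the complexifications of $\gamma$ and $\Gamma$ have exactly four common tangent lines in $\mathbb{CP}^2$. Moreover, there is a projective transformation $T$ of $\mathbb{RP}^2$, depending only on $\gamma$ and $\Gamma$, that takes $\gamma$ and $\Gamma$ to confocal ellipses (possibly concentric circles), centred at the origin and with axes along the coordinate axes, such that the following holds. Let $n\ge 3$ be odd and consider a Poncelet $n$-gon: a closed polygon (convex or star-shaped) with $n$ distinct vertices on $\Gamma$, all of whose side lines are tangent to $\gamma$. Let $\ell_i$, $i\in\mathbb Z/n$, be the lines containing its sides, enumerated so that their tangency points with $\gamma$ are in cyclic order; let $\ell_i\cap\ell_i$ denote the tangency point of $\ell_i$ with $\gamma$, and put $$P_k=\bigcup_{i-j=k}\ell_i\cap\ell_j,\qquad Q_k=\bigcup_{i+j=k}\ell_i\cap\ell_j\qquad(k\in\mathbb Z/n),$$ where the intersections are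 taken in $\mathbb{RP}^2$. 1. There are conics $E_0,\dots,E_{(n-1)/2}$ with $P_k\subset E_k$ such that the $T(E_k)$ are nested ellipses: $T(E_j)$ is strictly inside $T(E_k)$ for $j<k$. Every common complex tangent line of $\gamma$ and $\Gamma$ is tangent to the complexification of every $E_k$. 2. The sets $P_k$ are all projectively equivalent to each other; indeed, for all $j,k$ some invertible linear map of $\mathbb R^2$ takes $T(P_j)$ onto $T(P_k)$. 3. Suppose that no projective transformation other than the identity preserves $\gamma$, $\Gamma$ and the polygon. Then there are nondegenerate hyperbolas $H_k$, $k\in\mathbb Z/n$, pairwise disjoint in $\mathbb{RP}^2$, with $Q_k\subset H_k$; the images $T(H_k)$ are hyperbolas too; and every common complex tangent line of $\gamma$ and $\Gamma$ is tangent to the complexification of every $H_k$. The sets $Q_k$ are all projectively equivalent to each other; indeed, for all $j,k$ some invertible linear map of $\mathbb R^2$ takes $T(Q_j)$ onto $T(Q_k)$. -/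

import Mathlib

open scoped LinearAlgebra.Projectivization Pointwise Matrix

noncomputable section

namespace PonceletGrid

/-- Symmetric `3 × 3` matrices are the conics of the projective plane. -/
abbrev Mat (K : Type*) := Matrix (Fin 3) (Fin 3) K

/-- The projective plane over `K`, in homogeneous coordinates `[x : y : z]`.
The affine plane is the chart `z ≠ 0`, the line at infinity is `z = 0`. -/
abbrev Plane (K : Type*) [Field K] := ℙ K (Fin 3 → K)

/-- Lines of the projective plane: `[a : b : c]` stands for the line `a x + b y + c z = 0`. -/
abbrev Line (K : Type*) [Field K] := ℙ K (Fin 3 → K)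

/-- The point `p` lies on the line `u`. -/
def OnLine {K : Type*} [Field K] (p : Plane K) (u : Line K) : Prop :=
  Projectivization.orthogonal u p

/-- The quadratic form of the matrix `M`. -/
def quad {K : Type*} [Field K] (M : Mat K) (w : Fin 3 → K) : K := w ⬝ᵥ (M *ᵥ w)

theorem quad_smul {K : Type*} [Field K] (M : Mat K) (c : K) (w : Fin 3 → K) :
    quad M (c • w) = c ^ 2 * quad M w := by
  simp only [quad, Matrix.mulVec_smul, smul_dotProduct, dotProduct_smul, smul_eq_mul]
  ring

/-- The points of the conic with matrix `M`. -/
def locus {K : Type*} [Field K] (M : Mat K) : Set (Plane K) := {p | quad M p.rep = 0}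

/-- A line is tangent to a (nondegenerate) conic if it has exactly one point in common with it. -/
def IsTangent {K : Type*} [Field K] (M : Mat K) (u : Line K) : Prop :=
  ∃! p : Plane K, OnLine p u ∧ p ∈ locus M

/-- The complexification of a real conic. -/
def complexify (M : Mat ℝ) : Mat ℂ := M.map Complex.ofReal

/-- The equation of a real ellipse (with nonempty locus) in the affine plane `z ≠ 0`;
circles are ellipses. -/
def IsEllipse (M : Mat ℝ) : Prop :=
  M.IsSymm ∧ 0 < M 0 0 * M 1 1 - M 0 1 ^ 2 ∧ (M 0 0 + M 1 1) * M.det < 0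

/-- The equation of a nondegenerate hyperbola in the affine plane `z ≠ 0`. -/
def IsHyperbola (M : Mat ℝ) : Prop :=
  M.IsSymm ∧ M 0 0 * M 1 1 - M 0 1 ^ 2 < 0 ∧ M.det ≠ 0

/-- The point `p` lies in the open region bounded by the ellipse `M`: there the quadratic form has
the sign opposite to the one of its definite restriction to `z = 0`. -/
def Inside (M : Mat ℝ) (p : Plane ℝ) : Prop := (M 0 0 + M 1 1) * quad M p.rep < 0

/-- The ellipse `M`, with its interior, is contained in the interior of the ellipse `N`. -/
def Nested (M N : Mat ℝ) : Prop := ∀ p : Plane ℝ, p ∈ locus M ∨ Inside M p → Inside N p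

/-- The image of the conic `M` under the projective transformation `g`. -/
def conicImage (g : GL (Fin 3) ℝ) (M : Mat ℝ) : Mat ℝ :=
  ((g⁻¹ : GL (Fin 3) ℝ) : Mat ℝ)ᵀ * M * ((g⁻¹ : GL (Fin 3) ℝ) : Mat ℝ)

/-- The conic `x² / a + y² / b = 1`. -/
def axisConic (a b : ℝ) : Mat ℝ := Matrix.diagonal ![1 / a, 1 / b, -1]

/-- `M` and `N` are the ellipses `x² / a + y² / b = 1` and `x² / (a + c) + y² / (b + c) = 1`
of one confocal family (concentric circles if `a = b`). -/
def AreConfocal (M N : Mat ℝ) : Prop :=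
  ∃ a b c : ℝ, 0 < a ∧ 0 < b ∧ 0 < c ∧
    locus M = locus (axisConic a b) ∧ locus N = locus (axisConic (a + c) (b + c))

/-- Some projective transformation takes `M` and `N` to concentric circles. -/
def ProjectivelyConcentric (M N : Mat ℝ) : Prop :=
  ∃ (g : GL (Fin 3) ℝ) (r s : ℝ), 0 < r ∧ 0 < s ∧
    g • locus M = locus (axisConic (r ^ 2) (r ^ 2)) ∧
    g • locus N = locus (axisConic (s ^ 2) (s ^ 2))

/-- The line `u` contains a side of the closed polygon with consecutive vertices `v i`. -/
def IsSide {n : ℕ} (v : ZMod n → Plane ℝ) (u : Line ℝ) : Prop :=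
  ∃ i, OnLine (v i) u ∧ OnLine (v (i + 1)) u

/-- `v` is a polygon with `n` distinct vertices, inscribed into `Γ` and circumscribed about `γ`
(convex or star-shaped). -/
def IsPonceletPolygon {n : ℕ} (γ Γ : Mat ℝ) (v : ZMod n → Plane ℝ) : Prop :=
  Function.Injective v ∧ (∀ i, v i ∈ locus Γ) ∧ ∀ u, IsSide v u → IsTangent γ u

/-- The point `[cos t : sin t : 1]` of the unit circle. -/
def circlePoint (t : ℝ) : Plane ℝ :=
  Projectivization.mk ℝ ![Real.cos t, Real.sin t, 1]
    (fun h => one_ne_zero (α := ℝ) (by simpa using congrFun h 2))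

/-- The lines `ℓ i`, with cyclic indices, are the lines containing the sides of `v`, enumerated so
that their tangency points with `γ` are in cyclic order. The cyclic order on `γ` (in one or the
other direction) is the one of the unit circle, carried over by a projective transformation `g`;
`θ` is the angle of the tangency points, lifted to the real line. -/
def IsCyclicEnumeration {n : ℕ} (γ : Mat ℝ) (v : ZMod n → Plane ℝ) (ℓ : ZMod n → Line ℝ) : Prop :=
  Set.range ℓ = {u | IsSide v u} ∧
    ∃ (g : GL (Fin 3) ℝ) (θ : ℤ → ℝ),
      g • Set.range circlePoint = locus γ ∧
      StrictMono θ ∧ (∀ i, θ (i + n) = θ i + 2 * Real.pi) ∧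
      ∀ i : ℤ, OnLine (g • circlePoint (θ i)) (ℓ (i : ZMod n))

/-- `ℓ i ∩ ℓ j`, where `ℓ i ∩ ℓ i` means the tangency point of `ℓ i` with `γ`. -/
def gridPoint {n : ℕ} (γ : Mat ℝ) (ℓ : ZMod n → Line ℝ) (i j : ZMod n) : Set (Plane ℝ) :=
  {p | OnLine p (ℓ i) ∧ OnLine p (ℓ j) ∧ (i = j → p ∈ locus γ)}

/-- The set `P_k`. -/
def gridP {n : ℕ} (γ : Mat ℝ) (ℓ : ZMod n → Line ℝ) (k : ZMod n) : Set (Plane ℝ) :=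
  {p | ∃ i j, i - j = k ∧ p ∈ gridPoint γ ℓ i j}

/-- The set `Q_k`. -/
def gridQ {n : ℕ} (γ : Mat ℝ) (ℓ : ZMod n → Line ℝ) (k : ZMod n) : Set (Plane ℝ) :=
  {p | ∃ i j, i + j = k ∧ p ∈ gridPoint γ ℓ i j}

/-- The projective transformation `g` is a linear map of the affine plane `z ≠ 0`. -/
def IsLinear (g : GL (Fin 3) ℝ) : Prop :=
  g 0 2 = 0 ∧ g 1 2 = 0 ∧ g 2 0 = 0 ∧ g 2 1 = 0 ∧ g 2 2 = 1

/-- In the affine coordinates given by `T`, a linear map takes `A` onto `B`. In particular the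
projective transformation `T⁻¹ g T` takes `A` onto `B`. -/
def LinearlyEquivalent (T : GL (Fin 3) ℝ) (A B : Set (Plane ℝ)) : Prop :=
  ∃ g : GL (Fin 3) ℝ, IsLinear g ∧ (T⁻¹ * g * T) • A = B

/-- No projective transformation other than the identity preserves `γ`, `Γ` and the polygon. -/
def HasNoSymmetry {n : ℕ} (γ Γ : Mat ℝ) (v : ZMod n → Plane ℝ) : Prop :=
  ∀ g : GL (Fin 3) ℝ, g • locus γ = locus γ → g • locus Γ = locus Γ →
    g • Set.range v = Set.range v → ∀ p : Plane ℝ, g • p = p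

/-- The complex lines that are tangent to both complexified conics. -/
def commonTangents (M N : Mat ℝ) : Set (Line ℂ) :=
  {u | IsTangent (complexify M) u ∧ IsTangent (complexify N) u}

end PonceletGrid

end

open scoped LinearAlgebra.Projectivization Pointwise Matrix

noncomputable section

namespace PonceletGrid

/-! ### Incidence, conics and projective transformations -/

section Field

variable {K : Type*} [Field K]

/-! Jacobi's elliptic functions parametrize the tangents of the inner conic so that the whole grid
becomes a coordinate net. In suitable projective coordinates γ is the unit circle and Γ is x²/A +
y²/B = 1 with 1 < A ≤ B (`exists_normalForm`). Put m = 1 - (A - 1)/(B - 1), so that 0 ≤ m < 1, and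
write the tangents of γ as sn t · x + cn t · y = 1, with elliptic functions of parameter m. The
tangents with parameters x + y and x - y meet at [sn x dn y : cn x : cn y]; this is
`IsAmplitude.law_of_cosines`. For fixed y with cn y ≠ 0 the point runs on an ellipse. For fixed x
with sn x, cn x ≠ 0, and m > 0, it runs on a hyperbola. Scaling the second coordinate by √(1 - m)
makes all these conics confocal; T is the normalization followed by this scaling.

A vertex on Γ fixes sn² of half the parameter difference of its two sides. Hence consecutive sides
differ by a constant step modulo the period 4K, and since the polygon closes, all sides have
parameters in one coset of (4K/n)ℤ (`IsAmplitude.exists_isSide_eq`). The cyclic order of the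
tangency points then forces ℓ_i to have parameter u₀ + 2iδ with nδ = ±2K
(`IsAmplitude.exists_enumeration`). So ℓ_i ∩ ℓ_j has coordinates x = u₀ + (i + j)δ and y = (i - j)δ:
P_k lies on the curve y = kδ and Q_k on the curve x = u₀ + kδ.

Because the variables separate, moving from one curve of a family to another is a diagonal linear
map. Oddness of n is used twice: every index is even modulo n, so the positions along all the curves
of a family can be matched, and cn(kδ) never vanishes. The hyperbolas degenerate only if m = 0 or if
sn or cn vanishes at some u₀ + kδ; the polygon then has a rotation or an axial reflection as a
symmetry (`IsAmplitude.ne_zero_of_hasNoSymmetry`).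

For the common tangents, dual conics become linear equations in the squared line coordinates. The
solutions are [1 : ±i√(1 - m) : ±√m], four lines when m > 0, and every conic of the net satisfies
the resulting single linear condition. -/

theorem mk_mem_locus {M : Mat K} {w : Fin 3 → K} (hw : w ≠ 0) :
    Projectivization.mk K w hw ∈ locus M ↔ quad M w = 0 := by
  obtain ⟨a, ha⟩ := Projectivization.exists_smul_eq_mk_rep K w hw
  have : (Projectivization.mk K w hw).rep = (a : K) • w := ha.symm
  simp [locus, this, quad_smul]

theorem onLine_mk {p u : Fin 3 → K} (hp : p ≠ 0) (hu : u ≠ 0) :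
    OnLine (Projectivization.mk K p hp) (Projectivization.mk K u hu) ↔ u ⬝ᵥ p = 0 :=
  Iff.rfl

theorem gl_mulVec_ne_zero (g : GL (Fin 3) K) {w : Fin 3 → K} (hw : w ≠ 0) :
    (g : Mat K) *ᵥ w ≠ 0 :=
  (smul_ne_zero_iff_ne g).mpr hw

theorem gl_smul_mk (g : GL (Fin 3) K) {w : Fin 3 → K} (hw : w ≠ 0) :
    g • Projectivization.mk K w hw =
      Projectivization.mk K ((g : Mat K) *ᵥ w) (gl_mulVec_ne_zero g hw) :=
  rfl

theorem mk_eq_mk_of_smul {v w : Fin 3 → K} (hv : v ≠ 0) (hw : w ≠ 0) (a : K)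
    (h : a • w = v) : Projectivization.mk K v hv = Projectivization.mk K w hw :=
  (Projectivization.mk_eq_mk_iff' K v w hv hw).2 ⟨a, h⟩

theorem quad_mulVec (M G : Mat K) (w : Fin 3 → K) :
    quad M (G *ᵥ w) = quad (Gᵀ * M * G) w := by
  simp only [quad, ← Matrix.mulVec_mulVec]
  rw [Matrix.mulVec_transpose, dotProduct_comm, Matrix.dotProduct_mulVec, dotProduct_comm]

theorem dotProduct_mulVec_comm {M : Mat K} (hM : M.IsSymm) (p q : Fin 3 → K) :
    q ⬝ᵥ (M *ᵥ p) = p ⬝ᵥ (M *ᵥ q) := by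
  rw [Matrix.dotProduct_mulVec, ← Matrix.mulVec_transpose, hM.eq, dotProduct_comm]

theorem quad_add_smul {M : Mat K} (hM : M.IsSymm) (p q : Fin 3 → K) (a b : K) :
    quad M (a • p + b • q) =
      a ^ 2 * quad M p + 2 * a * b * (p ⬝ᵥ (M *ᵥ q)) + b ^ 2 * quad M q := by
  simp only [quad, Matrix.mulVec_add, Matrix.mulVec_smul, add_dotProduct, dotProduct_add,
    smul_dotProduct, dotProduct_smul, smul_eq_mul, dotProduct_mulVec_comm hM p q]
  ring

/-- The action of a projective transformation on lines. -/
def dual (g : GL (Fin 3) K) : GL (Fin 3) K where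
  val := ((g⁻¹ : GL (Fin 3) K) : Mat K)ᵀ
  inv := (g : Mat K)ᵀ
  val_inv := by rw [← Matrix.transpose_mul, ← Units.val_mul]; simp
  inv_val := by rw [← Matrix.transpose_mul, ← Units.val_mul]; simp

theorem dual_val (g : GL (Fin 3) K) : (dual g : Mat K) = ((g⁻¹ : GL (Fin 3) K) : Mat K)ᵀ := rfl

theorem onLine_smul_dual (g : GL (Fin 3) K) (p : Plane K) (u : Line K) :
    OnLine (g • p) (dual g • u) ↔ OnLine p u := by
  induction p using Projectivization.ind with | h p hp =>
  induction u using Projectivization.ind with | h u hu =>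
  rw [gl_smul_mk, gl_smul_mk, onLine_mk, onLine_mk, dual_val, Matrix.mulVec_transpose,
    ← Matrix.dotProduct_mulVec, Matrix.mulVec_mulVec, ← Units.val_mul]
  simp

theorem onLine_dual (g : GL (Fin 3) K) (p : Plane K) (u : Line K) :
    OnLine p (dual g • u) ↔ OnLine (g⁻¹ • p) u := by
  rw [← onLine_smul_dual g (g⁻¹ • p), smul_inv_smul]

theorem mk_eq_mk_cross_of_onLine {u p q : Fin 3 → K} (hu : u ≠ 0) (hc : crossProduct p q ≠ 0)
    (h1 : u ⬝ᵥ p = 0) (h2 : u ⬝ᵥ q = 0) :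
    Projectivization.mk K u hu = Projectivization.mk K (crossProduct p q) hc := by
  rw [Projectivization.mk_eq_mk_iff_crossProduct_eq_zero, cross_cross_eq_smul_sub_smul', h2,
    dotProduct_comm p u, h1]
  simp

/-- Two vectors of a line that represent different points span the line. -/
theorem exists_smul_add_smul_of_onLine {u p q r : Fin 3 → K} (hu : u ≠ 0) (hp : p ≠ 0) (hq : q ≠ 0)
    (hpq : Projectivization.mk K p hp ≠ Projectivization.mk K q hq)
    (h1 : u ⬝ᵥ p = 0) (h2 : u ⬝ᵥ q = 0) (h3 : u ⬝ᵥ r = 0) :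
    ∃ a b : K, r = a • p + b • q := by
  have hc : crossProduct p q ≠ 0 := by
    rwa [ne_eq, Projectivization.mk_eq_mk_iff_crossProduct_eq_zero] at hpq
  obtain ⟨k, hk⟩ := (Projectivization.mk_eq_mk_iff' K _ _ hc hu).1
    (mk_eq_mk_cross_of_onLine hu hc h1 h2).symm
  have h4 : r ⬝ᵥ crossProduct p q = 0 := by
    rw [← hk, dotProduct_smul, dotProduct_comm, h3, smul_zero]
  obtain ⟨i, hi⟩ := Function.ne_iff.1 hc
  set e : Fin 3 → K := Pi.single i 1
  -- Cramer's rule in the frame p, q, e, where det(p, q, e) ≠ 0. The coefficient of e is det(r, p,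
  -- q), which vanishes because p × q is proportional to u.
  have key : crossProduct p q i • r = (r ⬝ᵥ crossProduct q e) • p + (r ⬝ᵥ crossProduct e p) • q +
      (r ⬝ᵥ crossProduct p q) • e := by
    have : crossProduct p q i = crossProduct p q ⬝ᵥ e := by simp [e]
    rw [this]
    ext j
    fin_cases j <;> simp [cross_apply, dotProduct, Fin.sum_univ_three] <;> ring
  rw [h4, zero_smul, add_zero] at key
  refine ⟨(crossProduct p q i)⁻¹ * (r ⬝ᵥ crossProduct q e),
    (crossProduct p q i)⁻¹ * (r ⬝ᵥ crossProduct e p), ?_⟩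
  rw [mul_smul, mul_smul, ← smul_add, ← key, inv_smul_smul₀ hi]

/-- Two different lines meet in at most one point. -/
theorem eq_of_onLine_of_onLine {p q : Plane K} {u w : Line K} (huw : u ≠ w) (h1 : OnLine p u)
    (h2 : OnLine p w) (h3 : OnLine q u) (h4 : OnLine q w) : p = q := by
  induction p using Projectivization.ind with | h p hp =>
  induction q using Projectivization.ind with | h q hq =>
  induction u using Projectivization.ind with | h u hu =>
  induction w using Projectivization.ind with | h w hw =>
  rw [onLine_mk] at h1 h2 h3 h4
  by_contra hpq
  have hc : crossProduct p q ≠ 0 := by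
    rwa [Projectivization.mk_eq_mk_iff_crossProduct_eq_zero] at hpq
  exact huw ((mk_eq_mk_cross_of_onLine hu hc h1 h3).trans
    (mk_eq_mk_cross_of_onLine hw hc h2 h4).symm)

/-- There is a line through any two points. -/
theorem exists_onLine (p q : Plane K) : ∃ u : Line K, OnLine p u ∧ OnLine q u := by
  classical
  by_cases h : p = q
  · subst h
    induction p using Projectivization.ind with | h p hp =>
    obtain ⟨i, hi⟩ := Function.ne_iff.1 hp
    obtain ⟨j, hj⟩ : ∃ j, j ≠ i := exists_ne i
    have hne : (Pi.single i (p j) - Pi.single j (p i) : Fin 3 → K) ≠ 0 := fun h0 => hi (by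
      simpa [hj] using congrFun h0 j)
    exact ⟨Projectivization.mk K _ hne, by
      constructor <;> rw [onLine_mk, sub_dotProduct] <;> simp [mul_comm]⟩
  · exact ⟨Projectivization.cross p q, Projectivization.cross_orthogonal_left h,
      Projectivization.cross_orthogonal_right h⟩

theorem det_eq_zero_of_mulVec_onLine {M : Mat K} {u p q : Fin 3 → K}
    (hp : p ≠ 0) (hq : q ≠ 0) (hpq : Projectivization.mk K p hp ≠ Projectivization.mk K q hq)
    (a b : K) (h1 : M *ᵥ p = a • u) (h2 : M *ᵥ q = b • u) : M.det = 0 := by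
  by_contra hdet
  have hunit : IsUnit M := (Matrix.isUnit_iff_isUnit_det M).2 (isUnit_iff_ne_zero.2 hdet)
  have hinj := Matrix.mulVec_injective_of_isUnit hunit
  have ha : a ≠ 0 := by
    rintro rfl
    exact hp (hinj (by simpa using h1))
  have h : M *ᵥ q = M *ᵥ ((b / a) • p) := by
    rw [Matrix.mulVec_smul, h1, h2, smul_smul, div_mul_cancel₀ b ha]
  exact hpq (mk_eq_mk_of_smul hq hp (b / a) (hinj h).symm).symm

/-- A vector orthogonal to two different points of a line is a multiple of the line. -/
theorem exists_smul_eq_of_dotProduct {u p q x : Fin 3 → K} (hu : u ≠ 0) (hp : p ≠ 0) (hq : q ≠ 0)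
    (hpq : Projectivization.mk K p hp ≠ Projectivization.mk K q hq)
    (h1 : u ⬝ᵥ p = 0) (h2 : u ⬝ᵥ q = 0) (h3 : x ⬝ᵥ p = 0) (h4 : x ⬝ᵥ q = 0) :
    ∃ a : K, x = a • u := by
  by_cases hx : x = 0
  · exact ⟨0, by simp [hx]⟩
  have hc : crossProduct p q ≠ 0 := by
    rwa [ne_eq, Projectivization.mk_eq_mk_iff_crossProduct_eq_zero] at hpq
  obtain ⟨a, ha⟩ := (Projectivization.mk_eq_mk_iff' K x u hx hu).1
    ((mk_eq_mk_cross_of_onLine hx hc h3 h4).trans (mk_eq_mk_cross_of_onLine hu hc h1 h2).symm)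
  exact ⟨a, ha.symm⟩

/-- A line does not contain two conjugate points of a nondegenerate conic. -/
theorem det_eq_zero_of_quad_eq_zero {M : Mat K} (hM : M.IsSymm) {u p q : Fin 3 → K} (hu : u ≠ 0)
    (hp : p ≠ 0) (hq : q ≠ 0) (hpq : Projectivization.mk K p hp ≠ Projectivization.mk K q hq)
    (h1 : u ⬝ᵥ p = 0) (h2 : u ⬝ᵥ q = 0) (h3 : quad M p = 0) (h4 : quad M q = 0)
    (h5 : p ⬝ᵥ (M *ᵥ q) = 0) : M.det = 0 := by
  obtain ⟨a, ha⟩ := exists_smul_eq_of_dotProduct hu hp hq hpq h1 h2 (x := M *ᵥ p)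
    (by rw [dotProduct_comm]; exact h3)
    (by rw [dotProduct_comm, dotProduct_mulVec_comm hM]; exact h5)
  obtain ⟨b, hb⟩ := exists_smul_eq_of_dotProduct hu hp hq hpq h1 h2 (x := M *ᵥ q)
    (by rw [dotProduct_comm]; exact h5) (by rw [dotProduct_comm]; exact h4)
  exact det_eq_zero_of_mulVec_onLine hp hq hpq a b ha hb

theorem exists_mk_ne_onLine {u p : Fin 3 → K} (hp : p ≠ 0) :
    ∃ (q : Fin 3 → K) (hq : q ≠ 0), u ⬝ᵥ q = 0 ∧
      Projectivization.mk K p hp ≠ Projectivization.mk K q hq := by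
  by_contra! h
  -- The vectors u × x lie on the line u. If p were its only point, p × (u × x) would vanish
  -- identically.
  have key : ∀ x : Fin 3 → K, crossProduct p (crossProduct u x) = 0 := by
    intro x
    by_cases hx : crossProduct u x = 0
    · simp [hx]
    · exact (Projectivization.mk_eq_mk_iff_crossProduct_eq_zero hp hx).1
        (h _ hx (dot_self_cross u x))
  by_cases hu : u = 0
  · obtain ⟨i, hi⟩ := Function.ne_iff.1 hp
    obtain ⟨j, hj⟩ : ∃ j, j ≠ i := exists_ne i
    have hne : (Pi.single j 1 : Fin 3 → K) ≠ 0 := by simp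
    obtain ⟨a, ha⟩ := (Projectivization.mk_eq_mk_iff' K _ _ hp hne).1 (h _ hne (by simp [hu]))
    exact hi (by simp [← ha, hj.symm])
  · simp only [cross_cross_eq_smul_sub_smul'] at key
    obtain ⟨i, hi⟩ := Function.ne_iff.1 hu
    obtain ⟨j, hj⟩ : ∃ j, j ≠ i := exists_ne i
    rw [Pi.zero_apply] at hi
    have hp' : ∀ l, l ≠ i → p l = 0 := fun l hl => by
      have h1 := congrFun (key (Pi.single l 1)) i
      simpa [hl.symm, hi] using h1
    refine hp ?_
    have h1 := congrFun (key (Pi.single j 1)) j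
    have hpi : p i = 0 := by
      have : p ⬝ᵥ u = p i * u i := by
        rw [dotProduct, Finset.sum_eq_single i (fun l _ hl => by simp [hp' l hl]) (by simp)]
      simpa [hp' j hj, this, hi, dotProduct_comm u p] using h1
    ext l
    by_cases hl : l = i
    · simp [hl, hpi]
    · simp [hp' l hl]

variable [NeZero (2 : K)]

/-- A line meets a nondegenerate conic in at most two points. -/
theorem eq_or_eq_of_onLine_of_mem_locus {M : Mat K} (hM : M.IsSymm) (hdet : M.det ≠ 0)
    {p q r : Plane K} {u : Line K} (hpq : p ≠ q) (hp : OnLine p u) (hq : OnLine q u)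
    (hr : OnLine r u) (hp' : p ∈ locus M) (hq' : q ∈ locus M) (hr' : r ∈ locus M) :
    r = p ∨ r = q := by
  induction p using Projectivization.ind with | h p hp0 =>
  induction q using Projectivization.ind with | h q hq0 =>
  induction r using Projectivization.ind with | h r hr0 =>
  induction u using Projectivization.ind with | h u hu0 =>
  rw [onLine_mk] at hp hq hr
  rw [mk_mem_locus] at hp' hq' hr'
  obtain ⟨a, b, rfl⟩ := exists_smul_add_smul_of_onLine hu0 hp0 hq0 hpq hp hq hr
  rw [quad_add_smul hM, hp', hq'] at hr'
  have h5 : p ⬝ᵥ (M *ᵥ q) ≠ 0 := fun h5 =>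
    hdet (det_eq_zero_of_quad_eq_zero hM hu0 hp0 hq0 hpq hp hq hp' hq' h5)
  have hab : a = 0 ∨ b = 0 := by simpa [h5, NeZero.ne (2 : K)] using hr'
  rcases hab with rfl | rfl
  · exact Or.inr (mk_eq_mk_of_smul _ _ b (by simp))
  · exact Or.inl (mk_eq_mk_of_smul _ _ a (by simp))

/-- Tangency to a nondegenerate conic, in terms of the dual conic. -/
theorem isTangent_mk_iff {M : Mat K} (hM : M.IsSymm) (hdet : M.det ≠ 0) {u : Fin 3 → K}
    (hu : u ≠ 0) : IsTangent M (Projectivization.mk K u hu) ↔ quad M.adjugate u = 0 := by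
  have hadj (x : Fin 3 → K) : M.adjugate *ᵥ (M *ᵥ x) = M.det • x := by
    rw [Matrix.mulVec_mulVec, Matrix.adjugate_mul, Matrix.smul_mulVec, Matrix.one_mulVec]
  have hadj' (x : Fin 3 → K) : M *ᵥ (M.adjugate *ᵥ x) = M.det • x := by
    rw [Matrix.mulVec_mulVec, Matrix.mul_adjugate, Matrix.smul_mulVec, Matrix.one_mulVec]
  constructor
  · rintro ⟨p, ⟨hp1, hp2⟩, huniq⟩
    induction p using Projectivization.ind with | h p hp0 =>
    rw [onLine_mk] at hp1
    rw [mk_mem_locus] at hp2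
    obtain ⟨q, hq0, hq1, hpq⟩ := exists_mk_ne_onLine (u := u) hp0
    have hq2 : quad M q ≠ 0 := fun h =>
      hpq (huniq _ ⟨(onLine_mk _ _).2 hq1, (mk_mem_locus _).2 h⟩).symm
    have hB : p ⬝ᵥ (M *ᵥ q) = 0 := by
      by_contra hB
      set b := p ⬝ᵥ (M *ᵥ q)
      -- The second intersection of the line pq with the conic: on a • p + b • q the form is b(2a·B
      -- + b·Q), with B = p ⬝ᵥ (M *ᵥ q) and Q = `quad M q`. By uniqueness r would be p, impossible
      -- for B ≠ 0. So p is conjugate to the whole line, and M *ᵥ p is a multiple of u.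
      set r : Fin 3 → K := quad M q • p + (-(2 * b)) • q with hr
      have hrq : r ≠ 0 := fun h0 => hpq (mk_eq_mk_of_smul _ _ (2 * b / quad M q) (by
        rw [div_eq_inv_mul, mul_smul, inv_smul_eq_iff₀ hq2]
        rw [hr, neg_smul, ← sub_eq_add_neg, sub_eq_zero] at h0
        exact h0.symm))
      have h1 : quad M r = 0 := by rw [hr, quad_add_smul hM, hp2]; ring
      have h2 : u ⬝ᵥ r = 0 := by simp [hr, hp1, hq1]
      have h3 := huniq _ ⟨(onLine_mk hrq hu).2 h2, (mk_mem_locus hrq).2 h1⟩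
      obtain ⟨k, hk⟩ := (Projectivization.mk_eq_mk_iff' K _ _ hrq hp0).1 h3
      refine hpq (mk_eq_mk_of_smul hq0 hp0 ((quad M q - k) / (2 * b)) ?_).symm
      have h2b : 2 * b ≠ 0 := mul_ne_zero (NeZero.ne _) hB
      have : (quad M q - k) • p = (2 * b) • q := by
        rw [sub_smul, hk, hr]; simp
      rw [div_eq_inv_mul, mul_smul, this, inv_smul_smul₀ h2b]
    obtain ⟨a, ha⟩ := exists_smul_eq_of_dotProduct hu hp0 hq0 hpq hp1 hq1 (x := M *ᵥ p)
      (by rw [dotProduct_comm]; exact hp2)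
      (by rw [dotProduct_comm, dotProduct_mulVec_comm hM]; exact hB)
    have h1 : a • (M.adjugate *ᵥ u) = M.det • p := by
      rw [← Matrix.mulVec_smul, ← ha, hadj]
    have ha0 : a ≠ 0 := by
      rintro rfl
      rw [zero_smul] at h1
      exact (smul_ne_zero hdet hp0) h1.symm
    have h2 : a * quad M.adjugate u = 0 := by
      rw [quad, ← smul_eq_mul, ← dotProduct_smul, h1, dotProduct_smul, hp1, smul_zero]
    exact (mul_eq_zero.1 h2).resolve_left ha0
  · intro h
    -- The tangency point is the pole of u.
    have hp0 : M.adjugate *ᵥ u ≠ 0 := fun h0 => smul_ne_zero hdet hu (by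
      rw [← hadj', h0, Matrix.mulVec_zero])
    have hp2 : quad M (M.adjugate *ᵥ u) = 0 := by
      rw [quad, hadj', dotProduct_smul, dotProduct_comm]
      exact smul_eq_zero_of_right _ h
    refine ⟨Projectivization.mk K _ hp0, ⟨(onLine_mk _ _).2 h, (mk_mem_locus _).2 hp2⟩, ?_⟩
    rintro q ⟨hq1, hq2⟩
    induction q using Projectivization.ind with | h q hq0 =>
    rw [onLine_mk] at hq1
    rw [mk_mem_locus] at hq2
    by_contra hqp
    refine hdet (det_eq_zero_of_quad_eq_zero hM hu hq0 hp0 hqp hq1 h hq2 hp2 ?_)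
    rw [hadj', dotProduct_smul, dotProduct_comm, hq1, smul_zero]

end Field

/-! ### Equivariance of the configuration under projective transformations -/

section Real

theorem smul_mem_locus_conicImage (g : GL (Fin 3) ℝ) (M : Mat ℝ) (p : Plane ℝ) :
    g • p ∈ locus (conicImage g M) ↔ p ∈ locus M := by
  induction p using Projectivization.ind with | h p hp =>
  rw [gl_smul_mk, mk_mem_locus, mk_mem_locus, conicImage, ← quad_mulVec, Matrix.mulVec_mulVec,
    ← Units.val_mul]
  simp

theorem smul_locus (g : GL (Fin 3) ℝ) (M : Mat ℝ) : g • locus M = locus (conicImage g M) := by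
  ext p
  rw [Set.mem_smul_set_iff_inv_smul_mem, ← smul_mem_locus_conicImage g, smul_inv_smul]

theorem conicImage_mul (g h : GL (Fin 3) ℝ) (M : Mat ℝ) :
    conicImage (g * h) M = conicImage g (conicImage h M) := by
  simp only [conicImage, mul_inv_rev, Units.val_mul, Matrix.transpose_mul, Matrix.mul_assoc]

theorem conicImage_one (M : Mat ℝ) : conicImage 1 M = M := by
  simp [conicImage]

theorem conicImage_inv (g : GL (Fin 3) ℝ) (M : Mat ℝ) :
    conicImage g⁻¹ M = (g : Mat ℝ)ᵀ * M * (g : Mat ℝ) := by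
  rw [conicImage, inv_inv]

theorem isSymm_conicImage {M : Mat ℝ} (hM : M.IsSymm) (g : GL (Fin 3) ℝ) :
    (conicImage g M).IsSymm := by
  rw [Matrix.IsSymm, conicImage, Matrix.transpose_mul, Matrix.transpose_mul, hM.eq,
    Matrix.transpose_transpose, Matrix.mul_assoc]

theorem det_conicImage_ne_zero {M : Mat ℝ} (hM : M.det ≠ 0) (g : GL (Fin 3) ℝ) :
    (conicImage g M).det ≠ 0 := by
  have h : ((g⁻¹ : GL (Fin 3) ℝ) : Mat ℝ).det ≠ 0 :=
    ((Matrix.isUnit_iff_isUnit_det _).1 (Units.isUnit g⁻¹)).ne_zero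
  rw [conicImage, Matrix.det_mul, Matrix.det_mul, Matrix.det_transpose]
  exact mul_ne_zero (mul_ne_zero h hM) h

theorem locus_smul {c : ℝ} (hc : c ≠ 0) (M : Mat ℝ) : locus (c • M) = locus M := by
  ext p
  simp [locus, quad, Matrix.smul_mulVec, hc]

theorem isTangent_dual {g : GL (Fin 3) ℝ} {M N : Mat ℝ} (h : g • locus M = locus N) (u : Line ℝ) :
    IsTangent N (dual g • u) ↔ IsTangent M u := by
  have key (p : Plane ℝ) : OnLine p (dual g • u) ∧ p ∈ locus N ↔
      OnLine (g⁻¹ • p) u ∧ g⁻¹ • p ∈ locus M := by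
    rw [onLine_dual, ← h, Set.mem_smul_set_iff_inv_smul_mem]
  simp only [IsTangent, key]
  exact (Function.Bijective.existsUnique_iff (MulAction.bijective (β := Plane ℝ) g⁻¹)
    (p := fun p => OnLine p u ∧ p ∈ locus M)).symm

variable {n : ℕ} {g : GL (Fin 3) ℝ} {γ γ' Γ Γ' : Mat ℝ} {v : ZMod n → Plane ℝ}
  {ℓ : ZMod n → Line ℝ}

theorem isSide_dual (g : GL (Fin 3) ℝ) (v : ZMod n → Plane ℝ) (u : Line ℝ) :
    IsSide (fun i => g • v i) (dual g • u) ↔ IsSide v u := by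
  simp only [IsSide, onLine_smul_dual]

theorem IsPonceletPolygon.smul (hv : IsPonceletPolygon γ Γ v) (hγ : g • locus γ = locus γ')
    (hΓ : g • locus Γ = locus Γ') : IsPonceletPolygon γ' Γ' (fun i => g • v i) := by
  refine ⟨(MulAction.injective g).comp hv.1, fun i => ?_, fun u hu => ?_⟩
  · rw [← hΓ]
    exact Set.smul_mem_smul_set (hv.2.1 i)
  · rw [← smul_inv_smul (dual g) u, isSide_dual] at hu
    rw [← smul_inv_smul (dual g) u, isTangent_dual hγ]
    exact hv.2.2 _ hu

theorem IsCyclicEnumeration.smul (h : IsCyclicEnumeration γ v ℓ) (hγ : g • locus γ = locus γ') :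
    IsCyclicEnumeration γ' (fun i => g • v i) (fun i => dual g • ℓ i) := by
  obtain ⟨hr, k, θ, hk, hθ, hper, hon⟩ := h
  refine ⟨?_, g * k, θ, ?_, hθ, hper, fun i => ?_⟩
  · ext u
    rw [Set.mem_ofPred_eq, ← smul_inv_smul (dual g) u, isSide_dual]
    have : (dual g)⁻¹ • u ∈ Set.range ℓ ↔ IsSide v ((dual g)⁻¹ • u) := by rw [hr]; exact Iff.rfl
    rw [← this]
    simp only [Set.mem_range, smul_inv_smul, eq_inv_smul_iff]
  · rw [mul_smul, hk, hγ]
  · rw [mul_smul, onLine_smul_dual]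
    exact hon i

theorem gridPoint_dual (hγ : g • locus γ = locus γ') (i j : ZMod n) :
    gridPoint γ' (fun i => dual g • ℓ i) i j = g • gridPoint γ ℓ i j := by
  ext p
  rw [Set.mem_smul_set_iff_inv_smul_mem]
  simp only [gridPoint, Set.mem_ofPred_eq, onLine_dual, ← hγ, Set.mem_smul_set_iff_inv_smul_mem]

theorem gridP_dual (hγ : g • locus γ = locus γ') (k : ZMod n) :
    gridP γ' (fun i => dual g • ℓ i) k = g • gridP γ ℓ k := by
  ext p
  rw [Set.mem_smul_set_iff_inv_smul_mem]
  simp only [gridP, Set.mem_ofPred_eq, gridPoint_dual hγ, Set.mem_smul_set_iff_inv_smul_mem]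

theorem gridQ_dual (hγ : g • locus γ = locus γ') (k : ZMod n) :
    gridQ γ' (fun i => dual g • ℓ i) k = g • gridQ γ ℓ k := by
  ext p
  rw [Set.mem_smul_set_iff_inv_smul_mem]
  simp only [gridQ, Set.mem_ofPred_eq, gridPoint_dual hγ, Set.mem_smul_set_iff_inv_smul_mem]

theorem HasNoSymmetry.smul (h : HasNoSymmetry γ Γ v) (hγ : g • locus γ = locus γ')
    (hΓ : g • locus Γ = locus Γ') : HasNoSymmetry γ' Γ' (fun i => g • v i) := by
  intro k h1 h2 h3 p
  have hr : Set.range (fun i => g • v i) = g • Set.range v := by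
    rw [← Set.image_smul, ← Set.range_comp]; rfl
  rw [hr] at h3
  rw [← hγ] at h1
  rw [← hΓ] at h2
  have := h (g⁻¹ * k * g) (by rw [mul_smul, mul_smul, h1, inv_smul_smul])
    (by rw [mul_smul, mul_smul, h2, inv_smul_smul])
    (by rw [mul_smul, mul_smul, h3, inv_smul_smul]) (g⁻¹ • p)
  rw [mul_smul, mul_smul, smul_inv_smul] at this
  exact smul_left_cancel _ this

/-- The vertices are the points of `Γ` on the sides. -/
theorem IsPonceletPolygon.range_eq (hv : IsPonceletPolygon γ Γ v) (hn : 2 ≤ n) (hΓ : Γ.IsSymm)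
    (hdet : Γ.det ≠ 0) :
    Set.range v = {p | p ∈ locus Γ ∧ ∃ u, IsSide v u ∧ OnLine p u} := by
  have : Fact (1 < n) := ⟨hn⟩
  ext p
  constructor
  · rintro ⟨i, rfl⟩
    obtain ⟨u, hu⟩ := exists_onLine (v i) (v (i + 1))
    exact ⟨hv.2.1 i, u, ⟨i, hu⟩, hu.1⟩
  · rintro ⟨hp, u, ⟨i, hi, hi'⟩, hpu⟩
    have hne : v i ≠ v (i + 1) := fun h => by simpa using hv.1 h
    rcases eq_or_eq_of_onLine_of_mem_locus hΓ hdet hne hi hi' hpu (hv.2.1 i) (hv.2.1 _) hp with h | h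
    · exact ⟨i, h.symm⟩
    · exact ⟨i + 1, h.symm⟩

/-- Symmetries can be tested on the sides alone: the vertices are recovered as the points of Γ on
the sides, so g maps the vertex set into itself, hence onto itself by finiteness. -/
theorem HasNoSymmetry.smul_eq (h : HasNoSymmetry γ Γ v) (hv : IsPonceletPolygon γ Γ v)
    (hn : 2 ≤ n) (hΓ : Γ.IsSymm) (hdet : Γ.det ≠ 0) (h1 : g • locus γ = locus γ)
    (h2 : g • locus Γ = locus Γ) (h3 : ∀ u, IsSide v u → IsSide v (dual g • u)) (p : Plane ℝ) :
    g • p = p := by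
  have : NeZero n := ⟨by omega⟩
  have hfin : (Set.range v).Finite := Set.finite_range v
  have hsub : g • Set.range v ⊆ Set.range v := by
    rw [hv.range_eq hn hΓ hdet]
    rintro _ ⟨q, ⟨hq, u, hu, hqu⟩, rfl⟩
    refine ⟨?_, dual g • u, h3 u hu, (onLine_smul_dual g q u).2 hqu⟩
    rw [← h2]
    exact Set.smul_mem_smul_set hq
  refine h g h1 h2 (Set.eq_of_subset_of_ncard_le hsub ?_ hfin) p
  rw [← Set.image_smul, Set.ncard_image_of_injective _ (MulAction.injective g)]

end Real

/-! ### Jacobi's elliptic functions -/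

/-- `φ` is Jacobi's amplitude for the parameter `m`, and `K` is the quarter period. -/
structure IsAmplitude (m K : ℝ) (φ : ℝ → ℝ) : Prop where
  m_nonneg : 0 ≤ m
  m_lt_one : m < 1
  K_pos : 0 < K
  strictMono : StrictMono φ
  surjective : Function.Surjective φ
  neg : ∀ t, φ (-t) = -φ t
  add_two_K : ∀ t, φ (t + 2 * K) = φ t + Real.pi
  hasDerivAt : ∀ t, HasDerivAt φ (√(1 - m * Real.sin (φ t) ^ 2)) t

theorem one_sub_mul_sin_sq_pos {m : ℝ} (hm : 0 ≤ m) (hm1 : m < 1) (x : ℝ) :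
    0 < 1 - m * Real.sin x ^ 2 := by
  nlinarith [Real.sin_sq_le_one x, sq_nonneg (Real.sin x)]

/-- The amplitude is the inverse of the incomplete elliptic integral F of (1 - m sin²)^(-1/2). The
integrand is at least 1, so F is onto; it is even and π-periodic, which yields the symmetry and the
period. -/
theorem exists_isAmplitude {m : ℝ} (hm : 0 ≤ m) (hm1 : m < 1) :
    ∃ K φ, IsAmplitude m K φ := by
  set f : ℝ → ℝ := fun x => (√(1 - m * Real.sin x ^ 2))⁻¹ with hf
  have hpos (x : ℝ) : 0 < √(1 - m * Real.sin x ^ 2) :=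
    Real.sqrt_pos.2 (one_sub_mul_sin_sq_pos hm hm1 x)
  have hcont : Continuous f := by
    refine Continuous.inv₀ (by fun_prop) fun x => (hpos x).ne'
  have hfpos (x : ℝ) : 0 < f x := inv_pos.2 (hpos x)
  have hf1 (x : ℝ) : 1 ≤ f x := by
    rw [hf]
    refine (one_le_inv₀ (hpos x)).2 (Real.sqrt_le_one.2 ?_)
    nlinarith [mul_nonneg hm (sq_nonneg (Real.sin x))]
  have hint (a b : ℝ) : IntervalIntegrable f MeasureTheory.volume a b :=
    hcont.intervalIntegrable a b
  set F : ℝ → ℝ := fun x => ∫ t in (0 : ℝ)..x, f t with hF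
  have hFd (x : ℝ) : HasDerivAt F (f x) x :=
    intervalIntegral.integral_hasDerivAt_right (hint 0 x)
      hcont.aestronglyMeasurable.stronglyMeasurableAtFilter hcont.continuousAt
  have hFcont : Continuous F := continuous_iff_continuousAt.2 fun x => (hFd x).continuousAt
  have hFmono : StrictMono F := strictMono_of_hasDerivAt_pos hFd hfpos
  have hFneg (x : ℝ) : F (-x) = -F x := by
    have h1 : ∫ t in (0 : ℝ)..x, f (-t) = ∫ t in (-x)..(-0), f t :=
      intervalIntegral.integral_comp_neg f
    have h2 : (fun t => f (-t)) = f := by ext t; simp [hf]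
    have h3 := congrArg (fun k : ℝ → ℝ => ∫ t in (0 : ℝ)..x, k t) h2
    rw [neg_zero, intervalIntegral.integral_symm 0 (-x)] at h1
    change ∫ t in (0 : ℝ)..(-x), f t = -∫ t in (0 : ℝ)..x, f t
    linarith
  have hF0 : F 0 = 0 := by simp [hF]
  have hFge (x : ℝ) (hx : 0 ≤ x) : x ≤ F x := by
    have := intervalIntegral.integral_mono_on hx (intervalIntegrable_const (c := (1 : ℝ)))
      (hint 0 x) (fun t _ => hf1 t)
    simpa using this
  have hFtop : Filter.Tendsto F Filter.atTop Filter.atTop :=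
    Filter.tendsto_atTop_mono' _ (Filter.eventually_ge_atTop (0 : ℝ) |>.mono hFge) Filter.tendsto_id
  have hFbot : Filter.Tendsto F Filter.atBot Filter.atBot := by
    have h : F = fun x => -F (-x) := by ext x; rw [hFneg, neg_neg]
    rw [h]
    exact Filter.tendsto_neg_atTop_atBot.comp (hFtop.comp Filter.tendsto_neg_atBot_atTop)
  have hFsurj : Function.Surjective F := hFcont.surjective hFtop hFbot
  have hFper (x : ℝ) : F (x + Real.pi) = F x + F Real.pi := by
    have hper : Function.Periodic f Real.pi := fun t => by simp [hf, Real.sin_add_pi]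
    have h1 := intervalIntegral.integral_add_adjacent_intervals (hint 0 x) (hint x (x + Real.pi))
    have h2 := hper.intervalIntegral_add_eq x 0
    rw [zero_add] at h2
    simp only [hF]
    rw [← h1, h2]
  set e : ℝ ≃o ℝ := hFmono.orderIsoOfSurjective F hFsurj
  have hFe (t : ℝ) : F (e.symm t) = t := e.apply_symm_apply t
  have heF (t : ℝ) : e.symm (F t) = t := e.symm_apply_apply t
  -- By the symmetry of the integrand, F(π)/2 is the complete integral F(π/2).
  refine ⟨F Real.pi / 2, e.symm, hm, hm1, ?_, e.symm.strictMono, e.symm.surjective, ?_, ?_, ?_⟩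
  · have := hFmono Real.pi_pos
    rw [hF0] at this
    linarith
  · intro t
    apply hFmono.injective
    rw [hFe, hFneg, hFe]
  · intro t
    apply hFmono.injective
    rw [hFe, hFper, hFe]
    ring
  · intro t
    have := (hFd (e.symm t)).of_local_left_inverse e.symm.continuous.continuousAt (hfpos _).ne'
      (Filter.Eventually.of_forall hFe)
    simpa [hf] using this

namespace IsAmplitude

variable {m K : ℝ} {φ : ℝ → ℝ} (h : IsAmplitude m K φ)
include h

theorem map_zero : φ 0 = 0 := by
  have := h.neg 0
  rw [neg_zero] at this
  linarith

theorem map_K : φ K = Real.pi / 2 := by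
  have := h.add_two_K (-K)
  rw [h.neg, show -K + 2 * K = K by ring] at this
  linarith

theorem add_int (t : ℝ) (j : ℤ) : φ (t + 2 * K * j) = φ t + j * Real.pi := by
  induction j with
  | zero => simp
  | succ j ih =>
    rw [show t + 2 * K * ((j + 1 : ℤ) : ℝ) = t + 2 * K * j + 2 * K by push_cast; ring, h.add_two_K]
    push_cast at ih ⊢
    rw [ih]; ring
  | pred j ih =>
    have := h.add_two_K (t + 2 * K * ((-j - 1 : ℤ) : ℝ))
    rw [show t + 2 * K * ((-j - 1 : ℤ) : ℝ) + 2 * K = t + 2 * K * ((-j : ℤ) : ℝ) by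
      push_cast; ring, ih] at this
    push_cast at this ⊢
    linarith

end IsAmplitude

/-- The elliptic sine of the amplitude `φ`. -/
def sn (φ : ℝ → ℝ) (t : ℝ) : ℝ := Real.sin (φ t)

/-- The elliptic cosine of the amplitude `φ`. -/
def cn (φ : ℝ → ℝ) (t : ℝ) : ℝ := Real.cos (φ t)

/-- The delta amplitude. -/
def dn (m : ℝ) (φ : ℝ → ℝ) (t : ℝ) : ℝ := √(1 - m * sn φ t ^ 2)

theorem sn_sq_add_cn_sq (φ : ℝ → ℝ) (t : ℝ) : sn φ t ^ 2 + cn φ t ^ 2 = 1 :=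
  Real.sin_sq_add_cos_sq _

namespace IsAmplitude

variable {m K : ℝ} {φ : ℝ → ℝ} (h : IsAmplitude m K φ)
include h

theorem dn_pos (t : ℝ) : 0 < dn m φ t :=
  Real.sqrt_pos.2 (one_sub_mul_sin_sq_pos h.m_nonneg h.m_lt_one _)

theorem dn_sq (t : ℝ) : dn m φ t ^ 2 = 1 - m * sn φ t ^ 2 :=
  Real.sq_sqrt (one_sub_mul_sin_sq_pos h.m_nonneg h.m_lt_one _).le

theorem sn_neg (t : ℝ) : sn φ (-t) = -sn φ t := by simp [sn, h.neg]

theorem cn_neg (t : ℝ) : cn φ (-t) = cn φ t := by simp [cn, h.neg]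

theorem dn_neg (t : ℝ) : dn m φ (-t) = dn m φ t := by simp [dn, h.sn_neg]

theorem hasDerivAt_sn (t : ℝ) : HasDerivAt (sn φ) (cn φ t * dn m φ t) t :=
  (h.hasDerivAt t).sin

theorem hasDerivAt_cn (t : ℝ) : HasDerivAt (cn φ) (-sn φ t * dn m φ t) t :=
  (h.hasDerivAt t).cos

theorem hasDerivAt_dn (t : ℝ) : HasDerivAt (dn m φ) (-(m * sn φ t * cn φ t)) t := by
  have h1 := (((h.hasDerivAt_sn t).fun_pow 2).const_mul m).const_sub 1
  have h2 := h1.sqrt (one_sub_mul_sin_sq_pos h.m_nonneg h.m_lt_one _).ne'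
  refine h2.congr_deriv ?_
  change _ / (2 * dn m φ t) = _
  have := (h.dn_pos t).ne'
  field_simp
  ring

theorem denom_pos (s t : ℝ) : 0 < 1 - m * sn φ s ^ 2 * sn φ t ^ 2 := by
  have h1 := sn_sq_add_cn_sq φ s
  have h2 := one_sub_mul_sin_sq_pos h.m_nonneg h.m_lt_one (φ t)
  have h3 : m * sn φ s ^ 2 * sn φ t ^ 2 ≤ m * sn φ t ^ 2 := by
    have := mul_le_mul_of_nonneg_left (show sn φ s ^ 2 ≤ 1 by nlinarith [sq_nonneg (cn φ s)])
      (mul_nonneg h.m_nonneg (sq_nonneg (sn φ t)))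
    linarith
  have h4 : 0 < 1 - m * sn φ t ^ 2 := h2
  linarith

/-- With x + y = w held fixed, the quotient on the right of the addition formula has zero derivative
in x, and at x = w it equals sn w. -/
theorem sn_add (x y : ℝ) : sn φ (x + y) * (1 - m * sn φ x ^ 2 * sn φ y ^ 2) =
    sn φ x * cn φ y * dn m φ y + sn φ y * cn φ x * dn m φ x := by
  set w := x + y
  set f : ℝ → ℝ := fun t => (sn φ t * cn φ (w - t) * dn m φ (w - t) + sn φ (w - t) * cn φ t * dn m φ t)
    / (1 - m * sn φ t ^ 2 * sn φ (w - t) ^ 2) with hf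
  have hd (t : ℝ) : HasDerivAt f 0 t := by
    have hs := h.hasDerivAt_sn t
    have hc := h.hasDerivAt_cn t
    have hd := h.hasDerivAt_dn t
    have hs' := (h.hasDerivAt_sn (w - t)).comp_const_sub w t
    have hc' := (h.hasDerivAt_cn (w - t)).comp_const_sub w t
    have hd' := (h.hasDerivAt_dn (w - t)).comp_const_sub w t
    have hden := (h.denom_pos t (w - t)).ne'
    refine ((((hs.fun_mul hc').fun_mul hd').fun_add ((hs'.fun_mul hc).fun_mul hd)).fun_div
      ((((hs.fun_pow 2).const_mul m).fun_mul (hs'.fun_pow 2)).const_sub 1) hden).congr_deriv ?_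
    rw [div_eq_zero_iff]
    left
    have e1 := sn_sq_add_cn_sq φ t
    have e2 := sn_sq_add_cn_sq φ (w - t)
    have e3 := h.dn_sq t
    have e4 := h.dn_sq (w - t)
    generalize sn φ t = s at *
    generalize cn φ t = c at *
    generalize dn m φ t = d at *
    generalize sn φ (w - t) = s' at *
    generalize cn φ (w - t) = c' at *
    generalize dn m φ (w - t) = d' at *
    clear hs hc hd hs' hc' hd' hden
    grind
  have hconst := is_const_of_deriv_eq_zero (fun t => (hd t).differentiableAt) (fun t => (hd t).deriv)
    x w
  have h0 : sn φ 0 = 0 := by simp [sn, h.map_zero]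
  have h1 : cn φ 0 = 1 := by simp [cn, h.map_zero]
  have h2 : dn m φ 0 = 1 := by simp [dn, h0]
  simp only [hf, sub_self, h0, h1, h2, show w - x = y by simp [w]] at hconst
  rw [div_eq_iff (h.denom_pos x y).ne'] at hconst
  rw [hconst]
  ring

/-- Same argument as for `sn_add`. -/
theorem cn_add (x y : ℝ) : cn φ (x + y) * (1 - m * sn φ x ^ 2 * sn φ y ^ 2) =
    cn φ x * cn φ y - sn φ x * sn φ y * dn m φ x * dn m φ y := by
  set w := x + y
  set f : ℝ → ℝ := fun t => (cn φ t * cn φ (w - t) - sn φ t * sn φ (w - t) * dn m φ t * dn m φ (w - t))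
    / (1 - m * sn φ t ^ 2 * sn φ (w - t) ^ 2) with hf
  have hd (t : ℝ) : HasDerivAt f 0 t := by
    have hs := h.hasDerivAt_sn t
    have hc := h.hasDerivAt_cn t
    have hd := h.hasDerivAt_dn t
    have hs' := (h.hasDerivAt_sn (w - t)).comp_const_sub w t
    have hc' := (h.hasDerivAt_cn (w - t)).comp_const_sub w t
    have hd' := (h.hasDerivAt_dn (w - t)).comp_const_sub w t
    have hden := (h.denom_pos t (w - t)).ne'
    refine (((hc.fun_mul hc').fun_sub (((hs.fun_mul hs').fun_mul hd).fun_mul hd')).fun_div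
      ((((hs.fun_pow 2).const_mul m).fun_mul (hs'.fun_pow 2)).const_sub 1) hden).congr_deriv ?_
    rw [div_eq_zero_iff]
    left
    have e1 := sn_sq_add_cn_sq φ t
    have e2 := sn_sq_add_cn_sq φ (w - t)
    have e3 := h.dn_sq t
    have e4 := h.dn_sq (w - t)
    generalize sn φ t = s at *
    generalize cn φ t = c at *
    generalize dn m φ t = d at *
    generalize sn φ (w - t) = s' at *
    generalize cn φ (w - t) = c' at *
    generalize dn m φ (w - t) = d' at *
    clear hs hc hd hs' hc' hd' hden
    grind
  have hconst := is_const_of_deriv_eq_zero (fun t => (hd t).differentiableAt) (fun t => (hd t).deriv)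
    x w
  have h0 : sn φ 0 = 0 := by simp [sn, h.map_zero]
  have h1 : cn φ 0 = 1 := by simp [cn, h.map_zero]
  simp only [hf, sub_self, h0, h1, show w - x = y by simp [w]] at hconst
  rw [div_eq_iff (h.denom_pos x y).ne'] at hconst
  rw [hconst]
  ring

/-- The spherical law of cosines for elliptic functions. -/
theorem law_of_cosines (x y : ℝ) :
    sn φ (x + y) * (sn φ x * dn m φ y) + cn φ (x + y) * cn φ x = cn φ y := by
  have e1 := sn_sq_add_cn_sq φ x
  have e4 := h.dn_sq y
  have h1 := h.sn_add x y
  have h2 := h.cn_add x y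
  refine mul_right_cancel₀ (h.denom_pos x y).ne' ?_
  linear_combination sn φ x * dn m φ y * h1 + cn φ x * h2 + sn φ x ^ 2 * cn φ y * e4 + cn φ y * e1

end IsAmplitude

/-! ### Normal form of a nested pair of ellipses -/

section NormalForm

theorem exists_diagonalization_two {a b d : ℝ} (ha : 0 < a) (hd : 0 < a * d - b ^ 2) (x y z : ℝ) :
    ∃ p q r s : ℝ, a * p ^ 2 + 2 * b * p * q + d * q ^ 2 = 1 ∧
      a * r ^ 2 + 2 * b * r * s + d * s ^ 2 = 1 ∧
      a * p * r + b * (p * s + q * r) + d * q * s = 0 ∧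
      x * p * r + y * (p * s + q * r) + z * q * s = 0 := by
  obtain ⟨e, he, he2⟩ : ∃ e : ℝ, 0 < e ∧ e ^ 2 = a :=
    ⟨√a, Real.sqrt_pos.2 ha, Real.sq_sqrt ha.le⟩
  obtain ⟨f, hf, hf2⟩ : ∃ f : ℝ, 0 < f ∧ f ^ 2 = a * d - b ^ 2 :=
    ⟨_, Real.sqrt_pos.2 hd, Real.sq_sqrt hd.le⟩
  subst he2
  obtain rfl : d = (f ^ 2 + b ^ 2) / e ^ 2 := by field_simp; linarith
  -- In the orthonormal basis (1/e, 0), (-b/(ef), e/f) of the first form, the second form has matrix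
  -- (X, Y; Y, Z). Rotating by half the argument of (X - Z) + 2iY diagonalizes it.
  set X := x / e ^ 2
  set Y := (y - x * b / e ^ 2) / f
  set Z := (z * e ^ 2 - 2 * y * b + x * b ^ 2 / e ^ 2) / f ^ 2
  set ψ := Complex.arg ⟨X - Z, 2 * Y⟩ / 2 with hψ
  have h1 : ‖(⟨X - Z, 2 * Y⟩ : ℂ)‖ * Real.cos (2 * ψ) = X - Z := by
    rw [hψ, mul_div_cancel₀ _ two_ne_zero]; exact Complex.norm_mul_cos_arg _
  have h2 : ‖(⟨X - Z, 2 * Y⟩ : ℂ)‖ * Real.sin (2 * ψ) = 2 * Y := by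
    rw [hψ, mul_div_cancel₀ _ two_ne_zero]; exact Complex.norm_mul_sin_arg _
  have h3 := Real.sin_sq_add_cos_sq ψ
  have h4 : (Z - X) * Real.sin ψ * Real.cos ψ + Y * (Real.cos ψ ^ 2 - Real.sin ψ ^ 2) = 0 := by
    have e1 : Real.sin (2 * ψ) = 2 * Real.sin ψ * Real.cos ψ := Real.sin_two_mul ψ
    have e2 : Real.cos (2 * ψ) = Real.cos ψ ^ 2 - Real.sin ψ ^ 2 := Real.cos_two_mul' ψ
    rw [← e2]
    linear_combination (-(X - Z) / 2) * e1.symm + (Real.sin (2 * ψ) / 2) * h1 -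
      (Real.cos (2 * ψ) / 2) * h2
  set c := Real.cos ψ
  set s := Real.sin ψ
  refine ⟨c / e - s * b / (e * f), s * e / f, -s / e - c * b / (e * f), c * e / f,
    ?_, ?_, ?_, ?_⟩
  · field_simp; linear_combination f ^ 2 * h3
  · field_simp; linear_combination f ^ 2 * h3
  · field_simp; ring
  · have : x = X * e ^ 2 := by simp only [X]; field_simp
    have hy : y = Y * f + X * b := by simp only [X, Y]; field_simp; ring
    have hz : z = (Z * f ^ 2 + 2 * y * b - X * b ^ 2) / e ^ 2 := by
      simp only [X, Z]; field_simp; ring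
    rw [hz, hy, this]
    field_simp
    linear_combination f ^ 2 * h4

theorem continuous_quad (M : Mat ℝ) : Continuous (quad M) := by
  unfold quad
  fun_prop

/-- A pencil of two nested conics contains a conic that is singular at an interior point. -/
theorem exists_mulVec_eq_smul_mulVec {M N : Mat ℝ} (hM : M.IsSymm) (hN : N.IsSymm)
    (hneg : ∃ w, quad M w < 0) (hMN : ∀ w, w ≠ 0 → quad M w ≤ 0 → quad N w < 0) :
    ∃ (ρ : ℝ) (p : Fin 3 → ℝ), 0 < ρ ∧ quad M p < 0 ∧ M *ᵥ p = ρ • (N *ᵥ p) := by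
  obtain ⟨w₀, hw₀⟩ := hneg
  have hw₀0 : w₀ ≠ 0 := by
    rintro rfl
    simp [quad] at hw₀
  set S : Set (Fin 3 → ℝ) := Metric.sphere 0 1 ∩ {w | quad M w ≤ 0} with hS
  have hScomp : IsCompact S :=
    (isCompact_sphere 0 1).inter_right (isClosed_le (continuous_quad M) continuous_const)
  have hSne (w : Fin 3 → ℝ) (hw : w ∈ S) : w ≠ 0 := by
    rintro rfl
    simp [hS] at hw
  have hscale (w : Fin 3 → ℝ) (hw : w ≠ 0) (hw' : quad M w ≤ 0) : ‖w‖⁻¹ • w ∈ S := by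
    refine ⟨?_, ?_⟩
    · simp [norm_smul, hw]
    · change quad M _ ≤ 0
      rw [quad_smul]
      exact mul_nonpos_of_nonneg_of_nonpos (sq_nonneg _) hw'
  -- The ratio M/N is nonnegative on S and vanishes exactly on the conic M, so its maximum is
  -- attained strictly inside M.
  obtain ⟨p, hpS, hmax⟩ := hScomp.exists_isMaxOn ⟨_, hscale w₀ hw₀0 hw₀.le⟩
    (f := fun w => quad M w / quad N w) ((continuous_quad M).continuousOn.div
      (continuous_quad N).continuousOn fun w hw => (hMN w (hSne w hw) hw.2).ne)
  have hNp := hMN p (hSne p hpS) hpS.2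
  set ρ := quad M p / quad N p with hρ
  have hle (w : Fin 3 → ℝ) (hw : w ≠ 0) (hw' : quad M w ≤ 0) : ρ * quad N w ≤ quad M w := by
    have h1 : quad M (‖w‖⁻¹ • w) / quad N (‖w‖⁻¹ • w) ≤ ρ := hmax (hscale w hw hw')
    rw [quad_smul, quad_smul, mul_div_mul_left _ _ (by simpa using hw),
      div_le_iff_of_neg (hMN w hw hw')] at h1
    exact h1
  have hρpos : 0 < ρ := by
    have h1 := hle w₀ hw₀0 hw₀.le
    have h2 := hMN w₀ hw₀0 hw₀.le
    by_contra hcon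
    nlinarith [mul_nonneg_of_nonpos_of_nonpos (not_lt.1 hcon) h2.le]
  have hp : ρ * quad N p = quad M p := div_mul_cancel₀ _ hNp.ne
  have hMp : quad M p < 0 := by rw [← hp]; exact mul_neg_of_pos_of_neg hρpos hNp
  refine ⟨ρ, p, hρpos, hMp, ?_⟩
  -- First-order condition: near p the form ρN - M is nonpositive, with value 0 at p, so its
  -- gradient at p vanishes.
  have key (w : Fin 3 → ℝ) : p ⬝ᵥ (M *ᵥ w) = ρ * (p ⬝ᵥ (N *ᵥ w)) := by
    set f : ℝ → ℝ := fun ε => ρ * quad N (p + ε • w) - quad M (p + ε • w) with hf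
    have hf' : f = fun ε => 2 * (ρ * (p ⬝ᵥ (N *ᵥ w)) - p ⬝ᵥ (M *ᵥ w)) * ε +
        (ρ * quad N w - quad M w) * ε ^ 2 := by
      ext ε
      have h1 := quad_add_smul hM p w 1 ε
      have h2 := quad_add_smul hN p w 1 ε
      rw [one_smul] at h1 h2
      simp only [hf, h1, h2]
      linear_combination hp
    have hder : HasDerivAt f (2 * (ρ * (p ⬝ᵥ (N *ᵥ w)) - p ⬝ᵥ (M *ᵥ w))) 0 := by
      rw [hf']
      have h1 := (hasDerivAt_id (0 : ℝ)).const_mul (2 * (ρ * (p ⬝ᵥ (N *ᵥ w)) - p ⬝ᵥ (M *ᵥ w)))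
      have h2 := ((hasDerivAt_id (0 : ℝ)).fun_pow 2).const_mul (ρ * quad N w - quad M w)
      refine (h1.fun_add h2).congr_deriv (by simp)
    have hcont : Continuous fun ε : ℝ => quad M (p + ε • w) :=
      (continuous_quad M).comp (by fun_prop)
    have hev : ∀ᶠ ε in nhds (0 : ℝ), quad M (p + ε • w) < 0 :=
      hcont.continuousAt.eventually_lt continuousAt_const (by simpa using hMp)
    have hloc : IsLocalMax f 0 := by
      filter_upwards [hev] with ε hε
      have h1 : p + ε • w ≠ 0 := by
        intro h0
        rw [h0] at hε
        simp [quad] at hε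
      have h2 := hle _ h1 hε.le
      simp only [hf, zero_smul, add_zero, hp]
      linarith
    have := hloc.hasDerivAt_eq_zero hder
    linarith
  ext i
  have := key (Pi.single i 1)
  rw [← dotProduct_mulVec_comm hM, ← dotProduct_mulVec_comm hN] at this
  simpa using this

theorem of_mul_mul_transpose_of_apply (M : Mat ℝ) (f : Fin 3 → Fin 3 → ℝ) (i j : Fin 3) :
    ((Matrix.of f) * M * (Matrix.of f)ᵀ) i j = f i ⬝ᵥ (M *ᵥ f j) := by
  rw [Matrix.mul_assoc, Matrix.mul_apply_eq_vecMul, ← Matrix.mulVec_transpose,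
    Matrix.transpose_mul, Matrix.transpose_transpose, ← Matrix.mulVec_mulVec]
  change f j ⬝ᵥ (Mᵀ *ᵥ f i) = _
  rw [Matrix.mulVec_transpose, dotProduct_comm, Matrix.dotProduct_mulVec]

theorem quad_axisConic (a b : ℝ) (w : Fin 3 → ℝ) :
    quad (axisConic a b) w = w 0 ^ 2 / a + w 1 ^ 2 / b - w 2 ^ 2 := by
  simp [quad, axisConic, Matrix.mulVec_diagonal, dotProduct, Fin.sum_univ_three]
  ring

theorem isSymm_axisConic (a b : ℝ) : (axisConic a b).IsSymm := Matrix.isSymm_diagonal _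

/-- The witness is the centre of the conic, the last column of the adjugate; the form takes there
the value of the minor times the determinant. -/
theorem exists_quad_neg {M : Mat ℝ} (hM : M.IsSymm) (h : 0 < M 0 0 * M 1 1 - M 0 1 ^ 2)
    (hdet : M.det < 0) : ∃ w, quad M w < 0 := by
  refine ⟨![M 0 1 * M 1 2 - M 0 2 * M 1 1, M 0 1 * M 0 2 - M 0 0 * M 1 2,
    M 0 0 * M 1 1 - M 0 1 ^ 2], ?_⟩
  have h10 := hM.apply 0 1
  have h20 := hM.apply 0 2
  have h21 := hM.apply 1 2
  have := mul_neg_of_pos_of_neg h hdet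
  rw [Matrix.det_fin_three, h10, h20, h21] at this
  simp only [quad, dotProduct, Matrix.mulVec, Fin.sum_univ_three, h10, h20, h21,
    Matrix.cons_val_zero, Matrix.cons_val_one, Matrix.cons_val]
  linarith

/-- The vector p from `exists_mulVec_eq_smul_mulVec` has the same orthogonal complement for M and
for N. On this complement M is positive definite, so both forms can be diagonalized there
simultaneously. -/
theorem exists_gram_eq {M N : Mat ℝ} (hM : M.IsSymm) (hN : N.IsSymm)
    (hM0 : 0 < M 0 0) (hM1 : 0 < M 0 0 * M 1 1 - M 0 1 ^ 2) (hMdet : M.det < 0)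
    (hMN : ∀ w, w ≠ 0 → quad M w ≤ 0 → quad N w < 0) :
    ∃ (f : Fin 3 → Fin 3 → ℝ) (κ x y : ℝ), 0 < κ ∧ y ≤ x ∧
      (Matrix.of f) * M * (Matrix.of f)ᵀ = Matrix.diagonal ![1, 1, -1] ∧
      (Matrix.of f) * N * (Matrix.of f)ᵀ = Matrix.diagonal ![x, y, -κ] := by
  obtain ⟨ρ, p, hρ, hp, hpe⟩ := exists_mulVec_eq_smul_mulVec hM hN (exists_quad_neg hM hM1 hMdet) hMN
  obtain ⟨e, he, he2⟩ : ∃ e : ℝ, 0 < e ∧ e ^ 2 = -quad M p :=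
    ⟨_, Real.sqrt_pos.2 (neg_pos.2 hp), Real.sq_sqrt (neg_pos.2 hp).le⟩
  set f3 : Fin 3 → ℝ := e⁻¹ • p with hf3
  have hM3 : f3 ⬝ᵥ (M *ᵥ f3) = -1 := by
    change quad M f3 = -1
    rw [hf3, quad_smul, show quad M p = -e ^ 2 by linarith]
    field_simp
  have hMN3 : M *ᵥ f3 = ρ • (N *ᵥ f3) := by
    rw [hf3, Matrix.mulVec_smul, Matrix.mulVec_smul, hpe, smul_comm]
  have hN3 (w : Fin 3 → ℝ) : w ⬝ᵥ (N *ᵥ f3) = ρ⁻¹ * (w ⬝ᵥ (M *ᵥ f3)) := by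
    rw [hMN3, dotProduct_smul, smul_eq_mul, inv_mul_cancel_left₀ hρ.ne']
  set c : Fin 3 → ℝ := M *ᵥ f3 with hc
  -- The M-orthogonal projection of the basis vectors along f3; the sign is plus because M takes the
  -- value -1 at f3.
  set g : Fin 3 → Fin 3 → ℝ := fun i => Pi.single i 1 + c i • f3 with hg
  have hgc (i : Fin 3) : g i ⬝ᵥ c = 0 := by
    rw [hg, add_dotProduct, smul_dotProduct, hM3]
    simp
  have hcg (i : Fin 3) : f3 ⬝ᵥ (M *ᵥ g i) = 0 := by rw [← dotProduct_mulVec_comm hM]; exact hgc i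
  have hgg (i j : Fin 3) : g i ⬝ᵥ (M *ᵥ g j) = M i j + c i * c j := by
    have h1 : M *ᵥ g j = M.col j + c j • c := by
      rw [hg, Matrix.mulVec_add, Matrix.mulVec_smul, ← hc, Matrix.mulVec_single_one]
    rw [h1, dotProduct_add, dotProduct_smul, hgc, smul_zero, add_zero, hg, add_dotProduct,
      smul_dotProduct]
    have h2 : f3 ⬝ᵥ M.col j = c j := by
      rw [← Matrix.mulVec_single_one, ← dotProduct_mulVec_comm hM]
      simp [hc]
    rw [h2]
    simp
  have hN (w : Fin 3 → ℝ) : f3 ⬝ᵥ (N *ᵥ w) = w ⬝ᵥ (N *ᵥ f3) := dotProduct_mulVec_comm hN _ _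
  have h10 := hM.apply 0 1
  have hN10 : g 1 ⬝ᵥ (N *ᵥ g 0) = g 0 ⬝ᵥ (N *ᵥ g 1) := dotProduct_mulVec_comm ‹N.IsSymm› _ _
  -- The Gram matrix of g 0, g 1 is the positive definite upper block of M plus the rank one matrix
  -- c cᵀ.
  have hdet : 0 < (M 0 0 + c 0 * c 0) * (M 1 1 + c 1 * c 1) - (M 0 1 + c 0 * c 1) ^ 2 := by
    have : 0 ≤ M 0 0 * (M 0 0 * c 1 ^ 2 - 2 * M 0 1 * (c 0 * c 1) + M 1 1 * c 0 ^ 2) := by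
      nlinarith [sq_nonneg (M 0 0 * c 1 - M 0 1 * c 0), mul_nonneg hM1.le (sq_nonneg (c 0))]
    nlinarith [nonneg_of_mul_nonneg_right this hM0]
  obtain ⟨p, q, r, s, e1, e2, e3, e4⟩ := exists_diagonalization_two
    (by nlinarith [mul_self_nonneg (c 0)] : 0 < M 0 0 + c 0 * c 0) hdet
    (g 0 ⬝ᵥ (N *ᵥ g 0)) (g 0 ⬝ᵥ (N *ᵥ g 1)) (g 1 ⬝ᵥ (N *ᵥ g 1))
  have main (p q r s : ℝ)
      (e1 : (M 0 0 + c 0 * c 0) * p ^ 2 + 2 * (M 0 1 + c 0 * c 1) * p * q +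
        (M 1 1 + c 1 * c 1) * q ^ 2 = 1)
      (e2 : (M 0 0 + c 0 * c 0) * r ^ 2 + 2 * (M 0 1 + c 0 * c 1) * r * s +
        (M 1 1 + c 1 * c 1) * s ^ 2 = 1)
      (e3 : (M 0 0 + c 0 * c 0) * p * r + (M 0 1 + c 0 * c 1) * (p * s + q * r) +
        (M 1 1 + c 1 * c 1) * q * s = 0)
      (e4 : (g 0 ⬝ᵥ (N *ᵥ g 0)) * p * r + (g 0 ⬝ᵥ (N *ᵥ g 1)) * (p * s + q * r) +
        (g 1 ⬝ᵥ (N *ᵥ g 1)) * q * s = 0)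
      (e5 : quad N (r • g 0 + s • g 1) ≤ quad N (p • g 0 + q • g 1)) :
      ∃ (f : Fin 3 → Fin 3 → ℝ) (κ x y : ℝ), 0 < κ ∧ y ≤ x ∧
      (Matrix.of f) * M * (Matrix.of f)ᵀ = Matrix.diagonal ![1, 1, -1] ∧
      (Matrix.of f) * N * (Matrix.of f)ᵀ = Matrix.diagonal ![x, y, -κ] := by
    refine ⟨![p • g 0 + q • g 1, r • g 0 + s • g 1, f3], ρ⁻¹, quad N (p • g 0 + q • g 1),
      quad N (r • g 0 + s • g 1), inv_pos.2 hρ, e5, ?_, ?_⟩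
    · ext i j
      rw [of_mul_mul_transpose_of_apply]
      fin_cases i <;> fin_cases j <;>
        simp [Matrix.mulVec_add, Matrix.mulVec_smul, hgc, hcg, hgg, hM3, h10, ← hc]
      · linear_combination e1
      · linear_combination e3
      · linear_combination e3
      · linear_combination e2
    · ext i j
      rw [of_mul_mul_transpose_of_apply]
      fin_cases i <;> fin_cases j <;>
        simp [Matrix.mulVec_add, Matrix.mulVec_smul, hgc, hN3, hN, hM3, quad]
      · rw [hN10]
        linear_combination e4
      · rw [hN10]
        linear_combination e4
  rcases le_total (quad N (r • g 0 + s • g 1)) (quad N (p • g 0 + q • g 1)) with h | h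
  · exact main p q r s e1 e2 e3 e4 h
  · exact main r s p q e2 e1 (by linear_combination e3) (by linear_combination e4) h

theorem quad_of_transpose_mulVec (M : Mat ℝ) (f : Fin 3 → Fin 3 → ℝ) (a b c : ℝ)
    (h : (Matrix.of f) * M * (Matrix.of f)ᵀ = Matrix.diagonal ![a, b, c]) (w : Fin 3 → ℝ) :
    quad M ((Matrix.of f)ᵀ *ᵥ w) = a * w 0 ^ 2 + b * w 1 ^ 2 + c * w 2 ^ 2 := by
  rw [quad_mulVec, Matrix.transpose_transpose, h]
  simp [quad, Matrix.mulVec_diagonal, dotProduct, Fin.sum_univ_three]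
  ring

theorem exists_conicImage_eq_of_pos {M N : Mat ℝ} (hM : M.IsSymm) (hN : N.IsSymm)
    (hM0 : 0 < M 0 0) (hM1 : 0 < M 0 0 * M 1 1 - M 0 1 ^ 2) (hMdet : M.det < 0)
    (hN0 : 0 < N 0 0) (hNdet : N.det < 0)
    (hMN : ∀ w, w ≠ 0 → quad M w ≤ 0 → quad N w < 0) :
    ∃ (g : GL (Fin 3) ℝ) (κ A B : ℝ), 0 < κ ∧ 1 < A ∧ A ≤ B ∧
      conicImage g M = axisConic 1 1 ∧ conicImage g N = κ • axisConic A B := by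
  obtain ⟨f, κ, x, y, hκ, hyx, hfM, hfN⟩ := exists_gram_eq hM hN hM0 hM1 hMdet hMN
  have hdetF : (Matrix.of f).det ≠ 0 := by
    intro h0
    have := congrArg Matrix.det hfM
    rw [Matrix.det_mul, Matrix.det_mul, h0, Matrix.det_diagonal] at this
    simp [Fin.prod_univ_three] at this
  have hqM := quad_of_transpose_mulVec M f _ _ _ hfM
  have hqN := quad_of_transpose_mulVec N f _ _ _ hfN
  have hdetT : (Matrix.of f)ᵀ.det ≠ 0 := by rwa [Matrix.det_transpose]
  have hunit : IsUnit (Matrix.of f)ᵀ :=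
    (Matrix.isUnit_iff_isUnit_det _).2 (isUnit_iff_ne_zero.2 hdetT)
  have hinj := Matrix.mulVec_injective_of_isUnit hunit
  have hxy : 0 < x * y := by
    have := congrArg Matrix.det hfN
    rw [Matrix.det_mul, Matrix.det_mul, Matrix.det_transpose, Matrix.det_diagonal] at this
    simp [Fin.prod_univ_three] at this
    have h1 : 0 < (Matrix.of f).det ^ 2 := by positivity
    have h2 : x * y * κ = (Matrix.of f).det ^ 2 * -N.det := by linarith
    have h3 : 0 < x * y * κ := by rw [h2]; exact mul_pos h1 (neg_pos.2 hNdet)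
    exact pos_of_mul_pos_left h3 hκ.le
  -- The point [1 : 0 : 1] lies on the normalized inner circle, so N is negative there.
  have hx : x < κ := by
    have := hMN ((Matrix.of f)ᵀ *ᵥ ![1, 0, 1]) (fun h0 => by
      have := congrFun (hinj (h0.trans (Matrix.mulVec_zero _).symm)) 0
      simp at this) (by rw [hqM]; simp)
    rw [hqN] at this
    simp at this
    linarith
  -- Two negative coefficients would make N negative definite, against `hN0`.
  have hpos : 0 < x ∧ 0 < y := by
    rcases pos_and_pos_or_neg_and_neg_of_mul_pos hxy with h | h
    · exact h
    · exfalso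
      obtain ⟨w, hw⟩ := (Matrix.mulVec_surjective_iff_isUnit.2 hunit) (Pi.single 0 1)
      have h1 := hqN w
      rw [hw] at h1
      have h2 : quad N (Pi.single 0 1) = N 0 0 := by simp [quad]
      nlinarith [mul_nonneg (neg_pos.2 h.1).le (sq_nonneg (w 0)),
        mul_nonneg (neg_pos.2 h.2).le (sq_nonneg (w 1)), mul_nonneg hκ.le (sq_nonneg (w 2))]
  have hval : ((hunit.unit : GL (Fin 3) ℝ) : Mat ℝ) = (Matrix.of f)ᵀ := rfl
  refine ⟨hunit.unit⁻¹, κ, κ / x, κ / y, hκ, (one_lt_div hpos.1).2 hx,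
    div_le_div_of_nonneg_left hκ.le hpos.2 hyx, ?_, ?_⟩
  · rw [conicImage_inv, hval, Matrix.transpose_transpose, hfM, axisConic]
    simp
  · rw [conicImage_inv, hval, Matrix.transpose_transpose, hfN, axisConic]
    ext i j
    fin_cases i <;> fin_cases j <;> simp <;> field_simp

/-- Scaling by the trace of the block at infinity fixes the sign ambiguity: that block becomes
positive definite and the interior is where the form is negative. -/
theorem IsEllipse.exists_smul {M : Mat ℝ} (hM : IsEllipse M) :
    ∃ s : ℝ, s ≠ 0 ∧ (s • M).IsSymm ∧ 0 < (s • M) 0 0 ∧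
      0 < (s • M) 0 0 * (s • M) 1 1 - (s • M) 0 1 ^ 2 ∧ (s • M).det < 0 ∧
      ∀ w, quad (s • M) w < 0 ↔ (M 0 0 + M 1 1) * quad M w < 0 := by
  obtain ⟨h1, h2, h3⟩ := hM
  refine ⟨M 0 0 + M 1 1, fun h0 => by simp [h0] at h3, h1.smul _, ?_, ?_, ?_, ?_⟩
  · simp
    nlinarith [sq_nonneg (M 0 0), sq_nonneg (M 0 1)]
  · have h0 : M 0 0 + M 1 1 ≠ 0 := fun h0 => by simp [h0] at h3
    simp
    have : 0 < (M 0 0 + M 1 1) ^ 2 * (M 0 0 * M 1 1 - M 0 1 ^ 2) := by positivity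
    nlinarith
  · have h0 : M 0 0 + M 1 1 ≠ 0 := fun h0 => by simp [h0] at h3
    rw [Matrix.det_smul, Fintype.card_fin]
    have : (M 0 0 + M 1 1) ^ 2 * ((M 0 0 + M 1 1) * M.det) < 0 :=
      mul_neg_of_pos_of_neg (by positivity) h3
    linarith
  · intro w
    simp [quad, Matrix.smul_mulVec]

theorem quad_smul_matrix (s : ℝ) (M : Mat ℝ) (w : Fin 3 → ℝ) : quad (s • M) w = s * quad M w := by
  simp [quad, Matrix.smul_mulVec]

theorem conicImage_smul (g : GL (Fin 3) ℝ) (s : ℝ) (M : Mat ℝ) :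
    conicImage g (s • M) = s • conicImage g M := by
  simp [conicImage]

/-- A nested pair of ellipses is projectively equivalent to the unit circle and an ellipse
with the same axes. -/
theorem exists_normalForm {M N : Mat ℝ} (hM : IsEllipse M) (hN : IsEllipse N) (h : Nested M N) :
    ∃ (g : GL (Fin 3) ℝ) (s s' A B : ℝ), s ≠ 0 ∧ s' ≠ 0 ∧ 1 < A ∧ A ≤ B ∧
      conicImage g M = s • axisConic 1 1 ∧ conicImage g N = s' • axisConic A B := by
  obtain ⟨s, hs, hM1, hM2, hM3, hM4, hM5⟩ := hM.exists_smul
  obtain ⟨s', hs', hN1, hN2, hN3, hN4, hN5⟩ := hN.exists_smul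
  obtain ⟨g, κ, A, B, hκ, hA, hAB, h1, h2⟩ :=
    exists_conicImage_eq_of_pos hM1 hN1 hM2 hM3 hM4 hN2 hN4 (fun w hw hle => by
      set p := Projectivization.mk ℝ w hw
      obtain ⟨a, ha⟩ := Projectivization.exists_smul_eq_mk_rep ℝ w hw
      have hrep : p.rep = (a : ℝ) • w := ha.symm
      have ha2 : 0 < (a : ℝ) ^ 2 := by have := a.ne_zero; positivity
      have hin : p ∈ locus M ∨ Inside M p := by
        rcases hle.eq_or_lt with h0 | h0
        · left
          rw [quad_smul_matrix] at h0
          exact (mk_mem_locus hw).2 ((mul_eq_zero.1 h0).resolve_left hs)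
        · right
          rw [Inside, ← hM5, hrep, quad_smul]
          exact mul_neg_of_pos_of_neg ha2 h0
      have h3 := h p hin
      rw [Inside, ← hN5, hrep, quad_smul] at h3
      exact neg_of_mul_neg_right h3 ha2.le)
  rw [conicImage_smul] at h1 h2
  refine ⟨g, s⁻¹, s'⁻¹ * κ, A, B, inv_ne_zero hs, mul_ne_zero (inv_ne_zero hs') hκ.ne', hA, hAB,
    ?_, ?_⟩
  · rw [← h1, inv_smul_smul₀ hs]
  · rw [mul_smul, ← h2, inv_smul_smul₀ hs']

end NormalForm

/-! ### Tangent lines of the unit circle -/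

namespace IsAmplitude

variable {m K : ℝ} {φ : ℝ → ℝ} (h : IsAmplitude m K φ)
include h

theorem sn_zero : sn φ 0 = 0 := by simp [sn, h.map_zero]

theorem cn_zero : cn φ 0 = 1 := by simp [cn, h.map_zero]

theorem dn_zero : dn m φ 0 = 1 := by simp [dn, h.sn_zero]

theorem add_four_K (t : ℝ) (j : ℤ) : φ (t + 4 * K * j) = φ t + j * (2 * Real.pi) := by
  have := h.add_int t (2 * j)
  push_cast at this
  rw [show t + 4 * K * j = t + 2 * K * (2 * j) by ring, this]
  ring

theorem sn_add_four_K (t : ℝ) (j : ℤ) : sn φ (t + 4 * K * j) = sn φ t := by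
  rw [sn, h.add_four_K, Real.sin_add_int_mul_two_pi, sn]

theorem cn_add_four_K (t : ℝ) (j : ℤ) : cn φ (t + 4 * K * j) = cn φ t := by
  rw [cn, h.add_four_K, Real.cos_add_int_mul_two_pi, cn]

theorem sn_two_K_sub (t : ℝ) : sn φ (2 * K - t) = sn φ t := by
  rw [sn, show 2 * K - t = -t + 2 * K by ring, h.add_two_K, h.neg, Real.sin_add_pi, Real.sin_neg,
    neg_neg, sn]

theorem cn_two_K_sub (t : ℝ) : cn φ (2 * K - t) = -cn φ t := by
  rw [cn, show 2 * K - t = -t + 2 * K by ring, h.add_two_K, h.neg, Real.cos_add_pi, Real.cos_neg,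
    cn]

theorem exists_eq_of_sn_eq_cn_eq {x y : ℝ} (hs : sn φ x = sn φ y) (hc : cn φ x = cn φ y) :
    ∃ j : ℤ, x = y + 4 * K * j := by
  have h1 : (φ x : Real.Angle) = φ y := Real.Angle.cos_sin_inj hc hs
  obtain ⟨j, hj⟩ := Real.Angle.angle_eq_iff_two_pi_dvd_sub.1 h1
  refine ⟨j, h.strictMono.injective ?_⟩
  rw [h.add_four_K]
  linarith

theorem exists_eq_of_sn_sq_eq {x y : ℝ} (hs : sn φ x ^ 2 = sn φ y ^ 2) :
    ∃ j : ℤ, x = y + 2 * K * j ∨ x = -y + 2 * K * j := by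
  have h1 : Real.cos (2 * φ x) = Real.cos (2 * φ y) := by
    rw [Real.cos_two_mul, Real.cos_two_mul]
    have e1 := sn_sq_add_cn_sq φ x
    have e2 := sn_sq_add_cn_sq φ y
    simp only [sn, cn] at *
    linarith
  obtain ⟨j, hj⟩ := Real.cos_eq_cos_iff.1 h1
  rcases hj with hj | hj
  · refine ⟨-j, Or.inl (h.strictMono.injective ?_)⟩
    rw [h.add_int]
    push_cast
    linarith
  · refine ⟨j, Or.inr (h.strictMono.injective ?_)⟩
    rw [h.add_int, h.neg]
    linarith

theorem exists_eq_of_sn_eq_zero {x : ℝ} (hs : sn φ x = 0) : ∃ j : ℤ, x = 2 * K * j := by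
  obtain ⟨j, hj⟩ := h.exists_eq_of_sn_sq_eq (x := x) (y := 0) (by rw [hs, h.sn_zero])
  exact ⟨j, by simpa using hj⟩

theorem exists_eq_of_cn_eq_zero {x : ℝ} (hs : cn φ x = 0) : ∃ j : ℤ, x = K + 2 * K * j := by
  have h1 := sn_sq_add_cn_sq φ x
  have h2 : sn φ K = 1 := by rw [sn, h.map_K, Real.sin_pi_div_two]
  obtain ⟨j, hj | hj⟩ := h.exists_eq_of_sn_sq_eq (x := x) (y := K) (by rw [h2]; rw [hs] at h1; linarith)
  · exact ⟨j, hj⟩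
  · exact ⟨j - 1, by rw [hj]; push_cast; ring⟩

theorem exists_sn_cn {x y : ℝ} (hxy : x ^ 2 + y ^ 2 = 1) : ∃ t, sn φ t = x ∧ cn φ t = y := by
  obtain ⟨t, ht⟩ := h.surjective (Complex.arg ⟨y, x⟩)
  have hn : ‖(⟨y, x⟩ : ℂ)‖ = 1 := by
    rw [Complex.norm_def, Real.sqrt_eq_one, Complex.normSq_mk]
    linarith
  refine ⟨t, ?_, ?_⟩
  · have := Complex.norm_mul_sin_arg ⟨y, x⟩
    rw [hn, one_mul] at this
    rw [sn, ht, this]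
  · have := Complex.norm_mul_cos_arg ⟨y, x⟩
    rw [hn, one_mul] at this
    rw [cn, ht, this]

end IsAmplitude

/-- The tangent line of the unit circle at the point with elliptic parameter `t`. -/
def tangentLine (φ : ℝ → ℝ) (t : ℝ) : Line ℝ :=
  Projectivization.mk ℝ ![sn φ t, cn φ t, -1] (fun h => by simpa using congrFun h 2)

theorem quad_adjugate_diagonal {F : Type*} [Field F] (a b c : F) (w : Fin 3 → F) :
    quad (Matrix.diagonal ![a, b, c]).adjugate w =
      b * c * w 0 ^ 2 + a * c * w 1 ^ 2 + a * b * w 2 ^ 2 := by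
  rw [Matrix.adjugate_fin_three]
  simp [quad, dotProduct, Matrix.mulVec, Fin.sum_univ_three]
  ring

theorem det_axisConic (a b : ℝ) : (axisConic a b).det = -(1 / a * (1 / b)) := by
  simp [axisConic, Matrix.det_diagonal, Fin.prod_univ_three]

namespace IsAmplitude

variable {m K : ℝ} {φ : ℝ → ℝ} (h : IsAmplitude m K φ)
include h

theorem tangentLine_eq_iff {x y : ℝ} :
    tangentLine φ x = tangentLine φ y ↔ ∃ j : ℤ, x = y + 4 * K * j := by
  constructor
  · intro hxy
    obtain ⟨a, ha⟩ := (Projectivization.mk_eq_mk_iff' ℝ _ _ _ _).1 hxy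
    have h2 : a = 1 := by simpa using congrFun ha 2
    subst h2
    have h0 := congrFun ha 0
    have h1 := congrFun ha 1
    simp only [one_smul, Matrix.cons_val_zero, Matrix.cons_val_one] at h0 h1
    exact h.exists_eq_of_sn_eq_cn_eq h0.symm h1.symm
  · rintro ⟨j, rfl⟩
    simp only [tangentLine, h.sn_add_four_K, h.cn_add_four_K]

theorem exists_eq_tangentLine {u : Line ℝ} (hu : IsTangent (axisConic 1 1) u) :
    ∃ t, u = tangentLine φ t := by
  induction u using Projectivization.ind with | h u hu0 =>
  rw [isTangent_mk_iff (isSymm_axisConic 1 1) (by simp [det_axisConic]), axisConic,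
    quad_adjugate_diagonal] at hu
  have h2 : u 2 ≠ 0 := fun h2 => hu0 <| by
    rw [h2] at hu
    have : u 0 ^ 2 + u 1 ^ 2 = 0 := by linarith
    have h0 : u 0 = 0 := by nlinarith [sq_nonneg (u 0), sq_nonneg (u 1)]
    have h1 : u 1 = 0 := by nlinarith [sq_nonneg (u 0), sq_nonneg (u 1)]
    ext i
    fin_cases i <;> simp [h0, h1, h2]
  obtain ⟨t, ht1, ht2⟩ := h.exists_sn_cn (x := -(u 0 / u 2)) (y := -(u 1 / u 2)) (by
    field_simp; linarith)
  refine ⟨t, mk_eq_mk_of_smul _ _ (-u 2) ?_⟩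
  ext i
  fin_cases i <;> simp [ht1, ht2] <;> field_simp

theorem point_ne_zero (x y : ℝ) : (![sn φ x * dn m φ y, cn φ x, cn φ y] : Fin 3 → ℝ) ≠ 0 := by
  intro h0
  have h1 : sn φ x * dn m φ y = 0 := by simpa using congrFun h0 0
  have h2 : cn φ x = 0 := by simpa using congrFun h0 1
  have h3 := sn_sq_add_cn_sq φ x
  rw [(mul_eq_zero.1 h1).resolve_right (h.dn_pos y).ne', h2] at h3
  norm_num at h3

/-- The intersection point of the tangent lines with the parameters `x + y` and `x - y`. -/
def point (x y : ℝ) : Plane ℝ := Projectivization.mk ℝ _ (h.point_ne_zero x y)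

/-- The incidence is exactly `law_of_cosines`. -/
theorem onLine_point_add (x y : ℝ) : OnLine (h.point x y) (tangentLine φ (x + y)) := by
  rw [point, tangentLine, onLine_mk]
  have := h.law_of_cosines x y
  simp [dotProduct, Fin.sum_univ_three]
  linarith

theorem onLine_point_sub (x y : ℝ) : OnLine (h.point x y) (tangentLine φ (x - y)) := by
  -- The point is even in y, since cn and dn are.
  have h1 : h.point x y = h.point x (-y) := by
    simp only [point, h.dn_neg, h.cn_neg]
  rw [h1, sub_eq_add_neg]
  exact h.onLine_point_add x (-y)

theorem eq_point {x y : ℝ} {p : Plane ℝ} (hne : tangentLine φ x ≠ tangentLine φ y)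
    (hx : OnLine p (tangentLine φ x)) (hy : OnLine p (tangentLine φ y)) :
    p = h.point ((x + y) / 2) ((x - y) / 2) := by
  have h1 := h.onLine_point_add ((x + y) / 2) ((x - y) / 2)
  have h2 := h.onLine_point_sub ((x + y) / 2) ((x - y) / 2)
  rw [show (x + y) / 2 + (x - y) / 2 = x by ring] at h1
  rw [show (x + y) / 2 - (x - y) / 2 = y by ring] at h2
  exact eq_of_onLine_of_onLine hne hx hy h1 h2

theorem eq_point_zero {t : ℝ} {p : Plane ℝ} (hp : OnLine p (tangentLine φ t))
    (hp' : p ∈ locus (axisConic 1 1)) : p = h.point t 0 := by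
  induction p using Projectivization.ind with | h p hp0 =>
  rw [tangentLine, onLine_mk] at hp
  rw [mk_mem_locus, quad_axisConic] at hp'
  simp only [dotProduct, Fin.sum_univ_three, Matrix.cons_val_zero, Matrix.cons_val_one,
    Matrix.cons_val] at hp
  have e := sn_sq_add_cn_sq φ t
  -- The equations of circle and tangent combine to a vanishing sum of squares, so the only common
  -- point is the point of tangency.
  have hsum : (p 0 - p 2 * sn φ t) ^ 2 + (p 1 - p 2 * cn φ t) ^ 2 = 0 := by
    linear_combination hp' - 2 * p 2 * hp + p 2 ^ 2 * e
  have h0 : p 0 = p 2 * sn φ t := by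
    nlinarith [sq_nonneg (p 0 - p 2 * sn φ t), sq_nonneg (p 1 - p 2 * cn φ t)]
  have h1 : p 1 = p 2 * cn φ t := by
    nlinarith [sq_nonneg (p 0 - p 2 * sn φ t), sq_nonneg (p 1 - p 2 * cn φ t)]
  refine mk_eq_mk_of_smul _ _ (p 2) ?_
  ext i
  fin_cases i <;> simp [h0, h1, h.dn_zero, h.cn_zero]

/-- The tangents with parameters `x + y` and `x - y` meet on a confocal ellipse that depends
only on `y`. -/
theorem sn_sq_of_point_mem_locus {A B x y : ℝ} (hA : 1 < A) (hAB : A - 1 = (1 - m) * (B - 1))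
    (hp : h.point x y ∈ locus (axisConic A B)) : B * sn φ y ^ 2 = B - 1 := by
  rw [point, mk_mem_locus, quad_axisConic] at hp
  simp only [Matrix.cons_val_zero, Matrix.cons_val_one, Matrix.cons_val, mul_pow, h.dn_sq] at hp
  have hB : 1 < B := by
    have h1 : 0 < (1 - m) * (B - 1) := by linarith
    have := pos_of_mul_pos_right h1 (sub_pos.2 h.m_lt_one).le
    linarith
  have e1 := sn_sq_add_cn_sq φ x
  have e2 := sn_sq_add_cn_sq φ y
  rw [show cn φ x ^ 2 = 1 - sn φ x ^ 2 by linarith, show cn φ y ^ 2 = 1 - sn φ y ^ 2 by linarith]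
    at hp
  have hA0 : A ≠ 0 := by linarith
  have hB0 : B ≠ 0 := by linarith
  field_simp at hp
  obtain rfl : A = 1 + (1 - m) * (B - 1) := by linarith
  -- The equation factors. The second factor is -(dn² x + (A - 1)), which is negative, so the
  -- condition involves y only.
  have key : ((B - 1) - B * sn φ y ^ 2) * (m * sn φ x ^ 2 - (1 + (1 - m) * (B - 1))) = 0 := by
    linear_combination hp
  rcases mul_eq_zero.1 key with h1 | h1
  · linarith
  · exfalso
    have h2 := h.dn_sq x
    have h3 := pow_pos (h.dn_pos x) 2
    linarith

end IsAmplitude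

/-! ### The sides of a Poncelet polygon -/

section Sides

variable {n : ℕ} {m K A B : ℝ} {φ : ℝ → ℝ} {v : ZMod n → Plane ℝ} {ℓ : ZMod n → Line ℝ}

/-- By `sn_sq_of_point_mem_locus` the half-differences of the parameters of consecutive sides share
one value of sn², so they agree up to sign and up to multiples of 2K. A sign change would make the
polygon turn back onto an earlier side, so the parameters form an arithmetic progression modulo 4K,
whose step is a multiple of 4K/n because the polygon closes. -/
theorem IsAmplitude.exists_isSide_eq (h : IsAmplitude m K φ) (hA : 1 < A)
    (hAB : A - 1 = (1 - m) * (B - 1)) (hn : 3 ≤ n)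
    (hv : IsPonceletPolygon (axisConic 1 1) (axisConic A B) v) :
    ∃ t₀ : ℝ, ∀ u, IsSide v u → ∃ j : ℤ, u = tangentLine φ (t₀ + 4 * K / n * j) := by
  have : Fact (1 < n) := ⟨by omega⟩
  have hn0 : (n : ℝ) ≠ 0 := by positivity
  have hB : 1 < B := by
    have h1 : 0 < (1 - m) * (B - 1) := by linarith
    have := pos_of_mul_pos_right h1 (sub_pos.2 h.m_lt_one).le
    linarith
  have hdet : (axisConic A B).det ≠ 0 := by
    rw [det_axisConic]
    have : 0 < A := by linarith
    have : 0 < B := by linarith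
    exact neg_ne_zero.2 (by positivity)
  have h2 : (2 : ZMod n) ≠ 0 := fun h2 => by
    have h3 := (ZMod.natCast_eq_zero_iff 2 n).1 (by exact_mod_cast h2)
    have := Nat.le_of_dvd two_pos h3
    omega
  have hvne (i : ZMod n) : v i ≠ v (i + 1) := fun hi => by simpa using hv.1 hi
  choose S hS hS' using fun i : ZMod n => exists_onLine (v i) (v (i + 1))
  choose τ hτ using fun i : ZMod n => h.exists_eq_tangentLine (hv.2.2 (S i) ⟨i, hS i, hS' i⟩)
  have hside (u : Line ℝ) (i : ZMod n) (h1 : OnLine (v i) u) (h2 : OnLine (v (i + 1)) u) :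
      u = S i := by
    by_contra hne
    exact hvne i (eq_of_onLine_of_onLine hne h1 (hS i) h2 (hS' i))
  have hSne (i : ZMod n) : S i ≠ S (i + 1) := fun heq => by
    have h3 := hS' (i + 1)
    rw [← heq] at h3
    rcases eq_or_eq_of_onLine_of_mem_locus (isSymm_axisConic A B) hdet (hvne i) (hS i) (hS' i) h3
      (hv.2.1 _) (hv.2.1 _) (hv.2.1 _) with h4 | h4
    · have := hv.1 h4
      rw [add_assoc, one_add_one_eq_two] at this
      exact h2 (by simpa using this)
    · have := hv.1 h4
      simp at this
  -- Otherwise three vertices, distinct because n ≥ 3, would lie on one line, which meets Γ at most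
  -- twice.
  have hS2 (i : ZMod n) : S i ≠ S (i + 1 + 1) := fun heq => by
    have h3 := hS (i + 1 + 1)
    rw [← heq] at h3
    rcases eq_or_eq_of_onLine_of_mem_locus (isSymm_axisConic A B) hdet (hvne i) (hS i) (hS' i) h3
      (hv.2.1 _) (hv.2.1 _) (hv.2.1 _) with h4 | h4
    · have := hv.1 h4
      rw [add_assoc, one_add_one_eq_two] at this
      exact h2 (by simpa using this)
    · have := hv.1 h4
      simp at this
  have hsn (i : ZMod n) : B * sn φ ((τ (i + 1) - τ i) / 2) ^ 2 = B - 1 := by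
    have h3 := hS (i + 1)
    have h4 := hS' i
    have h5 := (hSne i).symm
    rw [hτ] at h3 h4
    rw [hτ (i + 1), hτ i] at h5
    have h6 := h.eq_point h5 h3 h4
    exact h.sn_sq_of_point_mem_locus hA hAB (h6 ▸ hv.2.1 (i + 1))
  have hstep (i : ZMod n) : ∃ j : ℤ, τ (i + 1 + 1) - τ (i + 1) = τ (i + 1) - τ i + 4 * K * j := by
    have h3 : sn φ ((τ (i + 1 + 1) - τ (i + 1)) / 2) ^ 2 = sn φ ((τ (i + 1) - τ i) / 2) ^ 2 :=
      mul_left_cancel₀ (by linarith : B ≠ 0) ((hsn (i + 1)).trans (hsn i).symm)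
    obtain ⟨j, hj | hj⟩ := h.exists_eq_of_sn_sq_eq h3
    · exact ⟨j, by linarith⟩
    -- With the opposite sign the parameter returns, modulo 4K, to that of the side before.
    · exfalso
      refine hS2 i ?_
      rw [hτ i, hτ (i + 1 + 1), eq_comm, h.tangentLine_eq_iff]
      exact ⟨j, by linarith⟩
  have hD (k : ℕ) : ∃ j : ℤ, τ (k + 1) - τ k = τ 1 - τ 0 + 4 * K * j := by
    induction k with
    | zero => exact ⟨0, by simp⟩
    | succ k ih =>
      obtain ⟨j, hj⟩ := ih
      obtain ⟨j', hj'⟩ := hstep k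
      exact ⟨j + j', by push_cast; linarith⟩
  have hk (k : ℕ) : ∃ j : ℤ, τ k = τ 0 + k * (τ 1 - τ 0) + 4 * K * j := by
    induction k with
    | zero => exact ⟨0, by simp⟩
    | succ k ih =>
      obtain ⟨j, hj⟩ := ih
      obtain ⟨j', hj'⟩ := hD k
      exact ⟨j + j', by push_cast; linarith⟩
  obtain ⟨N, hN⟩ := hk n
  rw [ZMod.natCast_self] at hN
  refine ⟨τ 0, ?_⟩
  rintro u ⟨i, h1, h2⟩
  obtain ⟨j, hj⟩ := hk i.val
  rw [ZMod.natCast_zmod_val] at hj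
  -- Since τ n = τ 0, the relation `hN` makes the step τ 1 - τ 0 equal to -N · 4K/n.
  refine ⟨-i.val * N, ?_⟩
  rw [hside u i h1 h2, hτ i, h.tangentLine_eq_iff]
  refine ⟨j, ?_⟩
  have hD' : τ 1 - τ 0 = 4 * K / n * (-N) := by
    field_simp
    linarith
  rw [hj, hD']
  push_cast
  ring

/-! ### Cyclic order of the tangency points -/

theorem sin_add_sin_sub_sin_add (x y : ℝ) : Real.sin x + Real.sin y - Real.sin (x + y) =
    4 * Real.sin (x / 2) * Real.sin (y / 2) * Real.sin ((x + y) / 2) := by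
  obtain ⟨a, rfl⟩ : ∃ a, x = 2 * a := ⟨x / 2, by ring⟩
  obtain ⟨b, rfl⟩ : ∃ b, y = 2 * b := ⟨y / 2, by ring⟩
  rw [show (2 * a + 2 * b) / 2 = a + b by ring, show 2 * a + 2 * b = 2 * (a + b) by ring,
    Real.sin_two_mul, Real.sin_two_mul, Real.sin_two_mul, mul_div_cancel_left₀ _ two_ne_zero,
    mul_div_cancel_left₀ _ two_ne_zero, Real.sin_add, Real.cos_add]
  have e1 := Real.sin_sq_add_cos_sq a
  have e2 := Real.sin_sq_add_cos_sq b
  linear_combination (-2 * Real.sin a * Real.cos a) * e2 - 2 * Real.sin b * Real.cos b * e1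

/-- The orientation of three points of the unit circle. -/
theorem det_circle (a b c : ℝ) :
    (!![Real.cos a, Real.cos b, Real.cos c; Real.sin a, Real.sin b, Real.sin c; 1, 1, 1]).det =
      4 * Real.sin ((b - a) / 2) * Real.sin ((c - b) / 2) * Real.sin ((c - a) / 2) := by
  have h1 := sin_add_sin_sub_sin_add (b - a) (c - b)
  rw [show b - a + (c - b) = c - a by ring] at h1
  rw [← h1, Matrix.det_fin_three]
  simp [Real.sin_sub]
  ring

/-- Strict growth squeezes μ from both ends: induction from 0 gives k ≤ μ k, and induction down from
n - 1 gives the reverse. -/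
theorem eq_self_of_strictMonoOn {n : ℤ} {μ : ℤ → ℤ} (h0 : 0 ≤ μ 0) (hlt : ∀ i, 0 < i → i < n → μ i < n)
    (hmono : ∀ b c, 0 ≤ b → b < c → c < n → μ b < μ c) (i : ℤ) (hi : 0 ≤ i) (hin : i < n)
    (hn : 2 ≤ n) : μ i = i := by
  have h1 (k : ℕ) : (k : ℤ) < n → (k : ℤ) ≤ μ k := by
    induction k with
    | zero => intro _; simpa using h0
    | succ k ih =>
      intro hk
      push_cast at hk ⊢
      have := hmono k (k + 1) (by positivity) (by omega) hk
      have := ih (by omega)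
      omega
  have h2 (k : ℕ) : (k : ℤ) < n → μ (n - 1 - k) ≤ n - 1 - k := by
    induction k with
    | zero =>
      intro _
      have := hlt (n - 1) (by omega) (by omega)
      simp
      omega
    | succ k ih =>
      intro hk
      push_cast at hk ⊢
      have := hmono (n - 1 - (k + 1)) (n - 1 - k) (by omega) (by omega) (by omega)
      have := ih (by omega)
      omega
  lift i to ℕ using hi
  have h3 := h2 (n - 1 - i).toNat (by omega)
  rw [Int.toNat_of_nonneg (by omega), show n - 1 - (n - 1 - (i : ℤ)) = i by ring] at h3
  exact le_antisymm h3 (h1 i hin)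

/-- A cyclically ordered enumeration of `ℤ / n` is a shift or a reflection. -/
theorem eq_or_eq_sub_of_cyclic {n : ℤ} (hn : 3 ≤ n) {μ : ℤ → ℤ} (h0 : μ 0 = 0)
    (hμ : ∀ i, 0 ≤ μ i ∧ μ i < n) {ε : ℝ}
    (hε : ∀ a b c, 0 ≤ a → a < b → b < c → c < n →
      0 < ε * ((μ b - μ a) * (μ c - μ b) * (μ c - μ a))) :
    (∀ i, 0 ≤ i → i < n → μ i = i) ∨ (∀ i, 0 < i → i < n → μ i = n - i) := by
  -- If μ b equalled μ 0, the product for a triple containing 0 and b would vanish; the third index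
  -- is n - 1, or 1 when b = n - 1.
  have hpos (b : ℤ) (hb : 0 < b) (hbn : b < n) : 0 < μ b := by
    refine lt_of_le_of_ne (hμ b).1 fun hb0 => ?_
    rcases lt_or_ge b (n - 1) with h | h
    · have := hε 0 b (n - 1) le_rfl hb h (by omega)
      simp [← hb0, h0] at this
    · obtain rfl : b = n - 1 := by omega
      have := hε 0 1 (n - 1) le_rfl one_pos (by omega) (by omega)
      simp [← hb0, h0] at this
  have hord (b c : ℤ) (hb : 0 < b) (hbc : b < c) (hc : c < n) : 0 < ε * ((μ c : ℝ) - μ b) := by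
    have h1 := hε 0 b c le_rfl hb hbc hc
    have h2 : (0 : ℝ) < μ b := by exact_mod_cast hpos b hb (by omega)
    have h3 : (0 : ℝ) < μ c := by exact_mod_cast hpos c (by omega) hc
    rw [h0, Int.cast_zero, sub_zero, sub_zero] at h1
    have h4 : ε * (μ b * ((μ c : ℝ) - μ b) * μ c) = (μ b * μ c) * (ε * ((μ c : ℝ) - μ b)) := by ring
    rw [h4] at h1
    exact pos_of_mul_pos_right h1 (mul_pos h2 h3).le
  rcases lt_or_ge 0 ε with h | h
  · left
    intro i hi hin
    refine eq_self_of_strictMonoOn h0.ge (fun i _ _ => (hμ i).2) (fun b c hb hbc hc => ?_) i hi hin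
      (by omega)
    rcases hb.eq_or_lt with rfl | hb
    · rw [h0]; exact hpos c hbc hc
    · have := pos_of_mul_pos_right (hord b c hb hbc hc) h.le
      exact_mod_cast sub_pos.1 this
  · right
    intro i hi hin
    -- For negative ε the map μ decreases on 1, …, n - 1, so its complement n - μ, set to 0 at 0,
    -- increases.
    have := eq_self_of_strictMonoOn (n := n) (μ := fun i => if i = 0 then 0 else n - μ i) (by simp)
      (fun i hi hin => by have := hpos i hi hin; simp [hi.ne']; omega) (fun b c hb hbc hc => ?_) i
      hi.le hin (by omega)
    · simp only [hi.ne', if_false] at this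
      omega
    · have hc0 : c ≠ 0 := by omega
      rcases hb.eq_or_lt with rfl | hb
      · have := (hμ c).2
        simp [hc0, this]
      · have h1 := hord b c hb hbc hc
        have h2 : (μ c : ℝ) < μ b := by
          by_contra hcon
          have := mul_nonpos_of_nonpos_of_nonneg h (sub_nonneg.2 (not_lt.1 hcon))
          linarith
        have h3 : μ c < μ b := by exact_mod_cast h2
        simp [hc0, hb.ne', h3]

/-- Cyclic order is read from the sign of the orientation determinant of three points. A projective
map between conics in the affine chart multiplies this sign by a constant, so the indices of the
sides modulo n form a cyclically ordered or reversed sequence, which `eq_or_eq_sub_of_cyclic` makes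
a shift or a reflection. -/
theorem IsAmplitude.exists_enumeration (h : IsAmplitude m K φ) (hn : 3 ≤ n)
    (hcyc : IsCyclicEnumeration (axisConic 1 1) v ℓ) {t₀ : ℝ}
    (hside : ∀ u, IsSide v u → ∃ j : ℤ, u = tangentLine φ (t₀ + 4 * K / n * j)) :
    ∃ u₀ δ : ℝ, (n * δ = 2 * K ∨ n * δ = -(2 * K)) ∧
      ∀ i : ℤ, ℓ i = tangentLine φ (u₀ + 2 * i * δ) := by
  obtain ⟨hr, g, θ, hg, hθ, hper, hon⟩ := hcyc
  have hn0 : (n : ℝ) ≠ 0 := by positivity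
  have hnpos : (0 : ℝ) < n := by positivity
  have hnz : (n : ℤ) ≠ 0 := by positivity
  have hK := h.K_pos
  have hℓ (i : ZMod n) : ∃ j : ℤ, ℓ i = tangentLine φ (t₀ + 4 * K / n * j) :=
    hside _ (by have : ℓ i ∈ Set.range ℓ := ⟨i, rfl⟩; rwa [hr] at this)
  choose J hJ using hℓ
  set u₀ := t₀ + 4 * K / n * J 0 with hu₀
  set μ : ℤ → ℤ := fun i => (J i - J 0) % n with hμdef
  have hμ (i : ℤ) : 0 ≤ μ i ∧ μ i < n :=
    ⟨Int.emod_nonneg _ hnz, Int.emod_lt_of_pos _ (by positivity)⟩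
  have hμ0 : μ 0 = 0 := by simp [hμdef]
  have hℓμ (i : ℤ) : ℓ i = tangentLine φ (u₀ + 4 * K / n * μ i) := by
    rw [hJ, h.tangentLine_eq_iff]
    refine ⟨(J i - J 0) / n, ?_⟩
    have h1 : ((J i - J 0 : ℤ) : ℝ) = n * ((J i - J 0) / n : ℤ) + μ i := by
      exact_mod_cast (Int.mul_ediv_add_emod (J i - J 0) n).symm
    push_cast at h1
    have h2 : (J i : ℝ) = J 0 + (n * ((J i - J 0) / n : ℤ) + μ i) := by rw [← h1]; ring
    rw [hu₀, h2]
    field_simp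
    ring
  set x : ℤ → ℝ := fun i => u₀ + 4 * K / n * μ i with hx
  -- The third coordinate of the transformed circle point. It never vanishes, because the unit
  -- circle misses the line at infinity, so by continuity it has constant sign.
  set R : ℝ → ℝ := fun t => ((g : Mat ℝ) *ᵥ ![Real.cos t, Real.sin t, 1]) 2 with hR
  have hcircle (t : ℝ) : g • circlePoint t ∈ locus (axisConic 1 1) := by
    rw [← hg]
    exact Set.smul_mem_smul_set ⟨t, rfl⟩
  have hRne (t : ℝ) : R t ≠ 0 := by
    intro h0
    have h1 := hcircle t
    rw [circlePoint, gl_smul_mk, mk_mem_locus, quad_axisConic] at h1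
    set w := (g : Mat ℝ) *ᵥ ![Real.cos t, Real.sin t, 1] with hw
    have h2 : w 2 = 0 := h0
    rw [h2] at h1
    have hw0 : w ≠ 0 := gl_mulVec_ne_zero g fun h => by simpa using congrFun h 2
    refine hw0 ?_
    have e0 : w 0 = 0 := by nlinarith [sq_nonneg (w 0), sq_nonneg (w 1)]
    have e1 : w 1 = 0 := by nlinarith [sq_nonneg (w 0), sq_nonneg (w 1)]
    ext i
    fin_cases i <;> simp [e0, e1, h2]
  have hRcont : Continuous R := by
    have : R = fun t => (g : Mat ℝ) 2 0 * Real.cos t + (g : Mat ℝ) 2 1 * Real.sin t +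
        (g : Mat ℝ) 2 2 := by
      ext t
      simp [hR, Matrix.mulVec, dotProduct, Fin.sum_univ_three]
    rw [this]
    fun_prop
  have hRR (s t : ℝ) : 0 < R s * R t := by
    by_contra hcon
    have h1 : R s * R t ≤ 0 := not_lt.1 hcon
    have : (0 : ℝ) ∈ Set.range R := by
      refine mem_range_of_exists_le_of_exists_ge hRcont ?_ ?_
      · by_contra! h2
        exact absurd (mul_pos (h2 s) (h2 t)) hcon
      · by_contra! h2
        exact absurd (mul_pos_of_neg_of_neg (h2 s) (h2 t)) hcon
    obtain ⟨t, ht⟩ := this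
    exact hRne t ht
  have hgw (i : ℤ) : (g : Mat ℝ) *ᵥ ![Real.cos (θ i), Real.sin (θ i), 1] =
      R (θ i) • ![sn φ (x i), cn φ (x i), 1] := by
    have h1 := hon i
    rw [hℓμ] at h1
    have h2 := h.eq_point_zero h1 (hcircle (θ i))
    rw [circlePoint, gl_smul_mk, IsAmplitude.point, Projectivization.mk_eq_mk_iff'] at h2
    obtain ⟨a, ha⟩ := h2
    have h3 : a = R (θ i) := by
      simp only [hR, ← ha]
      simp [h.cn_zero]
    rw [← ha, ← h3, h.dn_zero, h.cn_zero, mul_one]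
  have hxK (i j : ℤ) : |φ (x i) - φ (x j)| < 2 * Real.pi := by
    have hb (i : ℤ) : φ u₀ ≤ φ (x i) ∧ φ (x i) < φ u₀ + 2 * Real.pi := by
      have h1 : (0 : ℝ) ≤ μ i := by exact_mod_cast (hμ i).1
      have h2 : (μ i : ℝ) < n := by exact_mod_cast (hμ i).2
      constructor
      · refine h.strictMono.monotone ?_
        simp only [hx]
        have : 0 ≤ 4 * K / n * μ i := by positivity
        linarith
      · have h3 := h.add_four_K u₀ 1
        simp only [Int.cast_one, mul_one, one_mul] at h3
        rw [← h3]
        refine h.strictMono ?_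
        simp only [hx]
        have : 4 * K / n * μ i < 4 * K / n * n := mul_lt_mul_of_pos_left h2 (by positivity)
        rw [div_mul_cancel₀ _ hn0] at this
        linarith
    rw [abs_lt]
    constructor <;> linarith [(hb i).1, (hb i).2, (hb j).1, (hb j).2]
  -- All the angles lie in one half-open turn, so the sine of a half-difference has the sign of the
  -- difference of the indices.
  have hφx (i j : ℤ) : ∃ c : ℝ, 0 < c ∧
      Real.sin ((φ (x i) - φ (x j)) / 2) = c * ((μ i : ℝ) - μ j) := by
    rcases lt_trichotomy (μ i : ℝ) (μ j) with hlt | heq | hlt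
    · refine ⟨Real.sin ((φ (x i) - φ (x j)) / 2) / ((μ i : ℝ) - μ j), ?_, ?_⟩
      · refine div_pos_of_neg_of_neg ?_ (by linarith)
        have : φ (x i) < φ (x j) := h.strictMono (by
          have := mul_lt_mul_of_pos_left hlt (show 0 < 4 * K / n by positivity)
          simp only [hx]; linarith)
        have h2 := (abs_lt.1 (hxK i j)).1
        exact Real.sin_neg_of_neg_of_neg_pi_lt (by linarith) (by linarith)
      · rw [div_mul_cancel₀]
        linarith
    · refine ⟨1, one_pos, ?_⟩
      have : x i = x j := by simp only [hx, heq]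
      simp [this, heq]
    · refine ⟨Real.sin ((φ (x i) - φ (x j)) / 2) / ((μ i : ℝ) - μ j), ?_, ?_⟩
      · refine div_pos ?_ (by linarith)
        have : φ (x j) < φ (x i) := h.strictMono (by
          have := mul_lt_mul_of_pos_left hlt (show 0 < 4 * K / n by positivity)
          simp only [hx]; linarith)
        have h2 := (abs_lt.1 (hxK i j)).2
        exact Real.sin_pos_of_pos_of_lt_pi (by linarith) (by linarith)
      · rw [div_mul_cancel₀]
        linarith
  have hθn (a b : ℤ) (ha : 0 ≤ a) (hab : a < b) (hb : b < n) :
      0 < Real.sin ((θ b - θ a) / 2) := by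
    have h1 := hθ hab
    have h2 := hθ (show b < a + n by omega)
    rw [hper] at h2
    exact Real.sin_pos_of_pos_of_lt_pi (by linarith) (by linarith)
  -- The minus sign appears because (sn, cn) is (sin, cos), in the opposite order to `circlePoint`.
  have hdet (a b c : ℤ) : (g : Mat ℝ).det *
      (4 * Real.sin ((θ b - θ a) / 2) * Real.sin ((θ c - θ b) / 2) * Real.sin ((θ c - θ a) / 2)) =
      -(R (θ a) * R (θ b) * R (θ c) * (4 * Real.sin ((φ (x b) - φ (x a)) / 2) *
        Real.sin ((φ (x c) - φ (x b)) / 2) * Real.sin ((φ (x c) - φ (x a)) / 2))) := by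
    rw [← det_circle, ← det_circle, ← Matrix.det_mul]
    have h1 : (g : Mat ℝ) * !![Real.cos (θ a), Real.cos (θ b), Real.cos (θ c);
        Real.sin (θ a), Real.sin (θ b), Real.sin (θ c); 1, 1, 1] =
        !![R (θ a) * sn φ (x a), R (θ b) * sn φ (x b), R (θ c) * sn φ (x c);
          R (θ a) * cn φ (x a), R (θ b) * cn φ (x b), R (θ c) * cn φ (x c);
          R (θ a), R (θ b), R (θ c)] := by
      ext i j
      have ha := congrFun (hgw a) i
      have hb := congrFun (hgw b) i
      have hc := congrFun (hgw c) i
      fin_cases j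
      · fin_cases i <;>
          simpa [Matrix.mul_apply, Matrix.mulVec, dotProduct, Fin.sum_univ_three] using ha
      · fin_cases i <;>
          simpa [Matrix.mul_apply, Matrix.mulVec, dotProduct, Fin.sum_univ_three] using hb
      · fin_cases i <;>
          simpa [Matrix.mul_apply, Matrix.mulVec, dotProduct, Fin.sum_univ_three] using hc
    rw [h1, Matrix.det_fin_three, Matrix.det_fin_three]
    simp [sn, cn]
    ring
  have hgdet : (g : Mat ℝ).det ≠ 0 :=
    ((Matrix.isUnit_iff_isUnit_det _).1 (Units.isUnit g)).ne_zero
  have hcomb := eq_or_eq_sub_of_cyclic (n := n) (by exact_mod_cast hn) hμ0 hμ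
    (ε := -((g : Mat ℝ).det * R (θ 0))) (fun a b c ha hab hbc hc => by
      obtain ⟨c1, hc1, e1⟩ := hφx b a
      obtain ⟨c2, hc2, e2⟩ := hφx c b
      obtain ⟨c3, hc3, e3⟩ := hφx c a
      have h1 := hθn a b ha hab (by omega)
      have h2 := hθn b c (by omega) hbc hc
      have h3 := hθn a c ha (by omega) hc
      have hd := hdet a b c
      rw [e1, e2, e3] at hd
      set P := ((μ b : ℝ) - μ a) * ((μ c : ℝ) - μ b) * ((μ c : ℝ) - μ a)
      set W := 4 * Real.sin ((θ b - θ a) / 2) * Real.sin ((θ c - θ b) / 2) *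
        Real.sin ((θ c - θ a) / 2) with hW
      have hWpos : 0 < W := by positivity
      have e4 : (R (θ 0) * R (θ a)) * (R (θ b) * R (θ c)) * (4 * c1 * c2 * c3) *
          (-((g : Mat ℝ).det * R (θ 0)) * P) = R (θ 0) ^ 2 * (g : Mat ℝ).det ^ 2 * W := by
        linear_combination (-(R (θ 0) ^ 2 * (g : Mat ℝ).det)) * hd
      have e5 : 0 < (R (θ 0) * R (θ a)) * (R (θ b) * R (θ c)) * (4 * c1 * c2 * c3) :=
        mul_pos (mul_pos (hRR _ _) (hRR _ _)) (by positivity)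
      have e6 : 0 < R (θ 0) ^ 2 * (g : Mat ℝ).det ^ 2 * W := by
        have := hRne (θ 0)
        positivity
      rw [← e4] at e6
      exact pos_of_mul_pos_right e6 e5.le)
  have hmod (i : ℤ) : ((i % n : ℤ) : ZMod n) = i := by simp
  have hdiv (i : ℤ) : (i : ℝ) = n * ((i / n : ℤ) : ℝ) + ((i % n : ℤ) : ℝ) := by
    exact_mod_cast (Int.mul_ediv_add_emod i n).symm
  rcases hcomb with hc | hc
  · refine ⟨u₀, 2 * K / n, Or.inl (mul_div_cancel₀ _ hn0), fun i => ?_⟩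
    rw [← hmod i, hℓμ, hc _ (Int.emod_nonneg _ hnz) (Int.emod_lt_of_pos _ (by positivity)),
      h.tangentLine_eq_iff]
    refine ⟨-(i / n), ?_⟩
    rw [hdiv i]
    push_cast
    field_simp
    ring
  · refine ⟨u₀, -(2 * K) / n, Or.inr (mul_div_cancel₀ _ hn0), fun i => ?_⟩
    rw [← hmod i, hℓμ]
    rcases (Int.emod_nonneg i hnz).eq_or_lt with h0 | h0
    · rw [← h0, hμ0, h.tangentLine_eq_iff]
      refine ⟨i / n, ?_⟩
      rw [hdiv i, ← h0]
      push_cast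
      field_simp
      ring
    · rw [hc _ h0 (Int.emod_lt_of_pos _ (by positivity)), h.tangentLine_eq_iff]
      refine ⟨1 + i / n, ?_⟩
      rw [hdiv i]
      push_cast
      field_simp
      ring

end Sides

/-! ### The grid -/

/-- The linear map with matrix `diag (a, b)`. -/
def diagGL (a b : ℝ) (ha : a ≠ 0) (hb : b ≠ 0) : GL (Fin 3) ℝ where
  val := Matrix.diagonal ![a, b, 1]
  inv := Matrix.diagonal ![a⁻¹, b⁻¹, 1]
  val_inv := by
    rw [Matrix.diagonal_mul_diagonal, ← Matrix.diagonal_one]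
    congr 1
    ext i
    fin_cases i <;> simp [ha, hb]
  inv_val := by
    rw [Matrix.diagonal_mul_diagonal, ← Matrix.diagonal_one]
    congr 1
    ext i
    fin_cases i <;> simp [ha, hb]

theorem diagGL_inv {a b : ℝ} (ha : a ≠ 0) (hb : b ≠ 0) :
    (diagGL a b ha hb)⁻¹ = diagGL a⁻¹ b⁻¹ (inv_ne_zero ha) (inv_ne_zero hb) :=
  Units.ext rfl

theorem diagGL_mul {a b c d : ℝ} (ha : a ≠ 0) (hb : b ≠ 0) (hc : c ≠ 0) (hd : d ≠ 0) :
    diagGL a b ha hb * diagGL c d hc hd = diagGL (a * c) (b * d) (mul_ne_zero ha hc)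
      (mul_ne_zero hb hd) := by
  refine Units.ext ?_
  rw [Units.val_mul]
  change Matrix.diagonal _ * Matrix.diagonal _ = Matrix.diagonal _
  rw [Matrix.diagonal_mul_diagonal]
  congr 1
  ext i
  fin_cases i <;> simp

theorem diagGL_smul_mk {a b : ℝ} (ha : a ≠ 0) (hb : b ≠ 0) {w : Fin 3 → ℝ} (hw : w ≠ 0)
    (hw' : (![a * w 0, b * w 1, w 2] : Fin 3 → ℝ) ≠ 0) :
    diagGL a b ha hb • Projectivization.mk ℝ w hw = Projectivization.mk ℝ _ hw' := by
  rw [gl_smul_mk]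
  congr 1
  ext i
  fin_cases i <;> simp [diagGL, Matrix.mulVec_diagonal]

theorem conicImage_diagGL {a b : ℝ} (ha : a ≠ 0) (hb : b ≠ 0) (x y z : ℝ) :
    conicImage (diagGL a b ha hb) (Matrix.diagonal ![x, y, z]) =
      Matrix.diagonal ![x / a ^ 2, y / b ^ 2, z] := by
  rw [conicImage, diagGL_inv]
  change (Matrix.diagonal _)ᵀ * Matrix.diagonal _ * Matrix.diagonal _ = _
  rw [Matrix.diagonal_transpose, Matrix.diagonal_mul_diagonal, Matrix.diagonal_mul_diagonal]
  congr 1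
  ext i
  fin_cases i <;> simp <;> field_simp

theorem isLinear_diagGL {a b : ℝ} (ha : a ≠ 0) (hb : b ≠ 0) : IsLinear (diagGL a b ha hb) := by
  simp [IsLinear, diagGL]

/-- For n = 2r + 1 the inverse of 2 modulo n is r + 1. -/
theorem exists_two_mul_intCast_eq {n : ℕ} (hn : Odd n) (k : ZMod n) :
    ∃ l : ℤ, ((2 * l : ℤ) : ZMod n) = k := by
  obtain ⟨r, hr⟩ := hn
  obtain ⟨k, rfl⟩ := ZMod.intCast_surjective k
  refine ⟨k * (r + 1), ?_⟩
  have : (2 * (k * (r + 1)) : ℤ) = k + k * n := by rw [hr]; push_cast; ring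
  rw [this]
  simp

section Grid

variable {n : ℕ} {m K A B u₀ δ : ℝ} {φ : ℝ → ℝ} {v : ZMod n → Plane ℝ} {ℓ : ZMod n → Line ℝ}

namespace IsAmplitude

/-- If i ≠ j modulo n, the two tangents are distinct and meet once. If i = j modulo n, then (i - j)δ
is a multiple of 2K, so sn vanishes there and the formula gives the point of tangency. -/
theorem gridPoint_eq (h : IsAmplitude m K φ) (hn : n ≠ 0)
    (hδ : n * δ = 2 * K ∨ n * δ = -(2 * K))
    (hℓ : ∀ i : ℤ, ℓ i = tangentLine φ (u₀ + 2 * i * δ)) (i j : ℤ) :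
    gridPoint (axisConic 1 1) ℓ i j = {h.point (u₀ + (i + j) * δ) ((i - j) * δ)} := by
  have hn0 : (n : ℝ) ≠ 0 := by positivity
  have h1 := h.onLine_point_add (u₀ + (i + j) * δ) ((i - j) * δ)
  have h2 := h.onLine_point_sub (u₀ + (i + j) * δ) ((i - j) * δ)
  rw [show u₀ + (i + j) * δ + (i - j) * δ = u₀ + 2 * i * δ by ring, ← hℓ] at h1
  rw [show u₀ + (i + j) * δ - (i - j) * δ = u₀ + 2 * j * δ by ring, ← hℓ] at h2
  by_cases hij : (i : ZMod n) = j
  · have h3 : h.point (u₀ + (i + j) * δ) ((i - j) * δ) ∈ locus (axisConic 1 1) := by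
      rw [point, mk_mem_locus, quad_axisConic]
      have hs : sn φ ((i - j) * δ) = 0 := by
        obtain ⟨k, hk⟩ := (ZMod.intCast_eq_intCast_iff_dvd_sub j i n).1 hij.symm
        have hk' : (i : ℝ) - j = n * k := by exact_mod_cast hk
        have : ∃ l : ℤ, (i - j) * δ = 0 + 2 * K * l := by
          rcases hδ with hδ | hδ
          · exact ⟨k, by rw [hk']; linear_combination k * hδ⟩
          · exact ⟨-k, by rw [hk']; push_cast; linear_combination k * hδ⟩
        obtain ⟨l, hl⟩ := this
        rw [hl, sn, h.add_int, h.map_zero, zero_add, Real.sin_int_mul_pi]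
      have e1 := sn_sq_add_cn_sq φ ((i - j) * δ)
      have e2 := sn_sq_add_cn_sq φ (u₀ + (i + j) * δ)
      have e3 := h.dn_sq ((i - j) * δ)
      rw [hs] at e1 e3
      simp only [Matrix.cons_val_zero, Matrix.cons_val_one, Matrix.cons_val, mul_pow, e3]
      linear_combination e2 - e1
    ext p
    simp only [gridPoint, Set.mem_ofPred_eq, Set.mem_singleton_iff, hij, true_imp_iff]
    constructor
    · rintro ⟨hp, -, hp'⟩
      rw [hℓ] at hp h2
      exact (h.eq_point_zero hp hp').trans (h.eq_point_zero h2 h3).symm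
    · rintro rfl
      exact ⟨h2, h2, h3⟩
  · have hne : ℓ i ≠ ℓ j := by
      intro heq
      rw [hℓ, hℓ, h.tangentLine_eq_iff] at heq
      obtain ⟨k, hk⟩ := heq
      have hK := h.K_pos
      refine hij ?_
      have : ∃ l : ℤ, (i : ℝ) - j = n * l := by
        rcases hδ with hδ | hδ
        · refine ⟨k, mul_left_cancel₀ (mul_pos four_pos hK).ne' ?_⟩
          linear_combination n * hk - 2 * (i - j) * hδ
        · refine ⟨-k, mul_left_cancel₀ (mul_pos four_pos hK).ne' ?_⟩
          push_cast
          linear_combination -n * hk + 2 * (i - j) * hδ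
      obtain ⟨l, hl⟩ := this
      exact ((ZMod.intCast_eq_intCast_iff_dvd_sub j i n).2 ⟨l, by exact_mod_cast hl⟩).symm
    ext p
    simp only [gridPoint, Set.mem_ofPred_eq, Set.mem_singleton_iff, hij, false_imp_iff, and_true]
    constructor
    · rintro ⟨hp, hp'⟩
      exact eq_of_onLine_of_onLine hne hp hp' h1 h2
    · rintro rfl
      exact ⟨h1, h2⟩

theorem gridP_eq (h : IsAmplitude m K φ) (hn : n ≠ 0) (hδ : n * δ = 2 * K ∨ n * δ = -(2 * K))
    (hℓ : ∀ i : ℤ, ℓ i = tangentLine φ (u₀ + 2 * i * δ)) (k : ℤ) :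
    gridP (axisConic 1 1) ℓ k =
      Set.range fun j : ℤ => h.point (u₀ + (2 * j + k) * δ) (k * δ) := by
  ext p
  simp only [gridP, Set.mem_ofPred_eq, Set.mem_range]
  constructor
  · rintro ⟨i, j, hij, hp⟩
    obtain ⟨j, rfl⟩ := ZMod.intCast_surjective j
    obtain rfl : i = ((j + k : ℤ) : ZMod n) := by push_cast; rw [← hij]; ring
    rw [h.gridPoint_eq hn hδ hℓ] at hp
    refine ⟨j, ?_⟩
    rw [hp]
    push_cast
    congr 1 <;> ring
  · rintro ⟨j, rfl⟩
    refine ⟨((j + k : ℤ) : ZMod n), j, by push_cast; ring, ?_⟩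
    rw [h.gridPoint_eq hn hδ hℓ, Set.mem_singleton_iff]
    push_cast
    congr 1 <;> ring

theorem gridQ_eq (h : IsAmplitude m K φ) (hn : n ≠ 0) (hδ : n * δ = 2 * K ∨ n * δ = -(2 * K))
    (hℓ : ∀ i : ℤ, ℓ i = tangentLine φ (u₀ + 2 * i * δ)) (k : ℤ) :
    gridQ (axisConic 1 1) ℓ k =
      Set.range fun j : ℤ => h.point (u₀ + k * δ) ((k - 2 * j) * δ) := by
  ext p
  simp only [gridQ, Set.mem_ofPred_eq, Set.mem_range]
  constructor
  · rintro ⟨i, j, hij, hp⟩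
    obtain ⟨j, rfl⟩ := ZMod.intCast_surjective j
    obtain rfl : i = ((k - j : ℤ) : ZMod n) := by push_cast; rw [← hij]; ring
    rw [h.gridPoint_eq hn hδ hℓ] at hp
    refine ⟨j, ?_⟩
    rw [hp]
    push_cast
    congr 1 <;> ring
  · rintro ⟨j, rfl⟩
    refine ⟨((k - j : ℤ) : ZMod n), j, by push_cast; ring, ?_⟩
    rw [h.gridPoint_eq hn hδ hℓ, Set.mem_singleton_iff]
    push_cast
    congr 1 <;> ring

/-- The zeros of cn are the odd multiples of K, and kδ = ±2kK/n can be one only if 2k is an odd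
multiple of the odd number n. -/
theorem cn_int_mul_ne_zero (h : IsAmplitude m K φ) (hn : Odd n)
    (hδ : n * δ = 2 * K ∨ n * δ = -(2 * K)) (k : ℤ) : cn φ (k * δ) ≠ 0 := by
  intro h0
  obtain ⟨j, hj⟩ := h.exists_eq_of_cn_eq_zero h0
  obtain ⟨r, rfl⟩ := hn
  have hK := h.K_pos
  have : ∃ l : ℤ, 2 * (l : ℝ) = (2 * r + 1) * (1 + 2 * j) := by
    push_cast at hδ
    rcases hδ with hδ | hδ
    · refine ⟨k, mul_left_cancel₀ hK.ne' ?_⟩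
      linear_combination (2 * r + 1) * hj - k * hδ
    · refine ⟨-k, mul_left_cancel₀ hK.ne' ?_⟩
      push_cast
      linear_combination (2 * r + 1) * hj - k * hδ
  obtain ⟨l, hl⟩ := this
  have hl' : 2 * l = (2 * r + 1) * (1 + 2 * j) := by exact_mod_cast hl
  have : (2 * r + 1) * (1 + 2 * j) = 2 * (r + 2 * r * j + j) + 1 := by ring
  omega

/-- Separation of variables: y enters only through a diagonal matrix acting on the tangency point
with parameter x. -/
theorem point_eq_diagGL_smul (h : IsAmplitude m K φ) (x : ℝ) {y : ℝ} (hy : cn φ y ≠ 0) :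
    h.point x y = diagGL (dn m φ y / cn φ y) (1 / cn φ y) (div_ne_zero (h.dn_pos y).ne' hy)
      (one_div_ne_zero hy) • h.point x 0 := by
  have hne : (![dn m φ y / cn φ y * (![sn φ x * dn m φ 0, cn φ x, cn φ 0] : Fin 3 → ℝ) 0,
      1 / cn φ y * (![sn φ x * dn m φ 0, cn φ x, cn φ 0] : Fin 3 → ℝ) 1,
      (![sn φ x * dn m φ 0, cn φ x, cn φ 0] : Fin 3 → ℝ) 2] : Fin 3 → ℝ) ≠ 0 := fun h0 => by
    simpa [h.cn_zero] using congrFun h0 2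
  rw [point, point, diagGL_smul_mk _ _ _ hne]
  refine mk_eq_mk_of_smul _ _ (cn φ y) ?_
  ext i
  fin_cases i <;> simp [h.dn_zero, h.cn_zero] <;> field_simp

/-- The dual separation: x enters only through a diagonal matrix, which is invertible off the zeros
of sn and cn. -/
theorem point_eq_diagGL_smul' (h : IsAmplitude m K φ) {x : ℝ} (y : ℝ) (hs : sn φ x ≠ 0)
    (hc : cn φ x ≠ 0) :
    h.point x y = diagGL (sn φ x) (cn φ x) hs hc •
      Projectivization.mk ℝ ![dn m φ y, 1, cn φ y] (fun h => by simpa using congrFun h 1) := by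
  rw [diagGL_smul_mk _ _ _ (fun h0 => hc (by simpa using congrFun h0 1)), point]
  congr 1
  ext i
  fin_cases i <;> simp

/-- Writing k = 2l modulo n, the first coordinates u₀ + 2(j + l)δ become, after reindexing, those of
the tangency points. Every P_k is thus a diagonal image of P_0. -/
theorem exists_diagGL_smul_gridP (h : IsAmplitude m K φ) (hn : Odd n)
    (hδ : n * δ = 2 * K ∨ n * δ = -(2 * K))
    (hℓ : ∀ i : ℤ, ℓ i = tangentLine φ (u₀ + 2 * i * δ)) (j k : ZMod n) :
    ∃ a b ha hb, diagGL a b ha hb • gridP (axisConic 1 1) ℓ j = gridP (axisConic 1 1) ℓ k := by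
  have key (k : ZMod n) : ∃ a b ha hb, gridP (axisConic 1 1) ℓ k = diagGL a b ha hb •
      Set.range fun j : ℤ => h.point (u₀ + 2 * j * δ) 0 := by
    obtain ⟨l, rfl⟩ := exists_two_mul_intCast_eq hn k
    have hc := h.cn_int_mul_ne_zero hn hδ (2 * l)
    refine ⟨_, _, div_ne_zero (h.dn_pos (((2 * l : ℤ) : ℝ) * δ)).ne' hc, one_div_ne_zero hc, ?_⟩
    rw [h.gridP_eq hn.pos.ne' hδ hℓ, ← Set.image_smul, ← Set.range_comp]
    simp only [Function.comp_def, h.point_eq_diagGL_smul _ hc]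
    ext p
    constructor
    · rintro ⟨i, rfl⟩
      exact ⟨i + l, by push_cast; congr 2; ring⟩
    · rintro ⟨i, rfl⟩
      exact ⟨i - l, by push_cast; congr 2; ring⟩
  obtain ⟨a, b, ha, hb, hj⟩ := key j
  obtain ⟨c, d, hc, hd, hk⟩ := key k
  refine ⟨c * a⁻¹, d * b⁻¹, mul_ne_zero hc (inv_ne_zero ha), mul_ne_zero hd (inv_ne_zero hb), ?_⟩
  rw [← diagGL_mul hc hd (inv_ne_zero ha) (inv_ne_zero hb), ← diagGL_inv ha hb, hj, hk, mul_smul,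
    inv_smul_smul]

/-- Writing k = 2l, the second coordinates 2(l - j)δ run through all even multiples of δ,
independently of l. -/
theorem exists_diagGL_smul_gridQ (h : IsAmplitude m K φ) (hn : Odd n)
    (hδ : n * δ = 2 * K ∨ n * δ = -(2 * K))
    (hℓ : ∀ i : ℤ, ℓ i = tangentLine φ (u₀ + 2 * i * δ))
    (hsc : ∀ k : ℤ, sn φ (u₀ + k * δ) ≠ 0 ∧ cn φ (u₀ + k * δ) ≠ 0) (j k : ZMod n) :
    ∃ a b ha hb, diagGL a b ha hb • gridQ (axisConic 1 1) ℓ j = gridQ (axisConic 1 1) ℓ k := by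
  have key (k : ZMod n) : ∃ a b ha hb, gridQ (axisConic 1 1) ℓ k = diagGL a b ha hb •
      Set.range fun j : ℤ => Projectivization.mk ℝ ![dn m φ (2 * j * δ), 1, cn φ (2 * j * δ)]
        (fun h => by simpa using congrFun h 1) := by
    obtain ⟨l, rfl⟩ := exists_two_mul_intCast_eq hn k
    obtain ⟨hs, hc⟩ := hsc (2 * l)
    refine ⟨_, _, hs, hc, ?_⟩
    rw [h.gridQ_eq hn.pos.ne' hδ hℓ, ← Set.image_smul, ← Set.range_comp]
    simp only [Function.comp_def, h.point_eq_diagGL_smul' _ hs hc]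
    ext p
    constructor
    · rintro ⟨i, rfl⟩
      refine ⟨l - i, ?_⟩
      simp only
      congr 2
      push_cast
      rw [show 2 * ((l : ℝ) - i) * δ = (2 * l - 2 * i) * δ by ring]
    · rintro ⟨i, rfl⟩
      refine ⟨l - i, ?_⟩
      simp only
      congr 2
      push_cast
      rw [show (2 * (l : ℝ) - 2 * (l - i)) * δ = 2 * i * δ by ring]
  obtain ⟨a, b, ha, hb, hj⟩ := key j
  obtain ⟨c, d, hc, hd, hk⟩ := key k
  refine ⟨c * a⁻¹, d * b⁻¹, mul_ne_zero hc (inv_ne_zero ha), mul_ne_zero hd (inv_ne_zero hb), ?_⟩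
  rw [← diagGL_mul hc hd (inv_ne_zero ha) (inv_ne_zero hb), ← diagGL_inv ha hb, hj, hk, mul_smul,
    inv_smul_smul]

end IsAmplitude

end Grid

/-! ### Symmetries -/

section Symmetry

variable {n : ℕ} {m K A B u₀ δ : ℝ} {φ : ℝ → ℝ} {v : ZMod n → Plane ℝ} {ℓ : ZMod n → Line ℝ}

/-- The rotation with the cosine `c` and the sine `s`. -/
def rotationGL (c s : ℝ) (h : c ^ 2 + s ^ 2 = 1) : GL (Fin 3) ℝ where
  val := !![c, s, 0; -s, c, 0; 0, 0, 1]
  inv := !![c, -s, 0; s, c, 0; 0, 0, 1]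
  val_inv := by
    ext i j
    fin_cases i <;> fin_cases j <;> simp [Matrix.mul_apply, Fin.sum_univ_three] <;>
      first | ring1 | linear_combination h
  inv_val := by
    ext i j
    fin_cases i <;> fin_cases j <;> simp [Matrix.mul_apply, Fin.sum_univ_three] <;>
      first | ring1 | linear_combination h

theorem dual_rotationGL (c s : ℝ) (h : c ^ 2 + s ^ 2 = 1) :
    dual (rotationGL c s h) = rotationGL c s h := by
  refine Units.ext ?_
  rw [dual_val]
  change (!![c, -s, 0; s, c, 0; 0, 0, 1] : Mat ℝ)ᵀ = !![c, s, 0; -s, c, 0; 0, 0, 1]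
  ext i j
  fin_cases i <;> fin_cases j <;> simp

theorem conicImage_rotationGL (c s : ℝ) (h : c ^ 2 + s ^ 2 = 1) (a : ℝ) :
    conicImage (rotationGL c s h) (axisConic a a) = axisConic a a := by
  rw [conicImage]
  change (!![c, -s, 0; s, c, 0; 0, 0, 1] : Mat ℝ)ᵀ * axisConic a a *
    !![c, -s, 0; s, c, 0; 0, 0, 1] = axisConic a a
  ext i j
  fin_cases i <;> fin_cases j <;>
    simp [Matrix.mul_apply, Fin.sum_univ_three, axisConic, Matrix.diagonal] <;>
    first | ring1 | linear_combination a⁻¹ * h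

theorem dual_diagGL {a b : ℝ} (ha : a ≠ 0) (hb : b ≠ 0) :
    dual (diagGL a b ha hb) = diagGL a⁻¹ b⁻¹ (inv_ne_zero ha) (inv_ne_zero hb) := by
  refine Units.ext ?_
  rw [dual_val, diagGL_inv]
  exact Matrix.diagonal_transpose _

/-- Each excluded case yields a nontrivial symmetry: if m = 0, a rotation that shifts the sides; if
sn or cn vanishes at u₀ + kδ, the reflection t ↦ -t or t ↦ 2K - t, which exchanges the sides i and k
- i. -/
theorem IsAmplitude.ne_zero_of_hasNoSymmetry (h : IsAmplitude m K φ) (hA : 1 < A)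
    (hAB : A - 1 = (1 - m) * (B - 1)) (hn : 3 ≤ n)
    (hv : IsPonceletPolygon (axisConic 1 1) (axisConic A B) v)
    (hside : Set.range ℓ = {u | IsSide v u})
    (hδ : n * δ = 2 * K ∨ n * δ = -(2 * K))
    (hℓ : ∀ i : ℤ, ℓ i = tangentLine φ (u₀ + 2 * i * δ))
    (hsym : HasNoSymmetry (axisConic 1 1) (axisConic A B) v) :
    m ≠ 0 ∧ ∀ k : ℤ, sn φ (u₀ + k * δ) ≠ 0 ∧ cn φ (u₀ + k * δ) ≠ 0 := by
  have hK := h.K_pos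
  have hB : 1 < B := by
    have h1 : 0 < (1 - m) * (B - 1) := by linarith
    have := pos_of_mul_pos_right h1 (sub_pos.2 h.m_lt_one).le
    linarith
  have hdet : (axisConic A B).det ≠ 0 := by
    rw [det_axisConic]
    have : 0 < A := by linarith
    have : 0 < B := by linarith
    exact neg_ne_zero.2 (by positivity)
  have hsides (u : Line ℝ) : IsSide v u ↔ ∃ i : ℤ, u = tangentLine φ (u₀ + 2 * i * δ) := by
    change u ∈ {u | IsSide v u} ↔ _
    rw [← hside]
    constructor
    · rintro ⟨i, rfl⟩
      obtain ⟨i, rfl⟩ := ZMod.intCast_surjective i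
      exact ⟨i, hℓ i⟩
    · rintro ⟨i, rfl⟩
      exact ⟨i, hℓ i⟩
  have main (g : GL (Fin 3) ℝ) (h1 : conicImage g (axisConic 1 1) = axisConic 1 1)
      (h2 : conicImage g (axisConic A B) = axisConic A B)
      (h3 : ∀ i : ℤ, ∃ j : ℤ, dual g • tangentLine φ (u₀ + 2 * i * δ) =
        tangentLine φ (u₀ + 2 * j * δ)) (p : Plane ℝ) : g • p = p := by
    refine hsym.smul_eq hv (by omega) (isSymm_axisConic A B) hdet (by rw [smul_locus, h1])
      (by rw [smul_locus, h2]) (fun u hu => ?_) p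
    obtain ⟨i, rfl⟩ := (hsides u).1 hu
    exact (hsides _).2 (h3 i)
  refine ⟨?_, fun k => ⟨?_, ?_⟩⟩
  · rintro rfl
    obtain rfl : A = B := by linarith
    have hd (t : ℝ) : dn 0 φ t = 1 := by simp [dn]
    have e := sn_sq_add_cn_sq φ (2 * δ)
    -- For m = 0 the addition formulas are those of the circle, and adding 2δ to the parameter is a
    -- rotation. It would be trivial only if 2δ were a multiple of 4K, that is, if n divided 1.
    have hrot := main (rotationGL (cn φ (2 * δ)) (sn φ (2 * δ)) (by linarith))
      (conicImage_rotationGL _ _ _ _) (conicImage_rotationGL _ _ _ _) (fun i => ⟨i + 1, by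
        have hs := h.sn_add (u₀ + 2 * i * δ) (2 * δ)
        have hc := h.cn_add (u₀ + 2 * i * δ) (2 * δ)
        simp only [hd, zero_mul, sub_zero, mul_one] at hs hc
        rw [dual_rotationGL, tangentLine, tangentLine, gl_smul_mk]
        congr 1
        rw [show u₀ + 2 * ((i + 1 : ℤ) : ℝ) * δ = u₀ + 2 * i * δ + 2 * δ by push_cast; ring, hs, hc]
        ext j
        fin_cases j <;>
          simp [rotationGL, Matrix.mulVec, dotProduct, Fin.sum_univ_three] <;> ring⟩)
      (Projectivization.mk ℝ ![0, 1, 1] (fun h => by simpa using congrFun h 2))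
    rw [gl_smul_mk, Projectivization.mk_eq_mk_iff'] at hrot
    obtain ⟨a, ha⟩ := hrot
    have e0 : sn φ (2 * δ) = 0 := by
      simpa [rotationGL, Matrix.mulVec, dotProduct, Fin.sum_univ_three] using (congrFun ha 0).symm
    have e2 : a = 1 := by
      simpa [rotationGL, Matrix.mulVec, dotProduct, Fin.sum_univ_three] using congrFun ha 2
    have e1 : cn φ (2 * δ) = 1 := by
      simpa [rotationGL, Matrix.mulVec, dotProduct, Fin.sum_univ_three, e2] using
        (congrFun ha 1).symm
    obtain ⟨j, hj⟩ := h.exists_eq_of_sn_eq_cn_eq (x := 2 * δ) (y := 0)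
      (by rw [e0, h.sn_zero]) (by rw [e1, h.cn_zero])
    have hj1 : (n : ℤ) * j = 1 ∨ (n : ℤ) * j = -1 := by
      rcases hδ with hδ | hδ
      · left
        have : (n : ℝ) * j = 1 := mul_left_cancel₀ (mul_pos four_pos hK).ne' (by
          linear_combination 2 * hδ - n * hj)
        exact_mod_cast this
      · right
        have : (n : ℝ) * j = -1 := mul_left_cancel₀ (mul_pos four_pos hK).ne' (by
          linear_combination 2 * hδ - n * hj)
        exact_mod_cast this
    have : (n : ℤ) ∣ 1 := by
      rcases hj1 with h1 | h1
      · exact ⟨j, h1.symm⟩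
      · exact ⟨-j, by rw [mul_neg, h1]; rfl⟩
    have := Int.le_of_dvd one_pos this
    omega
  · intro hs
    obtain ⟨j, hj⟩ := h.exists_eq_of_sn_eq_zero hs
    have hrefl := main (diagGL (-1) 1 (by norm_num) one_ne_zero)
      (by rw [axisConic, conicImage_diagGL]; norm_num) (by rw [axisConic, conicImage_diagGL]; norm_num)
      (fun i => ⟨k - i, by
        have e : tangentLine φ (u₀ + 2 * ((k - i : ℤ) : ℝ) * δ) =
            tangentLine φ (-(u₀ + 2 * i * δ)) := by
          rw [h.tangentLine_eq_iff]
          exact ⟨j, by push_cast; linear_combination 2 * hj⟩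
        rw [e, dual_diagGL, tangentLine, diagGL_smul_mk _ _ _ (fun h => by simpa using congrFun h 2)]
        simp only [tangentLine, h.sn_neg, h.cn_neg]
        congr 1
        ext j
        fin_cases j <;> simp [inv_neg]⟩)
      (Projectivization.mk ℝ ![1, 0, 1] (fun h => by simpa using congrFun h 2))
    rw [diagGL_smul_mk _ _ _ (fun h => by simpa using congrFun h 2),
      Projectivization.mk_eq_mk_iff'] at hrefl
    obtain ⟨a, ha⟩ := hrefl
    have e0 : a = -1 := by simpa using congrFun ha 0
    have e2 : a = 1 := by simpa using congrFun ha 2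
    linarith
  · intro hs
    obtain ⟨j, hj⟩ := h.exists_eq_of_cn_eq_zero hs
    have hrefl := main (diagGL 1 (-1) one_ne_zero (by norm_num))
      (by rw [axisConic, conicImage_diagGL]; norm_num) (by rw [axisConic, conicImage_diagGL]; norm_num)
      (fun i => ⟨k - i, by
        have e : tangentLine φ (u₀ + 2 * ((k - i : ℤ) : ℝ) * δ) =
            tangentLine φ (2 * K - (u₀ + 2 * i * δ)) := by
          rw [h.tangentLine_eq_iff]
          exact ⟨j, by push_cast; linear_combination 2 * hj⟩
        rw [e, dual_diagGL, tangentLine, tangentLine,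
          diagGL_smul_mk _ _ _ (fun h => by simpa using congrFun h 2)]
        congr 1
        ext j
        fin_cases j <;> simp [h.sn_two_K_sub, h.cn_two_K_sub, inv_neg]⟩)
      (Projectivization.mk ℝ ![0, 1, 1] (fun h => by simpa using congrFun h 2))
    rw [diagGL_smul_mk _ _ _ (fun h => by simpa using congrFun h 2),
      Projectivization.mk_eq_mk_iff'] at hrefl
    obtain ⟨a, ha⟩ := hrefl
    have e0 : a = -1 := by simpa using congrFun ha 1
    have e2 : a = 1 := by simpa using congrFun ha 2
    linarith

/-- Equal squares leave two cases: equal parameters modulo 2K, or opposite ones. In the second, u₀ +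
(k + l)δ is a multiple of K, where sn or cn vanishes. -/
theorem IsAmplitude.sn_sq_injective (h : IsAmplitude m K φ)
    (hδ : n * δ = 2 * K ∨ n * δ = -(2 * K))
    (hsc : ∀ k : ℤ, sn φ (u₀ + k * δ) ≠ 0 ∧ cn φ (u₀ + k * δ) ≠ 0) {k l : ℤ}
    (hkl : sn φ (u₀ + 2 * k * δ) ^ 2 = sn φ (u₀ + 2 * l * δ) ^ 2) :
    ((2 * k : ℤ) : ZMod n) = ((2 * l : ℤ) : ZMod n) := by
  have hK := h.K_pos
  obtain ⟨i, hi | hi⟩ := h.exists_eq_of_sn_sq_eq hkl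
  · have : ∃ j : ℤ, ((2 * k - 2 * l : ℤ) : ℝ) = n * j := by
      push_cast
      rcases hδ with hδ | hδ
      · exact ⟨i, mul_left_cancel₀ (mul_pos two_pos hK).ne' (by
          linear_combination n * hi - 2 * (k - l) * hδ)⟩
      · exact ⟨-i, mul_left_cancel₀ (mul_pos two_pos hK).ne' (by
          push_cast
          linear_combination -n * hi + 2 * (k - l) * hδ)⟩
    obtain ⟨j, hj⟩ := this
    exact ((ZMod.intCast_eq_intCast_iff_dvd_sub _ _ n).2 ⟨j, by exact_mod_cast hj⟩).symm
  · exfalso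
    obtain ⟨hs, hc⟩ := hsc (k + l)
    have e : u₀ + ((k + l : ℤ) : ℝ) * δ = K * i := by push_cast; linear_combination hi / 2
    rw [e] at hs hc
    rcases Int.even_or_odd' i with ⟨r, rfl | rfl⟩
    · refine hs ?_
      rw [show K * ((2 * r : ℤ) : ℝ) = 0 + 2 * K * r by push_cast; ring, sn, h.add_int, h.map_zero,
        zero_add, Real.sin_int_mul_pi]
    · refine hc ?_
      rw [show K * ((2 * r + 1 : ℤ) : ℝ) = K + 2 * K * r by push_cast; ring, cn, h.add_int, h.map_K,
        Real.cos_eq_zero_iff]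
      exact ⟨r, by ring⟩

end Symmetry

/-! ### Common tangents -/

section Tangents

variable {t : GL (Fin 3) ℝ}

/-- The action of the projective transformation `t⁻¹` on the complex lines. -/
def complexDual (t : GL (Fin 3) ℝ) : GL (Fin 3) ℂ :=
  dual (Matrix.GeneralLinearGroup.map Complex.ofRealHom t)⁻¹

theorem complexDual_val (t : GL (Fin 3) ℝ) :
    (complexDual t : Mat ℂ) = ((t : Mat ℝ).map Complex.ofReal)ᵀ := by
  rw [complexDual, dual_val, inv_inv]
  rfl

theorem complexify_conicImage_inv (t : GL (Fin 3) ℝ) (x y z : ℝ) :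
    complexify (conicImage t⁻¹ (Matrix.diagonal ![x, y, z])) =
      (complexDual t : Mat ℂ) * Matrix.diagonal ![(x : ℂ), (y : ℂ), (z : ℂ)] *
        (complexDual t : Mat ℂ)ᵀ := by
  have hd : (Matrix.diagonal ![x, y, z]).map Complex.ofRealHom =
      Matrix.diagonal ![(x : ℂ), (y : ℂ), (z : ℂ)] := by
    ext i j
    fin_cases i <;> fin_cases j <;> simp
  rw [complexDual_val, complexify, conicImage_inv, Matrix.transpose_transpose]
  change (_ * _ * _ : Mat ℝ).map Complex.ofRealHom = _
  rw [Matrix.map_mul, Matrix.map_mul, hd]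
  rfl

/-- Tangency is membership in the dual conic, and the adjugate of G D Gᵀ, pulled back by G, is
det(G)² times the adjugate of D. -/
theorem isTangent_complexDual_smul_iff {x y z : ℝ} (hx : x ≠ 0) (hy : y ≠ 0) (hz : z ≠ 0)
    {w : Fin 3 → ℂ} (hw : w ≠ 0) :
    IsTangent (complexify (conicImage t⁻¹ (Matrix.diagonal ![x, y, z])))
      (complexDual t • Projectivization.mk ℂ w hw) ↔
    (y * z * w 0 ^ 2 + x * z * w 1 ^ 2 + x * y * w 2 ^ 2 : ℂ) = 0 := by
  have hdet : (complexDual t : Mat ℂ).det ≠ 0 :=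
    ((Matrix.isUnit_iff_isUnit_det _).1 (Units.isUnit (complexDual t))).ne_zero
  rw [gl_smul_mk, complexify_conicImage_inv]
  generalize_proofs hne
  generalize (complexDual t : Mat ℂ) = G at hdet hne ⊢
  have hsymm : (G * Matrix.diagonal ![(x : ℂ), (y : ℂ), (z : ℂ)] * Gᵀ).IsSymm := by
    rw [Matrix.IsSymm, Matrix.transpose_mul, Matrix.transpose_mul, Matrix.transpose_transpose,
      Matrix.diagonal_transpose, Matrix.mul_assoc]
  rw [isTangent_mk_iff hsymm, quad_mulVec,
    Matrix.adjugate_mul_distrib, Matrix.adjugate_mul_distrib, ← Matrix.adjugate_transpose]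
  · have : Gᵀ * (G.adjugateᵀ * ((Matrix.diagonal ![(x : ℂ), (y : ℂ), (z : ℂ)]).adjugate * G.adjugate))
        * G = (G.det ^ 2) • (Matrix.diagonal ![(x : ℂ), (y : ℂ), (z : ℂ)]).adjugate := by
      rw [← Matrix.mul_assoc, ← Matrix.transpose_mul, Matrix.adjugate_mul, Matrix.mul_assoc,
        Matrix.mul_assoc, Matrix.adjugate_mul]
      simp [smul_smul, pow_two]
    rw [this]
    simp only [quad, Matrix.smul_mulVec, dotProduct_smul, smul_eq_mul, mul_eq_zero,
      pow_eq_zero_iff two_ne_zero, hdet, false_or]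
    change quad _ w = 0 ↔ _
    rw [quad_adjugate_diagonal]
  · rw [Matrix.det_mul, Matrix.det_mul, Matrix.det_transpose, Matrix.det_diagonal]
    simp [Fin.prod_univ_three, hdet, hx, hy, hz]

theorem conicImage_inv_conicImage (t : GL (Fin 3) ℝ) (M : Mat ℝ) :
    conicImage t⁻¹ (conicImage t M) = M := by
  rw [← conicImage_mul, inv_mul_cancel, conicImage_one]

theorem conicImage_conicImage_inv (t : GL (Fin 3) ℝ) (M : Mat ℝ) :
    conicImage t (conicImage t⁻¹ M) = M := by
  rw [← conicImage_mul, mul_inv_cancel, conicImage_one]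

theorem smul_axisConic (s a b : ℝ) :
    s • axisConic a b = Matrix.diagonal ![s / a, s / b, -s] := by
  ext i j
  fin_cases i <;> fin_cases j <;> simp [axisConic, div_eq_mul_inv]

variable {γ Γ : Mat ℝ} {s s' A B m : ℝ}

/-- The two dual conics are w₂² = w₀² + w₁² and w₂² = A w₀² + B w₁², a linear system in the squares.
-/
theorem complexDual_smul_mem_commonTangents_iff (hs : s ≠ 0) (hs' : s' ≠ 0) (hA : 1 < A)
    (hB : 1 < B) (hAB : A - 1 = (1 - m) * (B - 1)) (hγ : conicImage t γ = s • axisConic 1 1)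
    (hΓ : conicImage t Γ = s' • axisConic A B) {w : Fin 3 → ℂ} (hw : w ≠ 0) :
    complexDual t • Projectivization.mk ℂ w hw ∈ commonTangents γ Γ ↔
      w 1 ^ 2 = -((1 - m : ℝ) : ℂ) * w 0 ^ 2 ∧ w 2 ^ 2 = (m : ℂ) * w 0 ^ 2 := by
  have hA0 : A ≠ 0 := by linarith
  have hB0 : B ≠ 0 := by linarith
  have hB1 : ((B : ℂ) - 1) ≠ 0 := by
    have : ((B - 1 : ℝ) : ℂ) ≠ 0 := by exact_mod_cast (by linarith : B - 1 ≠ 0)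
    simpa using this
  have hsC : (s : ℂ) ≠ 0 := by exact_mod_cast hs
  have hsC' : (s' : ℂ) ≠ 0 := by exact_mod_cast hs'
  have hAC : (A : ℂ) ≠ 0 := by exact_mod_cast hA0
  have hBC : (B : ℂ) ≠ 0 := by exact_mod_cast hB0
  have hABC : (A : ℂ) - 1 = (1 - m) * (B - 1) := by exact_mod_cast hAB
  rw [← conicImage_inv_conicImage t γ, ← conicImage_inv_conicImage t Γ, hγ, hΓ, smul_axisConic,
    smul_axisConic]
  change _ ∧ _ ↔ _
  rw [isTangent_complexDual_smul_iff (by simpa using hs) (by simpa using hs) (by simpa using hs),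
    isTangent_complexDual_smul_iff (div_ne_zero hs' hA0) (div_ne_zero hs' hB0) (by simpa using hs')]
  push_cast
  have e1 : ((s : ℂ) / 1 * -s * w 0 ^ 2 + s / 1 * -s * w 1 ^ 2 + s / 1 * (s / 1) * w 2 ^ 2 = 0) ↔
      w 2 ^ 2 = w 0 ^ 2 + w 1 ^ 2 := by
    constructor
    · intro h
      refine mul_left_cancel₀ (pow_ne_zero 2 hsC) ?_
      linear_combination h
    · intro h
      linear_combination (s : ℂ) ^ 2 * h
  have e2 : ((s' : ℂ) / B * -s' * w 0 ^ 2 + s' / A * -s' * w 1 ^ 2 + s' / A * (s' / B) * w 2 ^ 2 = 0)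
      ↔ w 2 ^ 2 = A * w 0 ^ 2 + B * w 1 ^ 2 := by
    constructor
    · intro h
      field_simp at h
      rw [mul_zero] at h
      linear_combination (mul_eq_zero.1 h).resolve_left (pow_ne_zero 2 hsC')
    · intro h
      field_simp
      linear_combination (s' : ℂ) ^ 2 * h
  rw [e1, e2]
  constructor
  · rintro ⟨h1, h2⟩
    have h3 : w 1 ^ 2 = -(1 - m : ℂ) * w 0 ^ 2 := by
      refine mul_left_cancel₀ hB1 ?_
      linear_combination h1 - h2 - w 0 ^ 2 * hABC
    exact ⟨h3, by linear_combination h1 + h3⟩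
  · rintro ⟨h1, h2⟩
    constructor
    · linear_combination h2 - h1
    · linear_combination h2 - B * h1 - w 0 ^ 2 * hABC

/-- A criterion for a conic to be tangent to the common tangents. -/
theorem isTangent_of_mem_commonTangents (hs : s ≠ 0) (hs' : s' ≠ 0) (hA : 1 < A)
    (hB : 1 < B) (hAB : A - 1 = (1 - m) * (B - 1)) (hγ : conicImage t γ = s • axisConic 1 1)
    (hΓ : conicImage t Γ = s' • axisConic A B) {x y z : ℝ} (hx : x ≠ 0) (hy : y ≠ 0) (hz : z ≠ 0)
    (hxyz : y * z - (1 - m) * (x * z) + m * (x * y) = 0) {u : Line ℂ}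
    (hu : u ∈ commonTangents γ Γ) :
    IsTangent (complexify (conicImage t⁻¹ (Matrix.diagonal ![x, y, z]))) u := by
  obtain ⟨u, rfl⟩ := MulAction.surjective (complexDual t) u
  induction u using Projectivization.ind with | h w hw =>
  rw [isTangent_complexDual_smul_iff hx hy hz]
  rw [complexDual_smul_mem_commonTangents_iff hs hs' hA hB hAB hγ hΓ] at hu
  have hC : (y * z - (1 - m) * (x * z) + m * (x * y) : ℂ) = 0 := by exact_mod_cast hxyz
  obtain ⟨h1, h2⟩ := hu
  push_cast at h1
  linear_combination (x * z : ℂ) * h1 + (x * y : ℂ) * h2 + w 0 ^ 2 * hC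

/-- The solutions are [1 : ±p : ±q] with p² = -(1 - m) and q² = m; the signs give four different
lines because p and q are nonzero. -/
theorem ncard_commonTangents (hs : s ≠ 0) (hs' : s' ≠ 0) (hA : 1 < A) (hB : 1 < B)
    (hAB : A - 1 = (1 - m) * (B - 1)) (hγ : conicImage t γ = s • axisConic 1 1)
    (hΓ : conicImage t Γ = s' • axisConic A B) (hm : 0 < m) (hm1 : m < 1) :
    (commonTangents γ Γ).ncard = 4 := by
  obtain ⟨p, hp0, hp⟩ : ∃ p : ℂ, p ≠ 0 ∧ p ^ 2 = -((1 - m : ℝ) : ℂ) := by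
    obtain ⟨p, hp⟩ := IsAlgClosed.exists_pow_nat_eq (-((1 - m : ℝ) : ℂ)) two_pos
    refine ⟨p, ?_, hp⟩
    rintro rfl
    have : (1 - m : ℝ) = 0 := by
      have : ((1 - m : ℝ) : ℂ) = 0 := by linear_combination hp
      exact_mod_cast this
    linarith
  obtain ⟨q, hq0, hq⟩ : ∃ q : ℂ, q ≠ 0 ∧ q ^ 2 = (m : ℂ) := by
    obtain ⟨q, hq⟩ := IsAlgClosed.exists_pow_nat_eq (m : ℂ) two_pos
    refine ⟨q, ?_, hq⟩
    rintro rfl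
    have : (m : ℂ) = 0 := by linear_combination -hq
    exact hm.ne' (by exact_mod_cast this)
  set σ : Bool → ℂ := fun e => if e then 1 else -1 with hσ
  have hσi : Function.Injective σ := by
    intro e e' h
    cases e <;> cases e' <;> simp [hσ] at h ⊢
    · exact absurd h (by norm_num)
    · exact absurd h (by norm_num)
  have hσ2 (e : Bool) : σ e ^ 2 = 1 := by cases e <;> simp [hσ]
  have hroot {x y : ℂ} (hxy : x ^ 2 = y ^ 2) : ∃ e, x = σ e * y := by
    rcases sq_eq_sq_iff_eq_or_eq_neg.1 hxy with h | h
    · exact ⟨true, by simp [hσ, h]⟩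
    · exact ⟨false, by simp [hσ, h]⟩
  have hne (e : Bool × Bool) : (![1, σ e.1 * p, σ e.2 * q] : Fin 3 → ℂ) ≠ 0 := fun h => by
    simpa using congrFun h 0
  set f : Bool × Bool → Line ℂ := fun e => complexDual t • Projectivization.mk ℂ _ (hne e) with hf
  have hfinj : Function.Injective f := by
    intro e e' h
    have h1 := MulAction.injective (complexDual t) h
    obtain ⟨a, ha⟩ := (Projectivization.mk_eq_mk_iff' ℂ _ _ _ _).1 h1
    have h0 : a = 1 := by simpa using congrFun ha 0
    subst h0
    have h1 := congrFun ha 1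
    have h2 := congrFun ha 2
    simp [hp0] at h1
    simp [hq0] at h2
    exact Prod.ext (hσi h1.symm) (hσi h2.symm)
  have hrange : commonTangents γ Γ = Set.range f := by
    ext u
    obtain ⟨u, rfl⟩ := MulAction.surjective (complexDual t) u
    induction u using Projectivization.ind with | h w hw =>
    constructor
    · intro h
      rw [complexDual_smul_mem_commonTangents_iff hs hs' hA hB hAB hγ hΓ, ← hp, ← hq] at h
      obtain ⟨e, he⟩ := hroot (h.1.trans (mul_pow p (w 0) 2).symm)
      obtain ⟨e', he'⟩ := hroot (h.2.trans (mul_pow q (w 0) 2).symm)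
      refine ⟨(e, e'), ?_⟩
      simp only [hf]
      congr 1
      refine (mk_eq_mk_of_smul _ _ (w 0) ?_).symm
      ext i
      fin_cases i
      · simp
      · simp [he]; ring
      · simp [he']; ring
    · rintro ⟨e, he⟩
      rw [← he, hf]
      simp only
      rw [complexDual_smul_mem_commonTangents_iff hs hs' hA hB hAB hγ hΓ]
      simp [mul_pow, hσ2, hp, hq]
  rw [hrange, Set.ncard_range_of_injective hfinj]
  simp

end Tangents

/-! ### The confocal conics -/

section Conics

theorem isEllipse_axisConic {a b : ℝ} (ha : 0 < a) (hb : 0 < b) : IsEllipse (axisConic a b) := by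
  refine ⟨isSymm_axisConic a b, ?_, ?_⟩
  · simp [axisConic, ha, hb]
  · rw [det_axisConic]
    have : 0 < (1 / a + 1 / b) * (1 / a * (1 / b)) := by positivity
    simp [axisConic] at this ⊢
    linarith

theorem nested_axisConic {a b a' b' : ℝ} (ha : 0 < a) (hb : 0 < b) (haa' : a < a')
    (hbb' : b < b') : Nested (axisConic a b) (axisConic a' b') := by
  intro p hp
  have ha' := ha.trans haa'
  have hb' := hb.trans hbb'
  have hsum : 0 < (axisConic a b) 0 0 + (axisConic a b) 1 1 := by
    simp [axisConic]; positivity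
  have hsum' : 0 < (axisConic a' b') 0 0 + (axisConic a' b') 1 1 := by
    simp [axisConic]; positivity
  have h1 : quad (axisConic a b) p.rep ≤ 0 := by
    rcases hp with hp | hp
    · exact le_of_eq hp
    · exact (neg_of_mul_neg_right hp hsum.le).le
  refine mul_neg_of_pos_of_neg hsum' ?_
  have hp0 := p.rep_nonzero
  set w := p.rep
  rw [quad_axisConic] at h1 ⊢
  have h2 : w 0 ^ 2 / a' ≤ w 0 ^ 2 / a := div_le_div_of_nonneg_left (sq_nonneg _) ha haa'.le
  have h3 : w 1 ^ 2 / b' ≤ w 1 ^ 2 / b := div_le_div_of_nonneg_left (sq_nonneg _) hb hbb'.le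
  by_cases h0 : w 0 = 0
  · by_cases h4 : w 1 = 0
    · have h5 : w 2 ≠ 0 := fun h5 => hp0 (by ext i; fin_cases i <;> simp [h0, h4, h5])
      have : 0 < w 2 ^ 2 := by positivity
      simp [h0, h4]
      linarith
    · have : w 1 ^ 2 / b' < w 1 ^ 2 / b := div_lt_div_of_pos_left (by positivity) hb hbb'
      linarith
  · have : w 0 ^ 2 / a' < w 0 ^ 2 / a := div_lt_div_of_pos_left (by positivity) ha haa'
    linarith

theorem isHyperbola_diagonal {x y z : ℝ} (hxy : x * y < 0) (hz : z ≠ 0) :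
    IsHyperbola (Matrix.diagonal ![x, y, z]) := by
  refine ⟨Matrix.isSymm_diagonal _, by simpa using hxy, ?_⟩
  rw [Matrix.det_diagonal]
  simpa [Fin.prod_univ_three, hz] using mul_ne_zero_iff.1 hxy.ne

/-- The minor is the dual conic evaluated at the line at infinity; p, q, r are, up to sign, the
coordinates of the image of that line under t. -/
theorem conicImage_inv_minor (t : GL (Fin 3) ℝ) : ∃ p q r : ℝ, ∀ x y z : ℝ,
    conicImage t⁻¹ (Matrix.diagonal ![x, y, z]) 0 0 *
      conicImage t⁻¹ (Matrix.diagonal ![x, y, z]) 1 1 -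
      conicImage t⁻¹ (Matrix.diagonal ![x, y, z]) 0 1 ^ 2 =
    y * z * p ^ 2 + x * z * q ^ 2 + x * y * r ^ 2 := by
  refine ⟨t 1 0 * t 2 1 - t 2 0 * t 1 1, t 0 0 * t 2 1 - t 2 0 * t 0 1,
    t 0 0 * t 1 1 - t 1 0 * t 0 1, fun x y z => ?_⟩
  rw [conicImage_inv]
  simp [Matrix.mul_apply, Fin.sum_univ_three]
  ring

variable {m S C S' C' : ℝ}

/-- Eliminating w₂ from the two equations leaves S' - S times a form with positive coefficients in
w₀², w₁². So w₀ = w₁ = 0, and then w₂ = 0 because m ≠ 0. -/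
theorem disjoint_locus_diagonal (hm : 0 < m) (hm1 : m < 1) (hS : 0 < S) (hC : 0 < C)
    (hS' : 0 < S') (hC' : 0 < C') (h : S + C = 1) (h' : S' + C' = 1) (hne : S ≠ S') :
    Disjoint (locus (Matrix.diagonal ![1 / S, -((1 - m) / C), -m]))
      (locus (Matrix.diagonal ![1 / S', -((1 - m) / C'), -m])) := by
  rw [Set.disjoint_left]
  intro p hp hp'
  induction p using Projectivization.ind with | h w hw =>
  rw [mk_mem_locus] at hp hp'
  have e (x y z : ℝ) : quad (Matrix.diagonal ![x, y, z]) w = x * w 0 ^ 2 + y * w 1 ^ 2 + z * w 2 ^ 2 := by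
    simp [quad, Matrix.mulVec_diagonal, dotProduct, Fin.sum_univ_three]
    ring
  rw [e] at hp hp'
  have hb : 0 < 1 - m := by linarith
  have key : (S' - S) * (C * C' * w 0 ^ 2 + (1 - m) * S * S' * w 1 ^ 2) = 0 := by
    field_simp at hp hp'
    obtain rfl : C = 1 - S := by linarith
    obtain rfl : C' = 1 - S' := by linarith
    linear_combination S' * (1 - S') * hp - S * (1 - S) * hp'
  have h1 := (mul_eq_zero.1 key).resolve_left (sub_ne_zero.2 hne.symm)
  have p0 : 0 ≤ C * C' * w 0 ^ 2 := by positivity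
  have p1 : 0 ≤ (1 - m) * S * S' * w 1 ^ 2 := by positivity
  have z0 : C * C' * w 0 ^ 2 = 0 := by linarith
  have z1 : (1 - m) * S * S' * w 1 ^ 2 = 0 := by linarith
  have w0 : w 0 = 0 := by simpa [hC.ne', hC'.ne'] using z0
  have w1 : w 1 = 0 := by simpa [hb.ne', hS.ne', hS'.ne'] using z1
  have w2 : w 2 = 0 := by simpa [w0, w1, hm.ne'] using hp
  exact hw (by ext i; fin_cases i <;> simp [w0, w1, w2])

end Conics

/-! ### The Poncelet grid -/

section Poncelet

variable {n : ℕ} {m K A B u₀ δ s s' : ℝ} {φ : ℝ → ℝ} {γ Γ : Mat ℝ} {t : GL (Fin 3) ℝ}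
  {ℓ : ZMod n → Line ℝ}

theorem conicImage_diagGL_mul {e : ℝ} (he : e ≠ 0) (t : GL (Fin 3) ℝ) (x y z : ℝ) :
    conicImage (diagGL 1 e one_ne_zero he * t) (conicImage t⁻¹ (Matrix.diagonal ![x, y, z])) =
      Matrix.diagonal ![x, y / e ^ 2, z] := by
  rw [conicImage_mul, conicImage_conicImage_inv, conicImage_diagGL, one_pow, div_one]

/-- Diagonal maps commute with the final scaling in T, so it suffices to work in the normal form
coordinates. -/
theorem linearlyEquivalent_of_diagGL {e : ℝ} (he : e ≠ 0) (t : GL (Fin 3) ℝ) {X Y : Set (Plane ℝ)}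
    (h : ∃ a b ha hb, diagGL a b ha hb • t • X = t • Y) :
    LinearlyEquivalent (diagGL 1 e one_ne_zero he * t) X Y := by
  obtain ⟨a, b, ha, hb, h⟩ := h
  refine ⟨diagGL a b ha hb, isLinear_diagGL ha hb, ?_⟩
  have hcomm : diagGL a b ha hb * diagGL 1 e one_ne_zero he =
      diagGL 1 e one_ne_zero he * diagGL a b ha hb := by
    rw [diagGL_mul, diagGL_mul]
    congr 1 <;> ring
  have hmul : (diagGL 1 e one_ne_zero he * t)⁻¹ * diagGL a b ha hb * (diagGL 1 e one_ne_zero he * t) =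
      t⁻¹ * (diagGL a b ha hb * t) := by
    rw [mul_assoc, ← mul_assoc (diagGL a b ha hb), hcomm]
    group
  rw [hmul, mul_smul, mul_smul, h, inv_smul_smul]

theorem mem_locus_conicImage_inv (t : GL (Fin 3) ℝ) (M : Mat ℝ) (p : Plane ℝ) :
    p ∈ locus (conicImage t⁻¹ M) ↔ t • p ∈ locus M := by
  rw [← smul_mem_locus_conicImage t, conicImage_conicImage_inv]

namespace IsAmplitude

theorem cn_abs (h : IsAmplitude m K φ) (x : ℝ) : cn φ |x| = cn φ x := by
  rcases abs_choice x with hx | hx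
  · rw [hx]
  · rw [hx, h.cn_neg]

theorem cn_sq_lt_cn_sq (h : IsAmplitude m K φ) {x y : ℝ} (hx : 0 ≤ x) (hxy : x < y) (hy : y < K) :
    cn φ y ^ 2 < cn φ x ^ 2 := by
  have h1 := h.strictMono.monotone hx
  have h2 := h.strictMono hxy
  have h3 := h.strictMono hy
  rw [h.map_zero] at h1
  rw [h.map_K] at h3
  have h4 : 0 < cn φ y := Real.cos_pos_of_mem_Ioo ⟨by linarith [Real.pi_pos], h3⟩
  have h5 : cn φ y < cn φ x := Real.cos_lt_cos_of_nonneg_of_le_pi_div_two h1 h3.le h2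
  exact pow_lt_pow_left₀ h5 h4.le two_ne_zero

/-- For k ≤ (n - 1)/2 one has |kδ| = 2kK/n < K, in the range where cn² is strictly decreasing. -/
theorem cn_natCast_mul_sq_lt (h : IsAmplitude m K φ) (hn : Odd n)
    (hδ : n * δ = 2 * K ∨ n * δ = -(2 * K)) {j k : ℕ} (hjk : j < k) (hk : k ≤ (n - 1) / 2) :
    cn φ (k * δ) ^ 2 < cn φ (j * δ) ^ 2 := by
  have hn0 : (0 : ℝ) < n := by exact_mod_cast hn.pos
  have hK := h.K_pos
  have habs : n * |δ| = 2 * K := by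
    rcases hδ with hδ | hδ
    · rw [← abs_of_pos hn0, ← abs_mul, hδ, abs_of_pos (by linarith)]
    · rw [← abs_of_pos hn0, ← abs_mul, hδ, abs_neg, abs_of_pos (by linarith)]
  have hδ0 : 0 < |δ| := pos_of_mul_pos_right (by rw [habs]; linarith) hn0.le
  have e (i : ℕ) : cn φ (i * δ) = cn φ (i * |δ|) := by
    rw [← h.cn_abs (i * δ), abs_mul, Nat.abs_cast]
  rw [e, e]
  refine h.cn_sq_lt_cn_sq (by positivity) (mul_lt_mul_of_pos_right (by exact_mod_cast hjk) hδ0) ?_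
  have h1 : 2 * (k : ℝ) < n := by
    have := hn.pos
    exact_mod_cast (by omega : 2 * k < n)
  have h2 := mul_lt_mul_of_pos_right h1 hδ0
  linarith

theorem dn_sq_eq (h : IsAmplitude m K φ) (x : ℝ) : dn m φ x ^ 2 = 1 - m + m * cn φ x ^ 2 := by
  have h1 := h.dn_sq x
  have h2 := sn_sq_add_cn_sq φ x
  linear_combination h1 - m * h2

theorem gridP_subset_locus (h : IsAmplitude m K φ) (hn : Odd n)
    (hδ : n * δ = 2 * K ∨ n * δ = -(2 * K))
    (hℓ : ∀ i : ℤ, ℓ i = tangentLine φ (u₀ + 2 * i * δ)) (k : ℕ) :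
    gridP (axisConic 1 1) ℓ k ⊆ locus (axisConic (dn m φ (k * δ) ^ 2 / cn φ (k * δ) ^ 2)
      (1 / cn φ (k * δ) ^ 2)) := by
  have hP := h.gridP_eq hn.pos.ne' hδ hℓ k
  rw [Int.cast_natCast] at hP
  rw [hP]
  rintro _ ⟨j, rfl⟩
  have hc : cn φ (k * δ) ≠ 0 := by simpa using h.cn_int_mul_ne_zero hn hδ k
  have hd := (h.dn_pos (k * δ)).ne'
  simp only [Int.cast_natCast]
  rw [point, mk_mem_locus, quad_axisConic]
  have e := sn_sq_add_cn_sq φ (u₀ + (2 * j + k) * δ)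
  simp only [Matrix.cons_val_zero, Matrix.cons_val_one, Matrix.cons_val]
  field_simp
  linear_combination cn φ (k * δ) ^ 2 * e

theorem gridQ_subset_locus (h : IsAmplitude m K φ) (hn : Odd n)
    (hδ : n * δ = 2 * K ∨ n * δ = -(2 * K))
    (hℓ : ∀ i : ℤ, ℓ i = tangentLine φ (u₀ + 2 * i * δ)) (k : ℤ)
    (hs : sn φ (u₀ + k * δ) ≠ 0) (hc : cn φ (u₀ + k * δ) ≠ 0) :
    gridQ (axisConic 1 1) ℓ k ⊆ locus (Matrix.diagonal ![1 / sn φ (u₀ + k * δ) ^ 2,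
      -((1 - m) / cn φ (u₀ + k * δ) ^ 2), -m]) := by
  rw [h.gridQ_eq hn.pos.ne' hδ hℓ k]
  rintro _ ⟨j, rfl⟩
  simp only
  rw [point, mk_mem_locus]
  have e := h.dn_sq_eq ((k - 2 * j) * δ)
  generalize ((k : ℝ) - 2 * j) * δ = y at e ⊢
  simp [quad, Matrix.mulVec_diagonal, dotProduct, Fin.sum_univ_three]
  field_simp
  linear_combination e

end IsAmplitude

/-- The sets `P_k` lie on nested confocal ellipses. -/
theorem exists_ellipses (h : IsAmplitude m K φ) (hs : s ≠ 0) (hs' : s' ≠ 0) (hA : 1 < A)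
    (hB : 1 < B) (hAB : A - 1 = (1 - m) * (B - 1)) (hγ : conicImage t γ = s • axisConic 1 1)
    (hΓ : conicImage t Γ = s' • axisConic A B) (hlocus : t • locus γ = locus (axisConic 1 1))
    {e : ℝ} (he : e ≠ 0) (he2 : e ^ 2 = 1 - m) (hn : Odd n)
    (hδ : n * δ = 2 * K ∨ n * δ = -(2 * K))
    (hℓ : ∀ i : ℤ, dual t • ℓ i = tangentLine φ (u₀ + 2 * i * δ)) :
    ∃ E : ℕ → Mat ℝ,
      (∀ k ≤ (n - 1) / 2,
        IsEllipse (conicImage (diagGL 1 e one_ne_zero he * t) (E k)) ∧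
        gridP γ ℓ (k : ZMod n) ⊆ locus (E k) ∧
        ∀ u ∈ commonTangents γ Γ, IsTangent (complexify (E k)) u) ∧
      ∀ j k, j < k → k ≤ (n - 1) / 2 →
        Nested (conicImage (diagGL 1 e one_ne_zero he * t) (E j))
          (conicImage (diagGL 1 e one_ne_zero he * t) (E k)) := by
  have hc (k : ℕ) : cn φ (k * δ) ≠ 0 := by simpa using h.cn_int_mul_ne_zero hn hδ k
  have hc2 (k : ℕ) : 0 < cn φ (k * δ) ^ 2 := by have := hc k; positivity
  have hd2 (k : ℕ) : 0 < dn m φ (k * δ) ^ 2 := pow_pos (h.dn_pos _) 2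
  have hb : 0 < 1 - m := by linarith [h.m_lt_one]
  have himage (k : ℕ) : conicImage (diagGL 1 e one_ne_zero he * t) (conicImage t⁻¹
      (axisConic (dn m φ (k * δ) ^ 2 / cn φ (k * δ) ^ 2) (1 / cn φ (k * δ) ^ 2))) =
      axisConic (dn m φ (k * δ) ^ 2 / cn φ (k * δ) ^ 2) ((1 - m) / cn φ (k * δ) ^ 2) := by
    rw [axisConic, conicImage_diagGL_mul, axisConic, he2]
    congr 2
    have := hc k
    field_simp
  refine ⟨fun k => conicImage t⁻¹ (axisConic (dn m φ (k * δ) ^ 2 / cn φ (k * δ) ^ 2)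
    (1 / cn φ (k * δ) ^ 2)), fun k _ => ⟨?_, ?_, fun u hu => ?_⟩, fun j k hjk hk => ?_⟩
  · rw [himage]
    exact isEllipse_axisConic (div_pos (hd2 k) (hc2 k)) (div_pos hb (hc2 k))
  · intro p hp
    rw [mem_locus_conicImage_inv]
    refine h.gridP_subset_locus (ℓ := fun i => dual t • ℓ i) hn hδ hℓ k ?_
    rw [gridP_dual hlocus]
    exact Set.smul_mem_smul_set hp
  · refine isTangent_of_mem_commonTangents hs hs' hA hB hAB hγ hΓ ?_ ?_ (by norm_num) ?_ hu
    · exact one_div_ne_zero (div_pos (hd2 k) (hc2 k)).ne'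
    · exact one_div_ne_zero (one_div_pos.2 (hc2 k)).ne'
    · have h1 := h.dn_sq_eq (k * δ)
      have := hc k
      have := (h.dn_pos (k * δ)).ne'
      field_simp
      linear_combination -cn φ (k * δ) ^ 2 * h1
  · have hlt := h.cn_natCast_mul_sq_lt hn hδ hjk hk
    have hdiv : (1 - m) / cn φ (j * δ) ^ 2 < (1 - m) / cn φ (k * δ) ^ 2 :=
      div_lt_div_of_pos_left hb (hc2 k) hlt
    -- The squared semi-axes differ by the constant m: the ellipses are confocal, so both axes grow
    -- together.
    have hd (i : ℕ) : dn m φ (i * δ) ^ 2 / cn φ (i * δ) ^ 2 = m + (1 - m) / cn φ (i * δ) ^ 2 := by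
      rw [h.dn_sq_eq, add_div, mul_div_cancel_right₀ _ (hc2 i).ne', add_comm]
    rw [himage, himage]
    refine nested_axisConic (div_pos (hd2 j) (hc2 j)) (div_pos hb (hc2 j)) ?_ hdiv
    rw [hd, hd]
    linarith

/-- The sets `Q_k` lie on disjoint confocal hyperbolas. -/
theorem exists_hyperbolas (h : IsAmplitude m K φ) (hγe : IsEllipse γ) (hs : s ≠ 0) (hs' : s' ≠ 0)
    (hA : 1 < A) (hB : 1 < B) (hAB : A - 1 = (1 - m) * (B - 1))
    (hγ : conicImage t γ = s • axisConic 1 1) (hΓ : conicImage t Γ = s' • axisConic A B)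
    (hlocus : t • locus γ = locus (axisConic 1 1)) {e : ℝ} (he : e ≠ 0) (he2 : e ^ 2 = 1 - m)
    (hn : Odd n) (hδ : n * δ = 2 * K ∨ n * δ = -(2 * K))
    (hℓ : ∀ i : ℤ, dual t • ℓ i = tangentLine φ (u₀ + 2 * i * δ)) (hm0 : m ≠ 0)
    (hsc : ∀ k : ℤ, sn φ (u₀ + k * δ) ≠ 0 ∧ cn φ (u₀ + k * δ) ≠ 0) :
    ∃ H : ZMod n → Mat ℝ,
      (∀ k, IsHyperbola (H k) ∧
        IsHyperbola (conicImage (diagGL 1 e one_ne_zero he * t) (H k)) ∧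
        gridQ γ ℓ k ⊆ locus (H k) ∧
        ∀ u ∈ commonTangents γ Γ, IsTangent (complexify (H k)) u) ∧
      ∀ j k, j ≠ k → Disjoint (locus (H j)) (locus (H k)) := by
  have hm : 0 < m := lt_of_le_of_ne h.m_nonneg hm0.symm
  have hb : 0 < 1 - m := by linarith [h.m_lt_one]
  -- Even representatives 2l of the indices, as needed for `sn_sq_injective`.
  choose l hl using exists_two_mul_intCast_eq hn
  set α : ZMod n → ℝ := fun k => u₀ + ((2 * l k : ℤ) : ℝ) * δ with hα
  have hS (k : ZMod n) : 0 < sn φ (α k) ^ 2 := by have := (hsc (2 * l k)).1; positivity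
  have hC (k : ZMod n) : 0 < cn φ (α k) ^ 2 := by have := (hsc (2 * l k)).2; positivity
  have hSC (k : ZMod n) := sn_sq_add_cn_sq φ (α k)
  have hxy (k : ZMod n) : 1 / sn φ (α k) ^ 2 * -((1 - m) / cn φ (α k) ^ 2) < 0 :=
    mul_neg_of_pos_of_neg (one_div_pos.2 (hS k)) (neg_lt_zero.2 (div_pos hb (hC k)))
  have hdiag (k : ZMod n) : IsHyperbola (Matrix.diagonal ![1 / sn φ (α k) ^ 2,
      -((1 - m) / cn φ (α k) ^ 2), -m]) := isHyperbola_diagonal (hxy k) (neg_ne_zero.2 hm0)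
  refine ⟨fun k => conicImage t⁻¹ (Matrix.diagonal ![1 / sn φ (α k) ^ 2,
    -((1 - m) / cn φ (α k) ^ 2), -m]), fun k => ⟨⟨?_, ?_, ?_⟩, ?_, ?_, fun u hu => ?_⟩,
    fun j k hjk => ?_⟩
  · exact isSymm_conicImage (hdiag k).1 _
  -- In the original chart the type of the conic depends on the line at infinity. As γ is an
  -- ellipse, this line misses it, that is, p² + q² < r²; this makes the minor of H_k negative.
  · obtain ⟨p, q, r, hpqr⟩ := conicImage_inv_minor t
    have h1 := hγe.2.1
    rw [← conicImage_inv_conicImage t γ, hγ, smul_axisConic, hpqr] at h1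
    simp only [div_one] at h1
    have h2 : p ^ 2 + q ^ 2 < r ^ 2 := by
      have h3 : 0 < s ^ 2 * (r ^ 2 - p ^ 2 - q ^ 2) := by linarith
      have := pos_of_mul_pos_right h3 (sq_nonneg s)
      linarith
    rw [hpqr]
    have hS1 : sn φ (α k) ^ 2 < 1 := by linarith [hSC k, hC k]
    have h4 : m * sn φ (α k) ^ 2 * p ^ 2 ≤ 1 * p ^ 2 := by
      refine mul_le_mul_of_nonneg_right ?_ (sq_nonneg p)
      exact mul_le_one₀ h.m_lt_one.le (hS k).le hS1.le
    have h5 : 0 ≤ m * cn φ (α k) ^ 2 * q ^ 2 := by positivity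
    have h6 : (1 - m) * (m * sn φ (α k) ^ 2 * p ^ 2 - r ^ 2) < 0 :=
      mul_neg_of_pos_of_neg hb (by nlinarith [sq_nonneg q])
    have h7 : -((1 - m) / cn φ (α k) ^ 2) * -m * p ^ 2 + 1 / sn φ (α k) ^ 2 * -m * q ^ 2 +
        1 / sn φ (α k) ^ 2 * -((1 - m) / cn φ (α k) ^ 2) * r ^ 2 =
        ((1 - m) * (m * sn φ (α k) ^ 2 * p ^ 2 - r ^ 2) - m * cn φ (α k) ^ 2 * q ^ 2) /
          (sn φ (α k) ^ 2 * cn φ (α k) ^ 2) := by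
      have hsk : sn φ (α k) ≠ 0 := (hsc (2 * l k)).1
      have hck : cn φ (α k) ≠ 0 := (hsc (2 * l k)).2
      field_simp
      ring
    rw [h7]
    exact div_neg_of_neg_of_pos (by linarith) (mul_pos (hS k) (hC k))
  · exact det_conicImage_ne_zero (hdiag k).2.2 _
  · rw [conicImage_diagGL_mul, he2]
    refine isHyperbola_diagonal ?_ (neg_ne_zero.2 hm0)
    rw [← mul_div_assoc]
    exact div_neg_of_neg_of_pos (hxy k) hb
  · intro p hp
    rw [mem_locus_conicImage_inv]
    refine h.gridQ_subset_locus (ℓ := fun i => dual t • ℓ i) hn hδ hℓ (2 * l k) (hsc _).1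
      (hsc _).2 ?_
    rw [hl, gridQ_dual hlocus]
    exact Set.smul_mem_smul_set hp
  · refine isTangent_of_mem_commonTangents hs hs' hA hB hAB hγ hΓ (one_div_pos.2 (hS k)).ne'
      (neg_ne_zero.2 (div_pos hb (hC k)).ne') (neg_ne_zero.2 hm0) ?_ hu
    have hsk : sn φ (α k) ≠ 0 := (hsc (2 * l k)).1
    have hck : cn φ (α k) ≠ 0 := (hsc (2 * l k)).2
    field_simp
    linear_combination (m - m ^ 2) * hSC k
  · rw [Set.disjoint_left]
    intro p hp hp'
    rw [mem_locus_conicImage_inv] at hp hp'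
    refine Set.disjoint_left.1 (disjoint_locus_diagonal hm h.m_lt_one (hS j) (hC j) (hS k) (hC k)
      (hSC j) (hSC k) fun heq => hjk ?_) hp hp'
    have := h.sn_sq_injective (n := n) hδ hsc (k := l j) (l := l k) (by
      simpa [hα] using heq)
    rw [← hl j, ← hl k, this]

end Poncelet

end PonceletGrid

end

/-! ### The main theorem -/

theorem theorem1 (γ Γ : PonceletGrid.Mat ℝ)
    (hγ : PonceletGrid.IsEllipse γ) (hΓ : PonceletGrid.IsEllipse Γ)
    (hnest : PonceletGrid.Nested γ Γ) :
    (¬ PonceletGrid.ProjectivelyConcentric γ Γ →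
      (PonceletGrid.commonTangents γ Γ).ncard = 4) ∧
    ∃ T : GL (Fin 3) ℝ,
      PonceletGrid.AreConfocal (PonceletGrid.conicImage T γ) (PonceletGrid.conicImage T Γ) ∧
      ∀ (n : ℕ), Odd n → 3 ≤ n →
      ∀ (v : ZMod n → PonceletGrid.Plane ℝ) (ℓ : ZMod n → PonceletGrid.Line ℝ),
        PonceletGrid.IsPonceletPolygon γ Γ v → PonceletGrid.IsCyclicEnumeration γ v ℓ →
        -- the sets `P_k` lie on nested ellipses with the common tangents of `γ` and `Γ`
        (∃ E : ℕ → PonceletGrid.Mat ℝ,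
          (∀ k ≤ (n - 1) / 2,
            PonceletGrid.IsEllipse (PonceletGrid.conicImage T (E k)) ∧
            PonceletGrid.gridP γ ℓ (k : ZMod n) ⊆ PonceletGrid.locus (E k) ∧
            ∀ u ∈ PonceletGrid.commonTangents γ Γ,
              PonceletGrid.IsTangent (PonceletGrid.complexify (E k)) u) ∧
          ∀ j k, j < k → k ≤ (n - 1) / 2 →
            PonceletGrid.Nested (PonceletGrid.conicImage T (E j))
              (PonceletGrid.conicImage T (E k))) ∧
        -- the sets `P_k` are equivalent to each other
        (∀ j k : ZMod n, PonceletGrid.LinearlyEquivalent T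
          (PonceletGrid.gridP γ ℓ j) (PonceletGrid.gridP γ ℓ k)) ∧
        -- the same for the sets `Q_k`, with disjoint hyperbolas
        (PonceletGrid.HasNoSymmetry γ Γ v →
          (∃ H : ZMod n → PonceletGrid.Mat ℝ,
            (∀ k,
              PonceletGrid.IsHyperbola (H k) ∧
              PonceletGrid.IsHyperbola (PonceletGrid.conicImage T (H k)) ∧
              PonceletGrid.gridQ γ ℓ k ⊆ PonceletGrid.locus (H k) ∧
              ∀ u ∈ PonceletGrid.commonTangents γ Γ,
                PonceletGrid.IsTangent (PonceletGrid.complexify (H k)) u) ∧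
            ∀ j k, j ≠ k → Disjoint (PonceletGrid.locus (H j)) (PonceletGrid.locus (H k))) ∧
          ∀ j k : ZMod n, PonceletGrid.LinearlyEquivalent T
            (PonceletGrid.gridQ γ ℓ j) (PonceletGrid.gridQ γ ℓ k)) := by
  open PonceletGrid in
  obtain ⟨t, s, s', A, B, hs, hs', hA, hAB, hγt, hΓt⟩ := exists_normalForm hγ hΓ hnest
  have hB : 1 < B := by linarith
  -- With this m, Γ belongs to the family of ellipses traced by the intersections of tangents with a
  -- fixed parameter difference; A ≤ B gives m ≥ 0.
  obtain ⟨m, hm⟩ : ∃ m, m = 1 - (A - 1) / (B - 1) := ⟨_, rfl⟩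
  have hAB' : A - 1 = (1 - m) * (B - 1) := by
    rw [hm, sub_sub_cancel, div_mul_cancel₀]
    linarith
  have hm0 : 0 ≤ m := by
    rw [hm, sub_nonneg, div_le_one (by linarith)]
    linarith
  have hm1 : m < 1 := by
    have : 0 < (A - 1) / (B - 1) := div_pos (by linarith) (by linarith)
    linarith
  have hb : 0 < 1 - m := by linarith
  have hγl : t • locus γ = locus (axisConic 1 1) := by rw [smul_locus, hγt, locus_smul hs]
  have hΓl : t • locus Γ = locus (axisConic A B) := by rw [smul_locus, hΓt, locus_smul hs']
  obtain ⟨K, φ, h⟩ := exists_isAmplitude hm0 hm1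
  have he : √(1 - m) ≠ 0 := (Real.sqrt_pos.2 hb).ne'
  have he2 : √(1 - m) ^ 2 = 1 - m := Real.sq_sqrt hb.le
  refine ⟨fun hnc => ?_, diagGL 1 (√(1 - m)) one_ne_zero he * t, ?_, ?_⟩
  · refine ncard_commonTangents hs hs' hA hB hAB' hγt hΓt (lt_of_le_of_ne hm0 ?_) hm1
    rintro rfl
    obtain rfl : A = B := by linarith
    refine hnc ⟨t, 1, √A, one_pos, Real.sqrt_pos.2 (by linarith), ?_, ?_⟩
    · rw [hγl, one_pow]
    · rw [hΓl, Real.sq_sqrt (by linarith)]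
  -- The scaling multiplies the second squared semi-axes by 1 - m, giving (1, 1 - m) and (A, (1 -
  -- m)B); both grow by A - 1 by the choice of m.
  · refine ⟨1, 1 - m, A - 1, one_pos, hb, by linarith, ?_, ?_⟩
    · rw [conicImage_mul, hγt, conicImage_smul, locus_smul hs, axisConic, conicImage_diagGL, he2,
        axisConic]
      simp
    · rw [conicImage_mul, hΓt, conicImage_smul, locus_smul hs', axisConic, conicImage_diagGL, he2,
        axisConic, show 1 - m + (A - 1) = (1 - m) * B by linarith, add_sub_cancel, one_pow, div_one,
        div_div, mul_comm B]
  · intro n hn hn3 v ℓ hv hcyc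
    have hv' := hv.smul hγl hΓl
    have hcyc' := hcyc.smul hγl
    obtain ⟨t₀, ht₀⟩ := h.exists_isSide_eq hA hAB' hn3 hv'
    obtain ⟨u₀, δ, hδ, hℓ⟩ := h.exists_enumeration hn3 hcyc' ht₀
    refine ⟨exists_ellipses h hs hs' hA hB hAB' hγt hΓt hγl he he2 hn hδ hℓ, fun j k => ?_,
      fun hsym => ?_⟩
    · refine linearlyEquivalent_of_diagGL he t ?_
      rw [← gridP_dual hγl, ← gridP_dual hγl]
      exact h.exists_diagGL_smul_gridP hn hδ hℓ j k
    · obtain ⟨hm', hsc⟩ := h.ne_zero_of_hasNoSymmetry hA hAB' hn3 hv' hcyc'.1 hδ hℓ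
        (hsym.smul hγl hΓl)
      refine ⟨exists_hyperbolas h hγ hs hs' hA hB hAB' hγt hΓt hγl he he2 hn hδ hℓ hm' hsc,
        fun j k => ?_⟩
      refine linearlyEquivalent_of_diagGL he t ?_
      rw [← gridQ_dual hγl, ← gridQ_dual hγl]
      exact h.exists_diagGL_smul_gridQ hn hδ hℓ hsc j k
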